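/- **Definitions.** For $m\ge 3$ let $P_m$ be the boundary complex of an $m$-gon. For a simplicial complex $K$ and a vertex $v$ of $K$, the simplicial wedge $\operatorname{wed}_v K$ is the complex obtained by replacing $v$ by two vertices $v_1,v_2$, with $$\operatorname{wed}_vK=\bigl(\{v_1,v_2\}*\operatorname{lk}_K(v)\bigr)\cup\bigl(\{\{v_1\},\{v_2\}\}*(K\setminus v)\bigr),$$ where in the first term $\{v_1,v_2\}$ is a full edge and $K\setminus v$ is the deletion of $v$. For $J=(j_1,\dots,j_m)\in\mathbb Z_{+}^m$ (positive integers) let $P_m(J)$ be the complex obtained from $P_m$ by iterated simplicial wedges in which the vertex $i$ is replaced by $j_i$ vertices; explicitly, its minimal non-faces are the sets $\{(i,k): i\in\tau,\ 1\le k\le j_i\}$ with $\tau$ a minimal non-face of $P_m$. A toric manifold over a simplicial complex $K$ is the complex toric variety $X_\Sigma$ of a complete non-singular fan $\Sigma$ in some $\mathbb R^n$ (with lattice $\mathbb Z^n$) whose underlying simplicial complex (vertices: the rays of $\Sigma$; faces: the sets of rays of cones of $\Sigma$) is isomorphic to $K$. It is projective if it embeds over $\mathbb C$ as a closed subscheme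 of some $\mathbb P^N_{\mathbb C}$. A simplicial fan $\Sigma$ is strongly polytopal if there is a simplicial polytope $P$ with $0\in\operatorname{relint}P$ such that the cones of $\Sigma$ are exactly the cones spanned by the proper faces of $P$ (the empty face spanning $\{0\}$). A simplicial complex $K$ is strongly combinatorially Delzant if it is polytopal (the boundary complex of a simplicial polytope), there is a projective toric manifold over $K$, and every toric manifold over $K$ is projective. **Theorem.** Let $m\ge 3$ and $J\in\mathbb Z_{+}^m$. Then every toric manifold $X_\Sigma$ over $P_m(J)$ is projective, and its fan $\Sigma$ is strongly polytopal. Moreover, $P_m(J)$ is strongly combinatorially Delzant. -/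

import Mathlib

open CategoryTheory CategoryTheory.Limits AlgebraicGeometry

noncomputable section

namespace ToricWedge

/-! ### Simplicial complexes: polygons and simplicial wedges -/

section Complexes

variable {V W : Type*}

/-- The boundary complex `P_m` of an `m`-gon, for `m ≥ 3`: the vertices are `0, …, m - 1` and the
edges are the pairs of cyclically consecutive vertices. -/
def polygon (m : ℕ) : AbstractSimplicialComplex (Fin m) where
  faces := {s | s.Nonempty ∧ ∃ i, s ⊆ {i, finRotate m i}}
  isRelLowerSet_faces := fun _ ⟨hs, i, hi⟩ => ⟨hs, fun _ ht hne => ⟨hne, i, ht.trans hi⟩⟩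
  singleton_mem v := ⟨Finset.singleton_nonempty v, v, by simp⟩

/-- The faces of the simplicial wedge of `K` at the vertex `v`. Its vertices are those of `K`
together with one new vertex `none`, the twin of `some v`. It is the union of the join of the edge
`{some v, none}` with the link of `v`, and the join of the two points `some v`, `none` with the
deletion of `v`; here `s.eraseNone.erase v` is the set of the elements of `s` other than the twins.
-/
def wedgeFaces (K : AbstractSimplicialComplex V) (v : V) [DecidableEq V] :
    Set (Finset (Option V)) :=
  {s | s.Nonempty ∧
    (insert v (s.eraseNone.erase v) ∈ K.faces ∨
      ((s.eraseNone.erase v = ∅ ∨ s.eraseNone.erase v ∈ K.faces) ∧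
        ¬ (some v ∈ s ∧ none ∈ s)))}

/-- Given a surjection `π : W → V` onto the vertices of `K`, the complex on `W` in which a set is
a nonface if and only if it contains the full preimage of a nonface of `K`. -/
def inflate (K : AbstractSimplicialComplex V) (π : W → V) (hπ : Function.Surjective π) :
    AbstractSimplicialComplex W where
  faces := {s | s.Nonempty ∧
    ∀ t : Finset V, t.Nonempty → (∀ w, π w ∈ t → w ∈ s) → t ∈ K.faces}
  isRelLowerSet_faces := fun _ ⟨hs, h⟩ =>
    ⟨hs, fun _ hu hne => ⟨hne, fun t ht htu => h t ht fun w hw => hu (htu w hw)⟩⟩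
  singleton_mem w := by
    refine ⟨Finset.singleton_nonempty w, fun t ht h => ?_⟩
    have : t = {π w} := by
      refine Finset.eq_singleton_iff_nonempty_unique_mem.2 ⟨ht, fun x hx => ?_⟩
      obtain ⟨y, rfl⟩ := hπ x
      rw [Finset.mem_singleton.1 (h y hx)]
    exact this ▸ K.singleton_mem _

/-- The complex `K(J)`: every vertex `i` of `K` is replaced by `J i` copies, and the minimal
nonfaces of `K(J)` are the full preimages of the minimal nonfaces of `K`. By `inflate_id` and
`inflate_wedge` below, this is the complex obtained from `K` by iterated simplicial wedges,
`J i - 1` of them at (copies of) the vertex `i`. -/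
def multiWedge (K : AbstractSimplicialComplex V) (J : V → ℕ+) :
    AbstractSimplicialComplex (Σ i, Fin (J i)) :=
  inflate K Sigma.fst fun i => ⟨⟨i, ⟨0, (J i).pos⟩⟩, rfl⟩

theorem inflate_id (K : AbstractSimplicialComplex V) :
    inflate K id Function.surjective_id = K := by
  ext s
  constructor
  · rintro ⟨hs, h⟩
    exact h s hs fun _ h => h
  · intro hs
    exact ⟨(K.isRelLowerSet_faces hs).1, fun t ht h => (K.isRelLowerSet_faces hs).2 h ht⟩

/-- Doubling one element `w` of a fibre of `π` is the simplicial wedge at `w`. -/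
theorem inflate_wedge [DecidableEq W] (K : AbstractSimplicialComplex V)
    (π : W → V) (hπ : Function.Surjective π) (w : W)
    (hπ' : Function.Surjective fun o : Option W => π (o.getD w)) :
    (inflate K (fun o : Option W => π (o.getD w)) hπ').faces
      = wedgeFaces (inflate K π hπ) w := by
  ext s
  have key : ∀ u : Finset W, u.Nonempty → (u ∈ (inflate K π hπ).faces ↔
      ∀ t : Finset V, t.Nonempty → (∀ x, π x ∈ t → x ∈ u) → t ∈ K.faces) :=
    fun u hu => ⟨fun h => h.2, fun h => ⟨hu, h⟩⟩
  have hins : (insert w (s.eraseNone.erase w)).Nonempty := Finset.insert_nonempty _ _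
  refine and_congr_right fun hs => ?_
  rw [key _ hins]
  by_cases hab : some w ∈ s ∧ none ∈ s
  · simp only [hab, and_self, not_true, and_false, or_false]
    refine forall₂_congr fun t ht => imp_congr_left ⟨fun h x hx => ?_, fun h o ho => ?_⟩
    · have hx' := h (some x) hx
      simp only [Finset.mem_insert, Finset.mem_erase, Finset.mem_eraseNone]
      tauto
    · cases o with
      | none => exact hab.2
      | some x =>
        have := h x ho
        simp only [Finset.mem_insert, Finset.mem_erase, Finset.mem_eraseNone] at this
        rcases this with rfl | h
        · exact hab.1
        · exact h.2
  · have hA : (∀ t : Finset V, t.Nonempty →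
        (∀ o : Option W, π (o.getD w) ∈ t → o ∈ s) → t ∈ K.faces) ↔
        (∀ t : Finset V, t.Nonempty →
          (∀ x, π x ∈ t → x ∈ s.eraseNone.erase w) → t ∈ K.faces) := by
      refine forall₂_congr fun t ht => imp_congr_left ⟨fun h x hx => ?_, fun h o ho => ?_⟩
      · have hx' := h (some x) hx
        simp only [Finset.mem_erase, Finset.mem_eraseNone]
        refine ⟨?_, hx'⟩
        rintro rfl
        exact hab ⟨hx', h none hx⟩
      · cases o with
        | none => exact absurd (h w ho) (by simp)
        | some x => exact Finset.mem_eraseNone.1 (Finset.mem_of_mem_erase (h x ho))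
    simp only [hab, not_false_eq_true, and_true]
    rw [hA]
    constructor
    · intro h
      rcases Finset.eq_empty_or_nonempty (s.eraseNone.erase w) with he | hne
      · exact Or.inr (Or.inl he)
      · exact Or.inr (Or.inr ((key _ hne).2 h))
    · rintro (h | h | h)
      · exact fun t ht htr => h t ht fun x hx => Finset.mem_insert_of_mem (htr x hx)
      · intro t ht htr
        obtain ⟨y, hy⟩ := ht
        obtain ⟨x, rfl⟩ := hπ y
        exact absurd (htr x hy) (by simp [h])
      · exact h.2

end Complexes

/-! ### Fans -/

/-- The pairing of a character `u ∈ ℤⁿ` with a vector of `ℝⁿ`. -/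
def pairing {n : ℕ} (u : Fin n → ℤ) (x : Fin n → ℝ) : ℝ := ∑ i, (u i : ℝ) * x i

/-- A lattice vector as a real vector. -/
def toReal {n : ℕ} (v : Fin n → ℤ) : Fin n → ℝ := fun i => (v i : ℝ)

/-- `τ` is a face of the rational polyhedral cone `σ`: it is cut out of `σ` by a supporting
hyperplane. (A face of a rational polyhedral cone is cut out by a rational hyperplane, so the normal
vector may be taken in the lattice.) -/
def IsConeFace {n : ℕ} (τ σ : PointedCone ℝ (Fin n → ℝ)) : Prop :=
  ∃ u : Fin n → ℤ, (∀ x ∈ σ, 0 ≤ pairing u x) ∧ ∀ x, x ∈ τ ↔ x ∈ σ ∧ pairing u x = 0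

/-- A fan in `ℝⁿ`, with respect to the lattice `ℤⁿ`: a finite set of strongly convex rational
polyhedral cones that contains every face of each of its cones, and in which any two cones
intersect in a face of each (the second face condition follows by exchanging `σ` and `τ`). -/
structure Fan (n : ℕ) where
  cones : Set (PointedCone ℝ (Fin n → ℝ))
  finite : cones.Finite
  rational : ∀ σ ∈ cones, ∃ S : Finset (Fin n → ℤ), σ = PointedCone.hull ℝ (toReal '' (S : Set _))
  stronglyConvex : ∀ σ ∈ cones, ∀ x ∈ σ, -x ∈ σ → x = 0
  face_mem : ∀ σ ∈ cones, ∀ τ, IsConeFace τ σ → τ ∈ cones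
  inf_isFace : ∀ σ ∈ cones, ∀ τ ∈ cones, IsConeFace (σ ⊓ τ) σ

namespace Fan

variable {n : ℕ} (Δ : Fan n)

/-- The cones cover `ℝⁿ`. -/
def IsComplete : Prop := ∀ x, ∃ σ ∈ Δ.cones, x ∈ σ

/-- Every cone is generated by a part of a `ℤ`-basis of the lattice. -/
def IsNonsingular : Prop :=
  ∀ σ ∈ Δ.cones, ∃ (b : Module.Basis (Fin n) ℤ (Fin n → ℤ)) (s : Set (Fin n)),
    σ = PointedCone.hull ℝ ((fun i => toReal (b i)) '' s)

/-- The rays of the fan. -/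
def rays : Set (PointedCone ℝ (Fin n → ℝ)) :=
  {ρ | ρ ∈ Δ.cones ∧ ∃ v ≠ 0, ρ = PointedCone.hull ℝ {v}}

/-- The underlying simplicial complex of the (simplicial) fan is `K`: for some identification of
the vertices of `K` with the rays, the nonempty faces of `K` are the nonempty sets of rays of the
form "all the rays of `σ`", with `σ` a cone of the fan. -/
def IsOver {V : Type*} (K : AbstractSimplicialComplex V) : Prop :=
  ∃ e : V ≃ Δ.rays, ∀ s : Finset V, s.Nonempty →
    (s ∈ K.faces ↔ ∃ σ ∈ Δ.cones, ∀ v, v ∈ s ↔ (e v : PointedCone ℝ (Fin n → ℝ)) ≤ σ)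

end Fan

/-! ### Polytopes and polytopality -/

section Polytopes

variable {E : Type*} [AddCommGroup E] [Module ℝ E] [TopologicalSpace E]

/-- A proper face of a polytope `P`; the empty face is allowed. -/
def IsProperFace (P F : Set E) : Prop := IsExposed ℝ P F ∧ F ≠ P

/-- A simplicial polytope: the convex hull of finitely many points, all of whose proper faces are
simplices. -/
def IsSimplicialPolytope (P : Set E) : Prop :=
  (∃ S : Finset E, P = convexHull ℝ (S : Set E)) ∧
    ∀ F, IsProperFace P F →
      ∃ T : Finset E, AffineIndependent ℝ ((↑) : T → E) ∧ F = convexHull ℝ (T : Set E)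

end Polytopes

/-- There is a simplicial polytope `P` with `0` in its relative interior such that the cones of the
fan are exactly the cones spanned by the proper faces of `P` (the empty face spans `{0}`). -/
def Fan.IsStronglyPolytopal {n : ℕ} (Δ : Fan n) : Prop :=
  ∃ P : Set (Fin n → ℝ), IsSimplicialPolytope P ∧ 0 ∈ intrinsicInterior ℝ P ∧
    Δ.cones = {σ | ∃ F, IsProperFace P F ∧ σ = PointedCone.hull ℝ F}

/-- `K` is the boundary complex of a simplicial polytope. -/
def IsPolytopal {V : Type*} (K : AbstractSimplicialComplex V) : Prop :=
  ∃ (d : ℕ) (P : Set (Fin d → ℝ)), IsSimplicialPolytope P ∧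
    ∃ e : V ≃ P.extremePoints ℝ, ∀ s : Finset V, s.Nonempty →
      (s ∈ K.faces ↔ ∃ F, IsProperFace P F ∧ ∀ v, v ∈ s ↔ (e v : Fin d → ℝ) ∈ F)

/-! ### The toric variety of a fan -/

section Charts

variable {n : ℕ}

/-- The monoid `σ^∨ ∩ ℤⁿ`. -/
def dualMonoid (σ : PointedCone ℝ (Fin n → ℝ)) : AddSubmonoid (Fin n → ℤ) where
  carrier := {u | ∀ x ∈ σ, 0 ≤ pairing u x}
  zero_mem' := fun x _ => by simp [pairing]
  add_mem' := fun {a b} ha hb x hx => by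
    have := add_nonneg (ha x hx) (hb x hx)
    simpa [pairing, add_mul, Finset.sum_add_distrib] using this

theorem dualMonoid_anti {τ σ : PointedCone ℝ (Fin n → ℝ)} (h : τ ≤ σ) :
    dualMonoid σ ≤ dualMonoid τ := fun _ hu x hx => hu x (h hx)

/-- The coordinate ring `ℂ[σ^∨ ∩ ℤⁿ]` of the affine toric variety `U_σ`. -/
abbrev coordRing (σ : PointedCone ℝ (Fin n → ℝ)) : Type := AddMonoidAlgebra ℂ (dualMonoid σ)

/-- The inclusion `ℂ[σ^∨ ∩ ℤⁿ] → ℂ[τ^∨ ∩ ℤⁿ]` for `τ ≤ σ`. -/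
def coordRingMap {τ σ : PointedCone ℝ (Fin n → ℝ)} (h : τ ≤ σ) : coordRing σ →+* coordRing τ :=
  AddMonoidAlgebra.mapDomainRingHom ℂ (AddSubmonoid.inclusion (dualMonoid_anti h))

theorem coordRingMap_single {τ σ : PointedCone ℝ (Fin n → ℝ)} (h : τ ≤ σ) (u : dualMonoid σ)
    (c : ℂ) : coordRingMap h (AddMonoidAlgebra.single u c) =
      AddMonoidAlgebra.single (AddSubmonoid.inclusion (dualMonoid_anti h) u) c := by
  simp [coordRingMap]

theorem coordRingMap_injective {τ σ : PointedCone ℝ (Fin n → ℝ)} (h : τ ≤ σ) :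
    Function.Injective (coordRingMap h) :=
  AddMonoidAlgebra.mapDomain_injective (AddSubmonoid.inclusion_injective _)

/-- If `τ` is the face of `σ` cut out by `u`, then `ℂ[τ^∨ ∩ ℤⁿ]` is the localization of
`ℂ[σ^∨ ∩ ℤⁿ]` at the character of `u`. -/
theorem isLocalization_coordRingMap {τ σ : PointedCone ℝ (Fin n → ℝ)} (h : τ ≤ σ)
    (hσ : ∃ S : Finset (Fin n → ℤ), σ = PointedCone.hull ℝ (toReal '' (S : Set _)))
    (u : dualMonoid σ) (hu : ∀ x, x ∈ τ ↔ x ∈ σ ∧ pairing (u : Fin n → ℤ) x = 0) :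
    letI := (coordRingMap h).toAlgebra
    IsLocalization.Away (AddMonoidAlgebra.single u 1 : coordRing σ) (coordRing τ) := by
  let := (coordRingMap h).toAlgebra
  have halg : ∀ a, algebraMap (coordRing σ) (coordRing τ) a = coordRingMap h a := fun _ => rfl
  have hpow : ∀ N : ℕ, (AddMonoidAlgebra.single u 1 : coordRing σ) ^ N =
      AddMonoidAlgebra.single (N • u) 1 := fun N => by simp [AddMonoidAlgebra.single_pow]
  obtain ⟨S, hS⟩ := hσ
  have hgen : ∀ w : Fin n → ℤ, (∀ v ∈ S, 0 ≤ pairing w (toReal v)) → w ∈ dualMonoid σ := by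
    intro w hw x hx
    rw [hS] at hx
    induction hx using Submodule.span_induction with
    | mem x hx => obtain ⟨v, hv, rfl⟩ := hx; exact hw v hv
    | zero => simp [pairing]
    | add x y _ _ hx hy =>
      have : pairing w (x + y) = pairing w x + pairing w y := by
        simp [pairing, mul_add, Finset.sum_add_distrib]
      rw [this]; exact add_nonneg hx hy
    | smul a x _ hx =>
      have : pairing w (a • x) = (a : ℝ) * pairing w x := by
        simp only [pairing, Finset.mul_sum]
        refine Finset.sum_congr rfl fun i _ => ?_
        change (w i : ℝ) * ((a : ℝ) * x i) = _
        ring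
      rw [this]; exact mul_nonneg a.2 hx
  have hint : ∀ w v : Fin n → ℤ, pairing w (toReal v) = ((∑ i, w i * v i : ℤ) : ℝ) := by
    intro w v; simp [pairing, toReal]
  have hpadd : ∀ (w w' : Fin n → ℤ) (N : ℕ) (x : Fin n → ℝ),
      pairing (w + N • w') x = pairing w x + N * pairing w' x := by
    intro w w' N x
    simp [pairing, add_mul, Finset.sum_add_distrib, Finset.mul_sum, mul_assoc]
  have hshift : ∀ w : dualMonoid τ, ∃ N : ℕ, ∀ M : ℕ, N ≤ M →
      (w : Fin n → ℤ) + M • (u : Fin n → ℤ) ∈ dualMonoid σ := by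
    intro w
    refine ⟨∑ v ∈ S, (∑ i, (w : Fin n → ℤ) i * v i).natAbs, fun M hM => hgen _ fun v hv => ?_⟩
    have hvσ : toReal v ∈ σ := by
      rw [hS]; exact PointedCone.subset_hull ⟨v, hv, rfl⟩
    have hu0 : 0 ≤ pairing (u : Fin n → ℤ) (toReal v) := u.2 _ hvσ
    rw [hpadd]
    rcases hu0.eq_or_lt with h0 | h0
    · rw [← h0, mul_zero, add_zero]
      exact w.2 _ ((hu _).2 ⟨hvσ, h0.symm⟩)
    · rw [hint] at h0
      rw [hint, hint]
      have h1 : 1 ≤ ∑ i, (u : Fin n → ℤ) i * v i := by exact_mod_cast h0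
      have h2 : (∑ i, (w : Fin n → ℤ) i * v i).natAbs ≤ M :=
        (Finset.single_le_sum (f := fun v : Fin n → ℤ => (∑ i, (w : Fin n → ℤ) i * v i).natAbs)
          (fun _ _ => Nat.zero_le _) hv).trans hM
      have h3 : 0 ≤ (∑ i, (w : Fin n → ℤ) i * v i) + (M : ℤ) * ∑ i, (u : Fin n → ℤ) i * v i := by
        have : (M : ℤ) * 1 ≤ (M : ℤ) * ∑ i, (u : Fin n → ℤ) i * v i :=
          mul_le_mul_of_nonneg_left h1 (Int.natCast_nonneg M)
        omega
      exact_mod_cast h3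
  have hneg : -(u : Fin n → ℤ) ∈ dualMonoid τ := fun x hx => by
    have : pairing (-(u : Fin n → ℤ)) x = - pairing (u : Fin n → ℤ) x := by simp [pairing]
    rw [this, ((hu x).1 hx).2, neg_zero]
  have hunit : IsUnit (coordRingMap h (AddMonoidAlgebra.single u 1)) := by
    refine IsUnit.of_mul_eq_one (AddMonoidAlgebra.single ⟨_, hneg⟩ 1) ?_
    rw [coordRingMap_single, AddMonoidAlgebra.single_mul_single, AddMonoidAlgebra.one_def]
    congr 1
    · ext i; simp
    · simp
  have hsurj : ∀ f : coordRing τ, ∃ N : ℕ, ∀ M : ℕ, N ≤ M → ∃ g : coordRing σ,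
      f * coordRingMap h ((AddMonoidAlgebra.single u 1) ^ M) = coordRingMap h g := by
    intro f
    induction f using AddMonoidAlgebra.induction_linear with
    | zero => exact ⟨0, fun M _ => ⟨0, by simp⟩⟩
    | add f f' hf hf' =>
      obtain ⟨N, hN⟩ := hf
      obtain ⟨N', hN'⟩ := hf'
      refine ⟨max N N', fun M hM => ?_⟩
      obtain ⟨g, hg⟩ := hN M ((le_max_left _ _).trans hM)
      obtain ⟨g', hg'⟩ := hN' M ((le_max_right _ _).trans hM)
      exact ⟨g + g', by rw [add_mul, hg, hg', map_add]⟩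
    | single w c =>
      obtain ⟨N, hN⟩ := hshift w
      refine ⟨N, fun M hM => ⟨AddMonoidAlgebra.single ⟨_, hN M hM⟩ c, ?_⟩⟩
      rw [hpow, coordRingMap_single, coordRingMap_single, AddMonoidAlgebra.single_mul_single]
      congr 1
      simp
  refine (isLocalization_iff _ _).2 ⟨?_, ?_, ?_⟩
  · rintro ⟨_, N, rfl⟩
    simp only [halg, map_pow]
    exact hunit.pow N
  · intro f
    obtain ⟨N, hN⟩ := hsurj f
    obtain ⟨g, hg⟩ := hN N le_rfl
    exact ⟨(g, ⟨_, N, rfl⟩), hg⟩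
  · intro a b hab
    exact ⟨1, by rw [coordRingMap_injective h hab]⟩

theorem coordRingMap_refl (σ : PointedCone ℝ (Fin n → ℝ)) :
    coordRingMap (le_refl σ) = RingHom.id _ :=
  AddMonoidAlgebra.mapDomainRingHom_id

theorem coordRingMap_comp {ρ τ σ : PointedCone ℝ (Fin n → ℝ)} (h : ρ ≤ τ) (h' : τ ≤ σ) :
    (coordRingMap h).comp (coordRingMap h') = coordRingMap (h.trans h') :=
  (AddMonoidAlgebra.mapDomainRingHom_comp _ _).symm

end Charts

namespace Fan

variable {n : ℕ} (Δ : Fan n)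

/-- The diagram of the affine toric varieties `U_σ = Spec ℂ[σ^∨ ∩ ℤⁿ]`, indexed by the cones of the
fan ordered by inclusion. -/
def chart : Δ.cones ⥤ Scheme.{0} where
  obj σ := Spec (CommRingCat.of (coordRing σ.1))
  map f := Spec.map (CommRingCat.ofHom (coordRingMap (leOfHom f)))
  map_id σ := by
    rw [← Spec.map_id, coordRingMap_refl]
    rfl
  map_comp f g := by
    rw [← Spec.map_comp, ← CommRingCat.ofHom_comp, coordRingMap_comp]

instance {σ τ : Δ.cones} (f : τ ⟶ σ) : IsOpenImmersion (Δ.chart.map f) := by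
  obtain ⟨u, hu, hτ⟩ := Δ.inf_isFace σ σ.2 τ τ.2
  rw [inf_eq_right.2 (leOfHom f)] at hτ
  let := (coordRingMap (leOfHom f)).toAlgebra
  have := isLocalization_coordRingMap (leOfHom f) (Δ.rational σ σ.2) ⟨u, hu⟩ hτ
  exact IsOpenImmersion.of_isLocalization
    (AddMonoidAlgebra.single (⟨u, hu⟩ : dualMonoid σ.1) 1 : coordRing σ.1)

/-- The points of `U_σ` that lie in `U_τ`, where `τ` is the face of `σ` cut out by `u`. -/
theorem range_chart_map {σ τ : Δ.cones} (f : τ ⟶ σ) (u : dualMonoid σ.1)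
    (hu : ∀ x, x ∈ τ.1 ↔ x ∈ σ.1 ∧ pairing (u : Fin n → ℤ) x = 0) :
    Set.range (Δ.chart.map f) =
      {p | (AddMonoidAlgebra.single u 1 : coordRing σ.1) ∉
        PrimeSpectrum.asIdeal (R := coordRing σ.1) p} := by
  let := (coordRingMap (leOfHom f)).toAlgebra
  have := isLocalization_coordRingMap (leOfHom f) (Δ.rational σ σ.2) u hu
  exact PrimeSpectrum.localization_away_comap_range (coordRing τ.1)
    (AddMonoidAlgebra.single u 1 : coordRing σ.1)

instance : (Δ.chart ⋙ Scheme.forget).IsLocallyDirected := by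
  constructor
  intro i j k fi fj xi xj hx
  replace hx : Δ.chart.map fi xi = Δ.chart.map fj xj := hx
  obtain ⟨u, hu, hj⟩ := Δ.inf_isFace k k.2 j j.2
  rw [inf_eq_right.2 (leOfHom fj)] at hj
  have hui : u ∈ dualMonoid i.1 := fun x hx => hu x (leOfHom fi hx)
  have hface : ∀ x, x ∈ i.1 ⊓ j.1 ↔ x ∈ i.1 ∧ pairing u x = 0 := fun x => by
    rw [Submodule.mem_inf, hj]
    exact ⟨fun h => ⟨h.1, h.2.2⟩, fun h => ⟨h.1, leOfHom fi h.1, h.2⟩⟩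
  let l : Δ.cones := ⟨i.1 ⊓ j.1, Δ.face_mem i i.2 _ ⟨u, hui, hface⟩⟩
  let fli : l ⟶ i := homOfLE (show i.1 ⊓ j.1 ≤ i.1 from inf_le_left)
  let flj : l ⟶ j := homOfLE (show i.1 ⊓ j.1 ≤ j.1 from inf_le_right)
  have h1 : Δ.chart.map fi xi ∈ Set.range (Δ.chart.map fj) := ⟨xj, hx.symm⟩
  rw [Δ.range_chart_map fj ⟨u, hu⟩ hj] at h1
  have h2 : xi ∈ Set.range (Δ.chart.map fli) := by
    rw [Δ.range_chart_map fli ⟨u, hui⟩ hface]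
    intro h
    apply h1
    change coordRingMap (leOfHom fi) _ ∈ PrimeSpectrum.asIdeal (R := coordRing i.1) xi
    rw [coordRingMap_single]
    exact h
  obtain ⟨z, hz⟩ := h2
  refine ⟨l, fli, flj, z, hz, ?_⟩
  change Δ.chart.map flj z = xj
  apply (Δ.chart.map fj).isOpenEmbedding.injective
  rw [← hx, ← hz, ← Scheme.Hom.comp_apply, ← Scheme.Hom.comp_apply, ← Functor.map_comp,
    ← Functor.map_comp]
  rfl

/-- The toric variety `X_Δ`, glued from the affine charts: `U_σ` and `U_τ` are
glued along `U_{σ ∩ τ}`. -/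
def toricVariety : Scheme.{0} := colimit Δ.chart

/-- The structure morphism of the toric variety. -/
def structureMap : Δ.toricVariety ⟶ Spec (CommRingCat.of ℂ) :=
  colimit.desc Δ.chart
    { pt := Spec (CommRingCat.of ℂ)
      ι :=
        { app := fun σ => Spec.map (CommRingCat.ofHom (algebraMap ℂ (coordRing σ.1)))
          naturality := fun τ σ f => by
            change Spec.map _ ≫ Spec.map _ = Spec.map _ ≫ 𝟙 _
            rw [Category.comp_id, ← Spec.map_comp, ← CommRingCat.ofHom_comp]
            congr 2
            ext c
            simp [coordRingMap] } }

end Fan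

/-! ### Projectivity -/

attribute [local instance] MvPolynomial.gradedAlgebra

/-- Complex projective space of dimension `N`. -/
def projectiveSpace (N : ℕ) : Scheme.{0} :=
  Proj (MvPolynomial.homogeneousSubmodule (Fin (N + 1)) ℂ)

/-- The structure morphism of projective space. -/
def projectiveSpaceMap (N : ℕ) : projectiveSpace N ⟶ Spec (CommRingCat.of ℂ) :=
  Proj.toSpecZero (MvPolynomial.homogeneousSubmodule (Fin (N + 1)) ℂ) ≫
    Spec.map (CommRingCat.ofHom
      (algebraMap ℂ (MvPolynomial.homogeneousSubmodule (Fin (N + 1)) ℂ 0)))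

/-- A complex scheme is projective if it is isomorphic, over `ℂ`, to a closed subscheme of some
projective space. -/
def IsProjective {X : Scheme.{0}} (f : X ⟶ Spec (CommRingCat.of ℂ)) : Prop :=
  ∃ (N : ℕ) (i : X ⟶ projectiveSpace N), IsClosedImmersion i ∧ i ≫ projectiveSpaceMap N = f

/-- `X_Δ` is a toric manifold over `K`: the fan is complete (`X_Δ` is a complete variety),
non-singular (`X_Δ` is smooth), and has underlying simplicial complex `K`. -/
def Fan.IsToricManifoldOver {n : ℕ} (Δ : Fan n) {V : Type*} (K : AbstractSimplicialComplex V) :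
    Prop :=
  Δ.IsComplete ∧ Δ.IsNonsingular ∧ Δ.IsOver K

/-- `K` is weakly combinatorially Delzant: it is polytopal and there is a projective toric manifold
over `K`. -/
def IsWeaklyCombinatoriallyDelzant {V : Type*} (K : AbstractSimplicialComplex V) : Prop :=
  IsPolytopal K ∧
    ∃ (n : ℕ) (Δ : Fan n), Δ.IsToricManifoldOver K ∧ IsProjective Δ.structureMap

/-- `K` is strongly combinatorially Delzant: it is weakly combinatorially Delzant and every toric
manifold over `K` is projective. -/
def IsStronglyCombinatoriallyDelzant {V : Type*} (K : AbstractSimplicialComplex V) : Prop :=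
  IsWeaklyCombinatoriallyDelzant K ∧
    ∀ (n : ℕ) (Δ : Fan n), Δ.IsToricManifoldOver K → IsProjective Δ.structureMap

end ToricWedge

end

noncomputable section

namespace ToricWedge

/-! ### The pairing -/

section Pairing

variable {n : ℕ}

/-! A complete nonsingular fan is projective and strongly polytopal as soon as it carries a strictly
convex integral support function. `AmpleSystem` records such a function: an integer `c x` for each
ray generator and, for each maximal cone `f`, a character `mu f` that equals `-c` on the generators
of `f` and exceeds `-c` on all others. The characters `mu f`, with their lattice neighbours `mu f +
dual f x`, give monomials that embed the variety (`AmpleSystem.Spans.isProjective`). The generators,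
rescaled to a common height, are the vertices of the polytope
(`AmpleSystem.Spans.isStronglyPolytopal`). Everything thus reduces to finding `c`, which is
`UnimodularSystem.IsWedge.exists_c`.

A facet of P_m(J) consists of all copies of the two ends of an edge and all copies but one of every
other vertex. Choose one copy `k i` of each vertex, a transversal, and project along the rays off
it: the result is a smooth planar fan with m rays in the given cyclic order. Changing the copy at
`i` does not change the further projection along the ray `i`. Hence, in coordinates `(a, b)` in
which the ray `i` is `(1, 0)`, the new fan has the same `b` and `a' = a + e b + d |b|`: each half
plane is sheared separately, and `d = 0` unless the ray opposite to `i` is also present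
(`IsFanRows.exists_shear`). A linear relation `ρ` between the generators sees only `d`: its
coefficients at the two copies of `i` differ by `-d ∑ |b l| ρ l`. Call `i` trivial if every relation
has equal coefficients at all copies of `i`. Comparing the four fans obtained by changing the copy
at `i`, at `j`, at both or at neither shows that two nontrivial vertices lie on one line
(`FanFamily.isTrivialAt_of_ne_zero`).

Strict convexity of `c` means positivity on the relation attached to each facet and each generator
outside it. If all vertices are trivial, the Euclidean norms of the generators of one planar fan
will do. Otherwise let `b` vanish on the line of the nontrivial vertices. No cone crosses that line,
so `|b|` is convex and linear on each cone; on a relation where `|b|` gives zero, the shear formula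
removes the dependence on the transversal, and the norm is positive. So norm plus `N |b|` works for
large `N` (`FanFamily.exists_support`), and rounding makes it integral.

A toric manifold over P_m(J) is constructed by extending a smooth planar fan with m rays. The same
argument supplies its support function, from which completeness and polytopality follow. -/

theorem pairing_add_right (u : Fin n → ℤ) (x y : Fin n → ℝ) :
    pairing u (x + y) = pairing u x + pairing u y := by
  simp [pairing, mul_add, Finset.sum_add_distrib]

theorem pairing_smul_right (u : Fin n → ℤ) (a : ℝ) (x : Fin n → ℝ) :
    pairing u (a • x) = a * pairing u x := by
  simp only [pairing, Finset.mul_sum, Pi.smul_apply, smul_eq_mul]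
  exact Finset.sum_congr rfl fun i _ => by ring

theorem pairing_zero_right (u : Fin n → ℤ) : pairing u 0 = 0 := by simp [pairing]

theorem pairing_neg_right (u : Fin n → ℤ) (x : Fin n → ℝ) : pairing u (-x) = -pairing u x := by
  simp [pairing]

theorem pairing_sum_right {ι : Type*} (u : Fin n → ℤ) (s : Finset ι) (x : ι → Fin n → ℝ) :
    pairing u (∑ i ∈ s, x i) = ∑ i ∈ s, pairing u (x i) := by
  classical
  induction s using Finset.induction_on with
  | empty => simp [pairing_zero_right]
  | insert i s hi ih => rw [Finset.sum_insert hi, Finset.sum_insert hi, pairing_add_right, ih]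

theorem pairing_add_left (u w : Fin n → ℤ) (x : Fin n → ℝ) :
    pairing (u + w) x = pairing u x + pairing w x := by
  simp [pairing, add_mul, Finset.sum_add_distrib]

theorem pairing_sub_left (u w : Fin n → ℤ) (x : Fin n → ℝ) :
    pairing (u - w) x = pairing u x - pairing w x := by
  simp [pairing, sub_mul, Finset.sum_sub_distrib]

theorem pairing_neg_left (u : Fin n → ℤ) (x : Fin n → ℝ) : pairing (-u) x = -pairing u x := by
  simp [pairing]

theorem pairing_zero_left (x : Fin n → ℝ) : pairing 0 x = 0 := by simp [pairing]

theorem pairing_smul_left (a : ℤ) (u : Fin n → ℤ) (x : Fin n → ℝ) :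
    pairing (a • u) x = a * pairing u x := by
  simp only [pairing, Finset.mul_sum, Pi.smul_apply, smul_eq_mul, Int.cast_mul]
  exact Finset.sum_congr rfl fun i _ => by ring

theorem pairing_sum_left {ι : Type*} (s : Finset ι) (u : ι → Fin n → ℤ) (x : Fin n → ℝ) :
    pairing (∑ i ∈ s, u i) x = ∑ i ∈ s, pairing (u i) x := by
  classical
  induction s using Finset.induction_on with
  | empty => simp [pairing_zero_left]
  | insert i s hi ih => rw [Finset.sum_insert hi, Finset.sum_insert hi, pairing_add_left, ih]

theorem pairing_toReal (u v : Fin n → ℤ) : pairing u (toReal v) = ((∑ i, u i * v i : ℤ) : ℝ) := by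
  simp [pairing, toReal]

theorem continuous_pairing (u : Fin n → ℤ) : Continuous (pairing u) := by
  unfold pairing; fun_prop

/-- Integral characters separate the points of `ℤⁿ`, tested on the vectors of `ℝⁿ`. -/
theorem eq_of_forall_pairing {u w : Fin n → ℤ} (h : ∀ x, pairing u x = pairing w x) : u = w := by
  funext i
  have := h (Pi.single i 1)
  simpa [pairing, Pi.single_apply] using this

end Pairing

/-! ### Cones spanned by part of a basis -/

theorem smul_mem_cone {n : ℕ} {σ : PointedCone ℝ (Fin n → ℝ)} {x : Fin n → ℝ} (hx : x ∈ σ)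
    {a : ℝ} (ha : 0 ≤ a) : a • x ∈ σ :=
  Submodule.smul_mem σ (⟨a, ha⟩ : {c : ℝ // 0 ≤ c}) hx

theorem hull_induction {n : ℕ} {s : Set (Fin n → ℝ)} {p : (Fin n → ℝ) → Prop} {x : Fin n → ℝ}
    (hx : x ∈ PointedCone.hull ℝ s) (mem : ∀ x ∈ s, p x) (zero : p 0)
    (add : ∀ x y, p x → p y → p (x + y)) (smul : ∀ (a : ℝ) x, 0 ≤ a → p x → p (a • x)) : p x := by
  induction hx using Submodule.span_induction with
  | mem x hx => exact mem x hx
  | zero => exact zero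
  | add x y _ _ hx hy => exact add x y hx hy
  | smul a x _ hx => exact smul a x a.2 hx

/-- Finitely many lattice vectors `vec x`, together with finitely many sets `facet f` of them that
are bases of the lattice; `dual f` is the dual basis of `facet f`. -/
structure UnimodularSystem (n : ℕ) (V ι : Type*) [DecidableEq V] where
  vec : V → Fin n → ℤ
  facet : ι → Finset V
  dual : ι → V → Fin n → ℤ
  pairing_dual : ∀ f, ∀ x ∈ facet f, ∀ y ∈ facet f,
    pairing (dual f x) (toReal (vec y)) = if x = y then 1 else 0
  sum_dual : ∀ f z, ∑ x ∈ facet f, pairing (dual f x) z • toReal (vec x) = z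

namespace UnimodularSystem

variable {n : ℕ} {V ι : Type*} [DecidableEq V] (S : UnimodularSystem n V ι)

/-- The vectors of the system, as real vectors. -/
def rvec (x : V) : Fin n → ℝ := toReal (S.vec x)

/-- The cone spanned by a set of vectors of the system. -/
def cone (s : Finset V) : PointedCone ℝ (Fin n → ℝ) := PointedCone.hull ℝ (S.rvec '' s)

theorem pairing_dual_rvec {f : ι} {x y : V} (hx : x ∈ S.facet f) (hy : y ∈ S.facet f) :
    pairing (S.dual f x) (S.rvec y) = if x = y then 1 else 0 := S.pairing_dual f x hx y hy

theorem sum_dual_rvec (f : ι) (z : Fin n → ℝ) :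
    ∑ x ∈ S.facet f, pairing (S.dual f x) z • S.rvec x = z := S.sum_dual f z

theorem pairing_eq_sum (f : ι) (u : Fin n → ℤ) (z : Fin n → ℝ) :
    pairing u z = ∑ x ∈ S.facet f, pairing (S.dual f x) z * pairing u (S.rvec x) := by
  conv_lhs => rw [← S.sum_dual_rvec f z]
  simp only [pairing_sum_right, pairing_smul_right]

theorem rvec_mem_cone {s : Finset V} {x : V} (hx : x ∈ s) : S.rvec x ∈ S.cone s :=
  PointedCone.subset_hull ⟨x, hx, rfl⟩

theorem cone_mono {s t : Finset V} (h : s ⊆ t) : S.cone s ≤ S.cone t :=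
  Submodule.span_mono (Set.image_mono (by exact_mod_cast h))

theorem sum_mem_cone {s : Finset V} {a : V → ℝ} (ha : ∀ x ∈ s, 0 ≤ a x) :
    ∑ x ∈ s, a x • S.rvec x ∈ S.cone s :=
  Submodule.sum_mem _ fun x hx => smul_mem_cone (S.rvec_mem_cone hx) (ha x hx)

theorem mem_cone_iff {f : ι} {s : Finset V} (hs : s ⊆ S.facet f) {z : Fin n → ℝ} :
    z ∈ S.cone s ↔ ∀ x ∈ S.facet f, 0 ≤ pairing (S.dual f x) z ∧
      (x ∉ s → pairing (S.dual f x) z = 0) := by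
  constructor
  · intro hz x hx
    refine hull_induction (p := fun z => 0 ≤ pairing (S.dual f x) z ∧
      (x ∉ s → pairing (S.dual f x) z = 0)) hz ?_ ?_ ?_ ?_
    · rintro _ ⟨y, hy, rfl⟩
      rw [S.pairing_dual_rvec hx (hs hy)]
      refine ⟨by split_ifs <;> norm_num, fun h => ?_⟩
      rw [if_neg]
      rintro rfl
      exact h hy
    · simp [pairing_zero_right]
    · intro y z hy hz
      rw [pairing_add_right]
      exact ⟨add_nonneg hy.1 hz.1, fun h => by rw [hy.2 h, hz.2 h, add_zero]⟩
    · intro a y ha hy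
      rw [pairing_smul_right]
      exact ⟨mul_nonneg ha hy.1, fun h => by rw [hy.2 h, mul_zero]⟩
  · intro h
    have : z = ∑ x ∈ s, pairing (S.dual f x) z • S.rvec x := by
      conv_lhs => rw [← S.sum_dual_rvec f z]
      exact (Finset.sum_subset hs fun x hx hxs => by rw [(h x hx).2 hxs, zero_smul]).symm
    rw [this]
    exact S.sum_mem_cone fun x hx => (h x (hs hx)).1

theorem mem_cone_facet_iff {f : ι} {z : Fin n → ℝ} :
    z ∈ S.cone (S.facet f) ↔ ∀ x ∈ S.facet f, 0 ≤ pairing (S.dual f x) z := by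
  rw [S.mem_cone_iff subset_rfl]
  exact forall₂_congr fun x hx => by simp [hx]

theorem pairing_nonneg_of_mem_cone {s : Finset V} {u : Fin n → ℤ}
    (hu : ∀ x ∈ s, 0 ≤ pairing u (S.rvec x)) {z : Fin n → ℝ} (hz : z ∈ S.cone s) :
    0 ≤ pairing u z := by
  refine hull_induction (p := fun z => 0 ≤ pairing u z) hz ?_ (pairing_zero_right u).ge ?_ ?_
  · rintro _ ⟨x, hx, rfl⟩
    exact hu x hx
  · intro x y hx hy
    rw [pairing_add_right]
    exact add_nonneg hx hy
  · intro a x ha hx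
    rw [pairing_smul_right]
    exact mul_nonneg ha hx

theorem pairing_eq_zero_of_mem_cone {s : Finset V} {u : Fin n → ℤ}
    (hu : ∀ x ∈ s, pairing u (S.rvec x) = 0) {z : Fin n → ℝ} (hz : z ∈ S.cone s) :
    pairing u z = 0 := by
  refine le_antisymm ?_ (S.pairing_nonneg_of_mem_cone (fun x hx => (hu x hx).ge) hz)
  have := S.pairing_nonneg_of_mem_cone (u := -u) (fun x hx => by
    rw [pairing_neg_left, hu x hx, neg_zero]) hz
  rw [pairing_neg_left] at this
  linarith

/-- The part of a cone on which a nonnegative character vanishes. -/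
theorem mem_cone_filter_iff {f : ι} {s : Finset V} (hs : s ⊆ S.facet f) {u : Fin n → ℤ}
    (hu : ∀ x ∈ s, 0 ≤ pairing u (S.rvec x)) {t : Finset V} (hts : t ⊆ s)
    (ht : ∀ x ∈ s, x ∈ t ↔ pairing u (S.rvec x) = 0) (z : Fin n → ℝ) :
    z ∈ S.cone t ↔ z ∈ S.cone s ∧ pairing u z = 0 := by
  constructor
  · exact fun hz => ⟨S.cone_mono hts hz,
      S.pairing_eq_zero_of_mem_cone (fun x hx => (ht x (hts hx)).1 hx) hz⟩
  · rintro ⟨hz, h0⟩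
    rw [S.mem_cone_iff hs] at hz
    rw [S.mem_cone_iff (hts.trans hs)]
    refine fun x hx => ⟨(hz x hx).1, fun hxt => ?_⟩
    by_cases hxs : x ∈ s
    · rw [S.pairing_eq_sum f, Finset.sum_eq_zero_iff_of_nonneg] at h0
      · have hne : pairing u (S.rvec x) ≠ 0 := fun h => hxt ((ht x hxs).2 h)
        exact (mul_eq_zero.1 (h0 x hx)).resolve_right hne
      · intro y hy
        by_cases hys : y ∈ s
        · exact mul_nonneg (hz y hy).1 (hu y hys)
        · rw [(hz y hy).2 hys, zero_mul]
    · exact (hz x hx).2 hxs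

theorem rvec_ne_zero {f : ι} {x : V} (hx : x ∈ S.facet f) : S.rvec x ≠ 0 := by
  intro h
  have := S.pairing_dual_rvec hx hx
  rw [h, pairing_zero_right] at this
  simp at this

theorem linearIndepOn_rvec (f : ι) : LinearIndepOn ℝ S.rvec (S.facet f : Set V) := by
  rw [linearIndepOn_finset_iff]
  intro a h x hx
  have := congrArg (pairing (S.dual f x)) h
  rw [pairing_sum_right, pairing_zero_right, Finset.sum_eq_single x] at this
  · simpa [pairing_smul_right, S.pairing_dual_rvec hx hx] using this
  · intro y hy hne
    rw [pairing_smul_right, S.pairing_dual_rvec hx hy, if_neg (Ne.symm hne), mul_zero]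
  · exact fun h => absurd hx h

end UnimodularSystem

/-- A unimodular system with a strictly convex integral support function: `-c` on the vectors, given
by the character `mu f` on `facet f`. Moreover every element of a facet can be exchanged. -/
structure AmpleSystem (n : ℕ) (V ι : Type*) [DecidableEq V] extends UnimodularSystem n V ι where
  mu : ι → Fin n → ℤ
  c : V → ℤ
  mu_nonneg : ∀ f x, 0 ≤ pairing (mu f) (toReal (vec x)) + c x
  mu_eq_zero_iff : ∀ f x, pairing (mu f) (toReal (vec x)) + c x = 0 ↔ x ∈ facet f
  exists_adj : ∀ f, ∀ x ∈ facet f, ∃ g, facet f \ {x} ⊆ facet g ∧ x ∉ facet g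
  exists_mem_facet : ∀ x, ∃ f, x ∈ facet f

namespace AmpleSystem

variable {n : ℕ} {V ι : Type*} [DecidableEq V] (S : AmpleSystem n V ι)

theorem pairing_mu {f : ι} {x : V} (hx : x ∈ S.facet f) :
    pairing (S.mu f) (S.rvec x) = -S.c x := by
  have := (S.mu_eq_zero_iff f x).2 hx
  unfold UnimodularSystem.rvec
  linarith

theorem neg_c_le (f : ι) (x : V) : -(S.c x : ℝ) ≤ pairing (S.mu f) (S.rvec x) := by
  have := S.mu_nonneg f x
  unfold UnimodularSystem.rvec
  linarith

theorem mem_facet_of_le {f : ι} {x : V} (h : pairing (S.mu f) (S.rvec x) ≤ -S.c x) :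
    x ∈ S.facet f := by
  rw [← S.mu_eq_zero_iff f x]
  exact le_antisymm (by unfold UnimodularSystem.rvec at h; linarith) (S.mu_nonneg f x)

/-- On the cone of the facet `f`, the character of `f` is the smallest. -/
theorem pairing_mu_le {f : ι} {z : Fin n → ℝ} (hz : z ∈ S.cone (S.facet f)) (g : ι) :
    pairing (S.mu f) z ≤ pairing (S.mu g) z := by
  have := S.pairing_nonneg_of_mem_cone (u := S.mu g - S.mu f) (s := S.facet f) (fun x hx => by
    rw [pairing_sub_left, S.pairing_mu hx]
    linarith [S.neg_c_le g x]) hz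
  rw [pairing_sub_left] at this
  linarith

/-- A vector of the system in the cone of a facet belongs to that facet. -/
theorem mem_facet_of_rvec_mem_cone {f : ι} {x : V} (h : S.rvec x ∈ S.cone (S.facet f)) :
    x ∈ S.facet f := by
  obtain ⟨g, hg⟩ := S.exists_mem_facet x
  refine S.mem_facet_of_le ?_
  rw [← S.pairing_mu hg]
  exact S.pairing_mu_le h g

theorem mem_of_rvec_mem_cone {f : ι} {s : Finset V} (hs : s ⊆ S.facet f) {x : V}
    (h : S.rvec x ∈ S.cone s) : x ∈ s := by
  have hx := S.mem_facet_of_rvec_mem_cone (S.cone_mono hs h)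
  by_contra hxs
  have := ((S.mem_cone_iff hs).1 h x hx).2 hxs
  rw [S.pairing_dual_rvec hx hx, if_pos rfl] at this
  exact one_ne_zero this

theorem subset_of_cone_le {f : ι} {s t : Finset V} (ht : t ⊆ S.facet f)
    (h : S.cone s ≤ S.cone t) : s ⊆ t := fun _ hx =>
  S.mem_of_rvec_mem_cone ht (h (S.rvec_mem_cone hx))

/-- Adjacent facets: the difference of their characters is a positive multiple of a dual vector. -/
theorem exists_mu_sub {f : ι} {x : V} (hx : x ∈ S.facet f) :
    ∃ (g : ι) (l : ℕ), S.mu g - S.mu f = ((l : ℤ) + 1) • S.dual f x ∧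
      S.facet f \ {x} ⊆ S.facet g ∧ x ∉ S.facet g := by
  obtain ⟨g, hg, hxg⟩ := S.exists_adj f x hx
  obtain ⟨a, ha⟩ : ∃ a : ℤ, pairing (S.mu g - S.mu f) (S.rvec x) = a :=
    ⟨_, pairing_toReal _ _⟩
  have hpos : 0 < a := by
    have h1 : 0 < pairing (S.mu g - S.mu f) (S.rvec x) := by
      rw [pairing_sub_left, S.pairing_mu hx]
      have : ¬ pairing (S.mu g) (S.rvec x) ≤ -S.c x := fun h => hxg (S.mem_facet_of_le h)
      linarith
    rw [ha] at h1
    exact_mod_cast h1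
  -- The difference vanishes on the rest of the facet `f` and takes the positive integer value `a`
  -- at `x`, so it is `a` times the dual vector; `l + 1` encodes `a`.
  refine ⟨g, (a - 1).toNat, ?_, hg, hxg⟩
  rw [Int.toNat_of_nonneg (by omega), sub_add_cancel]
  refine eq_of_forall_pairing fun z => ?_
  rw [S.pairing_eq_sum f, Finset.sum_eq_single x, ha, pairing_smul_left]
  · ring
  · intro y hy hne
    have hyg : y ∈ S.facet g := hg (by simp [hy, hne])
    rw [pairing_sub_left, S.pairing_mu hy, S.pairing_mu hyg, sub_self, mul_zero]
  · exact fun h => absurd hx h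

/-- The facets that contain `s` have intersection `s`. -/
theorem exists_facet_of_notMem {f : ι} {s : Finset V} (hs : s ⊆ S.facet f) {x : V} (hx : x ∉ s) :
    ∃ g, s ⊆ S.facet g ∧ x ∉ S.facet g := by
  by_cases hxf : x ∈ S.facet f
  · obtain ⟨g, hg, hxg⟩ := S.exists_adj f x hxf
    refine ⟨g, fun y hy => hg ?_, hxg⟩
    simp only [Finset.mem_sdiff, Finset.mem_singleton]
    exact ⟨hs hy, fun h => hx (h ▸ hy)⟩
  · exact ⟨f, hs, hxf⟩

/-- The cones of the facets cover the space. -/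
theorem exists_mem_cone_facet [Finite ι] [Nonempty ι] (z : Fin n → ℝ) :
    ∃ f, z ∈ S.cone (S.facet f) := by
  -- The minimizing character works: if the coordinate of `z` along `x` were negative, the facet
  -- across the wall opposite `x` would give a smaller value.
  obtain ⟨f, hf⟩ := Finite.exists_min fun f => pairing (S.mu f) z
  refine ⟨f, S.mem_cone_facet_iff.2 fun x hx => ?_⟩
  obtain ⟨g, l, hg, -⟩ := S.exists_mu_sub hx
  have h1 := congrArg (fun u => pairing u z) hg
  simp only [pairing_sub_left, pairing_smul_left] at h1
  have h2 : 0 ≤ ((((l : ℤ) + 1 : ℤ)) : ℝ) * pairing (S.dual f x) z := by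
    rw [← h1]; linarith [hf g]
  exact nonneg_of_mul_nonneg_right h2 (by push_cast; positivity)

/-- A subset of a facet is a face of the complex of the system. -/
def IsFace (s : Finset V) : Prop := ∃ f, s ⊆ S.facet f

/-- The vectors at which a character that is bounded below by `-c` attains `-c` form a face. -/
theorem isFace_of_tight [Finite ι] [Nonempty ι] (s : Finset V) (l : (Fin n → ℝ) →ₗ[ℝ] ℝ)
    (hl : ∀ x, -(S.c x : ℝ) ≤ l (S.rvec x)) (hs : ∀ x ∈ s, l (S.rvec x) = -S.c x) :
    S.IsFace s := by
  obtain ⟨f, hf⟩ := S.exists_mem_cone_facet (∑ x ∈ s, S.rvec x)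
  refine ⟨f, ?_⟩
  set z := ∑ x ∈ s, S.rvec x with hz
  -- On the generators of the cone of `f`, `l` is at least `-c`, which is `mu f`. Conversely `l z =
  -- -∑ c` is at most `mu f z` term by term over `s`, so all these terms are equalities.
  have h1 : pairing (S.mu f) z ≤ l z := by
    rw [S.pairing_eq_sum f, ← S.sum_dual_rvec f z, map_sum]
    rw [S.sum_dual_rvec f z]
    refine Finset.sum_le_sum fun x hx => ?_
    rw [map_smul, smul_eq_mul, S.pairing_mu hx]
    exact mul_le_mul_of_nonneg_left (hl x) (S.mem_cone_facet_iff.1 hf x hx)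
  have h2 : l z = ∑ x ∈ s, -(S.c x : ℝ) := by
    rw [hz, map_sum]
    exact Finset.sum_congr rfl hs
  have h3 : pairing (S.mu f) z = ∑ x ∈ s, pairing (S.mu f) (S.rvec x) := by
    rw [hz, pairing_sum_right]
  have h4 := (Finset.sum_eq_sum_iff_of_le fun x _ => S.neg_c_le f x).1
    (le_antisymm (Finset.sum_le_sum fun x _ => S.neg_c_le f x) (by linarith) :
      ∑ x ∈ s, -(S.c x : ℝ) = ∑ x ∈ s, pairing (S.mu f) (S.rvec x))
  exact fun x hx => S.mem_facet_of_le (h4 x hx).ge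

end AmpleSystem

/-! ### Morphisms from affine schemes to `Proj` -/

section ProjMorphism

open HomogeneousLocalization

variable {A R T : Type} [CommRing A] [CommRing R] [CommRing T] {σ : Type*} [SetLike σ A]
  [AddSubgroupClass σ A] (𝒜 : ℕ → σ) [GradedRing 𝒜]

/-- The map `(A_t)₀ → R` induced by a map `A → R` that inverts `t`. -/
def awayLift (φ : A →+* R) {t : A} (h : IsUnit (φ t)) : Away 𝒜 t →+* R :=
  (IsLocalization.Away.lift (S := Localization.Away t) t h).comp
    (algebraMap (Away 𝒜 t) (Localization.Away t))

/-- Since `φ t` is a unit, this equation determines the map; identities between such maps are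
checked against it. -/
theorem awayLift_mk (φ : A →+* R) {t : A} (h : IsUnit (φ t)) {d : ℕ} (ht : t ∈ 𝒜 d) (n : ℕ)
    (a : A) (ha : a ∈ 𝒜 (n • d)) : awayLift 𝒜 φ h (Away.mk 𝒜 ht n a ha) * φ t ^ n = φ a := by
  have key : (Away.mk 𝒜 ht n a ha).val * algebraMap A (Localization.Away t) (t ^ n)
      = algebraMap A (Localization.Away t) a := by
    rw [Away.val_mk, Localization.mk_eq_mk']
    exact IsLocalization.mk'_spec _ a (⟨t ^ n, n, rfl⟩ : Submonoid.powers t)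
  have := congrArg (IsLocalization.Away.lift (S := Localization.Away t) t h) key
  rw [map_mul, IsLocalization.Away.lift_eq, IsLocalization.Away.lift_eq, map_pow] at this
  exact this

theorem awayLift_comp (φ : A →+* R) (ψ : R →+* T) {t : A} (h : IsUnit (φ t))
    (h' : IsUnit (ψ.comp φ t)) {d : ℕ} (ht : t ∈ 𝒜 d) :
    ψ.comp (awayLift 𝒜 φ h) = awayLift 𝒜 (ψ.comp φ) h' := by
  ext z
  obtain ⟨n, a, ha, rfl⟩ := Away.mk_surjective 𝒜 ht z
  apply (h'.pow n).mul_left_injective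
  change _ * _ = _ * _
  rw [awayLift_mk, RingHom.comp_apply, RingHom.comp_apply, RingHom.comp_apply,
    ← awayLift_mk 𝒜 φ h ht n a ha, map_mul, map_pow]

/-- Rescaling the grading by a unit does not change the induced map. -/
theorem awayLift_eq_of_scale (φ φ' : A →+* R) {t : A} (h : IsUnit (φ t)) (h' : IsUnit (φ' t))
    {d : ℕ} (ht : t ∈ 𝒜 d) (u : R) (hu : ∀ e, ∀ a ∈ 𝒜 e, φ' a = u ^ e * φ a) :
    awayLift 𝒜 φ h = awayLift 𝒜 φ' h' := by
  ext z
  obtain ⟨n, a, ha, rfl⟩ := Away.mk_surjective 𝒜 ht z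
  apply (h'.pow n).mul_left_injective
  change _ * _ = _ * _
  rw [awayLift_mk, hu _ t ht, hu _ a ha, mul_pow, ← awayLift_mk 𝒜 φ h ht n a ha, ← pow_mul,
    smul_eq_mul, mul_comm d n]
  ring

/-- The morphism `Spec R → Proj A` induced by a map `A → R` that inverts `t`. -/
def specToProj (φ : A →+* R) {t : A} (h : IsUnit (φ t)) {d : ℕ} (ht : t ∈ 𝒜 d) (hd : 0 < d) :
    Spec (CommRingCat.of R) ⟶ Proj 𝒜 :=
  Spec.map (CommRingCat.ofHom (awayLift 𝒜 φ h)) ≫ Proj.awayι 𝒜 t ht hd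

theorem specMap_specToProj (φ : A →+* R) (ψ : R →+* T) {t : A} (h : IsUnit (φ t))
    (h' : IsUnit (ψ.comp φ t)) {d : ℕ} (ht : t ∈ 𝒜 d) (hd : 0 < d) :
    Spec.map (CommRingCat.ofHom ψ) ≫ specToProj 𝒜 φ h ht hd =
      specToProj 𝒜 (ψ.comp φ) h' ht hd := by
  rw [specToProj, specToProj, ← awayLift_comp 𝒜 φ ψ h h' ht, CommRingCat.ofHom_comp,
    Spec.map_comp, Category.assoc]

/-- The morphism already factors through the smaller open set `D₊(ts)`, where two choices of the
inverted element can be compared. -/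
theorem specToProj_eq_mul (φ : A →+* R) {t s : A} (h : IsUnit (φ t)) (hs' : IsUnit (φ (t * s)))
    {d e : ℕ} (ht : t ∈ 𝒜 d) (hd : 0 < d) (hs : s ∈ 𝒜 e) :
    specToProj 𝒜 φ h ht hd = specToProj 𝒜 φ hs' (SetLike.mul_mem_graded ht hs)
      (hd.trans_le (d.le_add_right e)) := by
  rw [specToProj, specToProj, ← Proj.SpecMap_awayMap_awayι 𝒜 ht hd hs rfl, ← Spec.map_comp_assoc,
    ← CommRingCat.ofHom_comp]
  congr 3
  ext z
  obtain ⟨n, a, ha, rfl⟩ := Away.mk_surjective 𝒜 ht z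
  apply (hs'.pow n).mul_left_injective
  change _ * _ = _ * _
  rw [RingHom.comp_apply, awayMap_mk, awayLift_mk, map_mul, mul_pow, ← mul_assoc, awayLift_mk,
    map_mul, map_pow]

/-- The morphism does not depend on the choice of the inverted element. -/
theorem specToProj_congr (φ : A →+* R) {t s : A} (h : IsUnit (φ t)) (h' : IsUnit (φ s))
    {d e : ℕ} (ht : t ∈ 𝒜 d) (hd : 0 < d) (hs : s ∈ 𝒜 e) (he : 0 < e) :
    specToProj 𝒜 φ h ht hd = specToProj 𝒜 φ h' hs he := by
  have h1 : IsUnit (φ (t * s)) := by rw [map_mul]; exact h.mul h'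
  have h2 : IsUnit (φ (s * t)) := by rw [map_mul]; exact h'.mul h
  rw [specToProj_eq_mul 𝒜 φ h h1 ht hd hs, specToProj_eq_mul 𝒜 φ h' h2 hs he ht]
  congr 1
  · exact mul_comm _ _
  · exact add_comm _ _

/-- Homogeneous coordinates matter only up to a common unit. This makes the chart morphisms glue. -/
theorem specToProj_eq_of_scale (φ φ' : A →+* R) {t s : A} (h : IsUnit (φ t)) (h' : IsUnit (φ' s))
    {d e : ℕ} (ht : t ∈ 𝒜 d) (hd : 0 < d) (hs : s ∈ 𝒜 e) (he : 0 < e) (u : R) (hu0 : IsUnit u)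
    (hu : ∀ e, ∀ a ∈ 𝒜 e, φ' a = u ^ e * φ a) :
    specToProj 𝒜 φ h ht hd = specToProj 𝒜 φ' h' hs he := by
  have ht' : IsUnit (φ' t) := by rw [hu d t ht]; exact (hu0.pow d).mul h
  rw [specToProj_congr 𝒜 φ' h' ht' hs he ht hd, specToProj, specToProj,
    awayLift_eq_of_scale 𝒜 φ φ' h ht' ht u hu]

theorem specToProj_mem_basicOpen (φ : A →+* R) {t : A} (h : IsUnit (φ t)) {d : ℕ} (ht : t ∈ 𝒜 d)
    (hd : 0 < d) {g : A} {e : ℕ} (hg : g ∈ 𝒜 e) (he : 0 < e) (p : PrimeSpectrum R) :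
    specToProj 𝒜 φ h ht hd p ∈ Proj.basicOpen 𝒜 g ↔ φ g ∉ p.asIdeal := by
  have h1 : specToProj 𝒜 φ h ht hd p ∈ Proj.basicOpen 𝒜 g ↔
      (Spec.map (CommRingCat.ofHom (awayLift 𝒜 φ h))) p ∈
        Proj.awayι 𝒜 t ht hd ⁻¹ᵁ Proj.basicOpen 𝒜 g := by
    rfl
  rw [h1, Proj.awayι_preimage_basicOpen 𝒜 ht hd hg he]
  change awayLift 𝒜 φ h _ ∉ p.asIdeal ↔ _
  -- The element cutting out `D₊(g)` inside `D₊(t)` is `g ^ d / t ^ e`, so its image is `φ g ^ d` up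
  -- to a unit.
  have h2 := awayLift_mk 𝒜 φ h ht e (g ^ d) (by
    convert! SetLike.pow_mem_graded d hg using 2; exact mul_comm _ _)
  have h3 : awayLift 𝒜 φ h (Away.isLocalizationElem ht hg) * φ t ^ e = φ g ^ d := by
    rw [← map_pow φ g d]; exact h2
  rw [not_iff_not, ← (Ideal.mul_unit_mem_iff_mem p.asIdeal (h.pow e)), h3]
  exact ⟨fun H => p.2.mem_of_pow_mem d H, fun H => Ideal.pow_mem_of_mem _ H d hd⟩

theorem specToProj_toSpecZero (φ : A →+* R) {t : A} (h : IsUnit (φ t)) {d : ℕ} (ht : t ∈ 𝒜 d)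
    (hd : 0 < d) {B : Type} [CommRing B] (i : B →+* 𝒜 0) :
    specToProj 𝒜 φ h ht hd ≫ Proj.toSpecZero 𝒜 ≫ Spec.map (CommRingCat.ofHom i) =
      Spec.map (CommRingCat.ofHom (φ.comp ((algebraMap (𝒜 0) A).comp i))) := by
  rw [specToProj, Category.assoc, Proj.awayι_toSpecZero_assoc, ← Spec.map_comp, ← Spec.map_comp,
    ← CommRingCat.ofHom_comp, ← CommRingCat.ofHom_comp]
  congr 2
  ext b
  rw [RingHom.comp_apply, RingHom.comp_apply]
  have h0 : ((i b : 𝒜 0) : A) ∈ 𝒜 (0 • d) := by rw [zero_smul]; exact (i b).2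
  have h1 := awayLift_mk 𝒜 φ h ht 0 (i b : A) h0
  rw [pow_zero, mul_one] at h1
  refine Eq.trans ?_ h1
  congr 1
  ext
  rw [Away.val_mk]
  change Localization.mk _ _ = _
  congr 1
  exact Subtype.ext (pow_zero t).symm

/-- A morphism to `Proj A` that restricts to `Spec R → Spec (A_t)₀` over `D₊(t)`, given by a
surjective ring map, is a closed immersion over `D₊(t)`. -/
theorem isClosedImmersion_restrict_basicOpen {X : Scheme.{0}} (i : X ⟶ Proj 𝒜) (φ : A →+* R)
    {t : A} (h : IsUnit (φ t)) {d : ℕ} (ht : t ∈ 𝒜 d) (hd : 0 < d)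
    (j : Spec (CommRingCat.of R) ⟶ X) [IsOpenImmersion j] (hj : j ≫ i = specToProj 𝒜 φ h ht hd)
    (hrange : Set.range j = i ⁻¹' (Proj.basicOpen 𝒜 t : Set (Proj 𝒜)))
    (hsurj : Function.Surjective (awayLift 𝒜 φ h)) :
    IsClosedImmersion (i ∣_ Proj.basicOpen 𝒜 t) := by
  let U := Proj.basicOpen 𝒜 t
  let ε : Spec (CommRingCat.of R) ≅ (i ⁻¹ᵁ U).toScheme :=
    IsOpenImmersion.isoOfRangeEq j (i ⁻¹ᵁ U).ι (by rw [hrange, Scheme.Opens.range_ι]; rfl)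
  have hε : ε.hom ≫ (i ⁻¹ᵁ U).ι = j := IsOpenImmersion.isoOfRangeEq_hom_fac _ _ _
  have h1 : ε.hom ≫ (i ∣_ U) = Spec.map (CommRingCat.ofHom (awayLift 𝒜 φ h)) ≫
      (Proj.basicOpenIsoSpec 𝒜 t ht hd).inv := by
    rw [← cancel_mono U.ι, Category.assoc, morphismRestrict_ι, reassoc_of% hε, hj, Category.assoc,
      Proj.basicOpenIsoSpec_inv_ι]
    rfl
  have h2 : IsClosedImmersion (Spec.map (CommRingCat.ofHom (awayLift 𝒜 φ h))) :=
    IsClosedImmersion.spec_of_surjective _ hsurj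
  have h3 : i ∣_ U = ε.inv ≫ Spec.map (CommRingCat.ofHom (awayLift 𝒜 φ h)) ≫
      (Proj.basicOpenIsoSpec 𝒜 t ht hd).inv := by
    rw [← h1, Iso.inv_hom_id_assoc]
  rw [h3]
  infer_instance

end ProjMorphism

/-! ### Projective embeddings of toric varieties -/

section Projective

attribute [local instance] MvPolynomial.gradedAlgebra

/-! ### Morphisms given by monomials on a single chart. -/

section Monomial

variable {n : ℕ} {T : Type}

/-- The map `y_j ↦ χ^{q_j - w}` from a polynomial ring to the coordinate ring of a chart. -/
def monomialMap (q : T → Fin n → ℤ) (w : Fin n → ℤ) (σ : PointedCone ℝ (Fin n → ℝ))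
    (h : ∀ j, q j - w ∈ dualMonoid σ) : MvPolynomial T ℂ →ₐ[ℂ] coordRing σ :=
  MvPolynomial.aeval fun j => AddMonoidAlgebra.single ⟨q j - w, h j⟩ 1

variable {q : T → Fin n → ℤ} {w w' : Fin n → ℤ} {σ τ : PointedCone ℝ (Fin n → ℝ)}

theorem monomialMap_X (h : ∀ j, q j - w ∈ dualMonoid σ) (j : T) :
    monomialMap q w σ h (MvPolynomial.X j) = AddMonoidAlgebra.single ⟨q j - w, h j⟩ 1 := by
  simp [monomialMap]

theorem coordRingMap_comp_monomialMap (hle : τ ≤ σ) (h : ∀ j, q j - w ∈ dualMonoid σ)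
    (h' : ∀ j, q j - w ∈ dualMonoid τ) :
    (coordRingMap hle).comp (monomialMap q w σ h : MvPolynomial T ℂ →+* coordRing σ) =
      (monomialMap q w τ h' : MvPolynomial T ℂ →+* coordRing τ) := by
  refine MvPolynomial.ringHom_ext (fun c => ?_) fun j => ?_
  · simp [monomialMap, coordRingMap]
  · rw [RingHom.comp_apply, RingHom.coe_coe, monomialMap_X, coordRingMap_single, RingHom.coe_coe,
      monomialMap_X]
    rfl

theorem isUnit_single (u : Fin n → ℤ) (hu : u ∈ dualMonoid σ) (hu' : -u ∈ dualMonoid σ) :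
    IsUnit (AddMonoidAlgebra.single ⟨u, hu⟩ 1 : coordRing σ) := by
  refine IsUnit.of_mul_eq_one (AddMonoidAlgebra.single ⟨-u, hu'⟩ 1) ?_
  rw [AddMonoidAlgebra.single_mul_single, AddMonoidAlgebra.one_def, mul_one]
  congr 1
  exact Subtype.ext (add_neg_cancel u)

theorem aeval_smul_of_isHomogeneous {R : Type} [CommRing R] [Algebra ℂ R] (r : T → R) (u : R)
    {a : MvPolynomial T ℂ} {e : ℕ} (ha : a.IsHomogeneous e) :
    MvPolynomial.aeval (fun j => u * r j) a = u ^ e * MvPolynomial.aeval r a := by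
  rw [MvPolynomial.aeval_def, MvPolynomial.aeval_def, MvPolynomial.eval₂_eq, MvPolynomial.eval₂_eq,
    Finset.mul_sum]
  refine Finset.sum_congr rfl fun d hd => ?_
  have hdeg : ∑ i ∈ d.support, d i = e := by
    have := ha (MvPolynomial.mem_support_iff.1 hd)
    rw [← this, Finsupp.weight_apply, Finsupp.sum]
    simp
  simp only [mul_pow, Finset.prod_mul_distrib]
  rw [Finset.prod_pow_eq_pow_sum, hdeg]
  ring

theorem monomialMap_scale (h : ∀ j, q j - w ∈ dualMonoid σ) (h' : ∀ j, q j - w' ∈ dualMonoid σ)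
    (hw : w - w' ∈ dualMonoid σ) {e : ℕ} {a : MvPolynomial T ℂ}
    (ha : a ∈ MvPolynomial.homogeneousSubmodule T ℂ e) :
    monomialMap q w' σ h' a =
      (AddMonoidAlgebra.single ⟨w - w', hw⟩ 1 : coordRing σ) ^ e * monomialMap q w σ h a := by
  rw [monomialMap, monomialMap, ← aeval_smul_of_isHomogeneous _ _
    ((MvPolynomial.mem_homogeneousSubmodule _ _).1 ha)]
  congr 2
  funext j
  rw [AddMonoidAlgebra.single_mul_single, mul_one]
  congr 1
  exact Subtype.ext (by simp)

theorem X_mem_homogeneousSubmodule (j : T) :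
    (MvPolynomial.X j : MvPolynomial T ℂ) ∈ MvPolynomial.homogeneousSubmodule T ℂ 1 :=
  (MvPolynomial.mem_homogeneousSubmodule _ _).2 (MvPolynomial.isHomogeneous_X ℂ j)

/-- The morphism to `Proj` given by the monomials `χ^{q_j}`, on a chart on which all `χ^{q_j - w}`
are regular and one of them is invertible. -/
def monomialMorphism (h : ∀ j, q j - w ∈ dualMonoid σ) (k : T) (hk : w - q k ∈ dualMonoid σ) :
    Spec (CommRingCat.of (coordRing σ)) ⟶ Proj (MvPolynomial.homogeneousSubmodule T ℂ) :=
  specToProj _ (monomialMap q w σ h : MvPolynomial T ℂ →+* coordRing σ) (t := MvPolynomial.X k)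
    (by
      rw [RingHom.coe_coe, monomialMap_X]
      exact isUnit_single _ _ (by rwa [neg_sub]))
    (X_mem_homogeneousSubmodule k) one_pos

/-- The two trivializations differ by the character of `w - w'`, which is a unit on the smaller
chart because both it and its inverse are regular there. -/
theorem specMap_monomialMorphism (hle : τ ≤ σ) (h : ∀ j, q j - w ∈ dualMonoid σ) (k : T)
    (hk : w - q k ∈ dualMonoid σ) (h' : ∀ j, q j - w' ∈ dualMonoid τ) (k' : T)
    (hk' : w' - q k' ∈ dualMonoid τ) (hw : w - w' ∈ dualMonoid τ) (hw' : w' - w ∈ dualMonoid τ) :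
    Spec.map (CommRingCat.ofHom (coordRingMap hle)) ≫ monomialMorphism h k hk =
      monomialMorphism h' k' hk' := by
  have h1 : ∀ j, q j - w ∈ dualMonoid τ := fun j => dualMonoid_anti hle (h j)
  have hu : IsUnit (((coordRingMap hle).comp
      (monomialMap q w σ h : MvPolynomial T ℂ →+* coordRing σ)) (MvPolynomial.X k)) := by
    rw [coordRingMap_comp_monomialMap hle h h1, RingHom.coe_coe, monomialMap_X]
    exact isUnit_single _ _ (by rw [neg_sub]; exact dualMonoid_anti hle hk)
  rw [monomialMorphism, specMap_specToProj _ _ _ _ hu]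
  refine specToProj_eq_of_scale _ _ _ _ _ _ _ _ _
    (AddMonoidAlgebra.single ⟨w - w', hw⟩ 1 : coordRing τ) (isUnit_single _ _ (by rwa [neg_sub]))
    fun e a ha => ?_
  rw [coordRingMap_comp_monomialMap hle h h1]
  exact monomialMap_scale h1 h' hw ha

theorem monomialMorphism_mem_basicOpen (h : ∀ j, q j - w ∈ dualMonoid σ) (k : T)
    (hk : w - q k ∈ dualMonoid σ) {g : MvPolynomial T ℂ} {e : ℕ}
    (hg : g ∈ MvPolynomial.homogeneousSubmodule T ℂ e) (he : 0 < e)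
    (p : PrimeSpectrum (coordRing σ)) :
    monomialMorphism h k hk p ∈ Proj.basicOpen (MvPolynomial.homogeneousSubmodule T ℂ) g ↔
      monomialMap q w σ h g ∉ p.asIdeal :=
  specToProj_mem_basicOpen _ _ _ _ _ hg he p

theorem iSup_basicOpen_X :
    ⨆ j : T, Proj.basicOpen (MvPolynomial.homogeneousSubmodule T ℂ) (MvPolynomial.X j) = ⊤ := by
  refine Proj.iSup_basicOpen_eq_top' _ _ (fun j => ⟨1, X_mem_homogeneousSubmodule j⟩) ?_
  rw [eq_top_iff]
  intro a _
  induction a using MvPolynomial.induction_on with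
  | C c =>
    exact Subalgebra.algebraMap_mem _ (⟨MvPolynomial.C c,
      (MvPolynomial.mem_homogeneousSubmodule _ _).2 (MvPolynomial.isHomogeneous_C T c)⟩ :
      MvPolynomial.homogeneousSubmodule T ℂ 0)
  | add a b ha hb => exact add_mem (ha trivial) (hb trivial)
  | mul_X a j ha => exact mul_mem (ha trivial) (Algebra.subset_adjoin ⟨j, rfl⟩)

end Monomial

namespace Fan

variable {n : ℕ} (Δ : Fan n)

/-- The inclusion of an affine chart into the toric variety. -/
def inclusion (σ : Δ.cones) : Spec (CommRingCat.of (coordRing σ.1)) ⟶ Δ.toricVariety :=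
  colimit.ι Δ.chart σ

instance (σ : Δ.cones) : IsOpenImmersion (Δ.inclusion σ) :=
  inferInstanceAs (IsOpenImmersion (colimit.ι Δ.chart σ))

theorem chart_map_inclusion {σ τ : Δ.cones} (i : τ ⟶ σ) :
    Δ.chart.map i ≫ Δ.inclusion σ = Δ.inclusion τ := colimit.w Δ.chart i

theorem inclusion_jointly_surjective (x : Δ.toricVariety) :
    ∃ (σ : Δ.cones) (p : PrimeSpectrum (coordRing σ.1)), Δ.inclusion σ p = x :=
  Scheme.IsLocallyDirected.ι_jointly_surjective Δ.chart x

theorem inclusion_structureMap (σ : Δ.cones) : Δ.inclusion σ ≫ Δ.structureMap =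
    Spec.map (CommRingCat.ofHom (algebraMap ℂ (coordRing σ.1))) := colimit.ι_desc _ _

end Fan

/-! ### The lattice points of the embedding and the morphism they define. -/

namespace AmpleSystem

variable {n : ℕ} {V ι : Type*} [DecidableEq V] (S : AmpleSystem n V ι)

/-- The lattice points `mu f` and their neighbours `mu f + dual f x`. -/
def point : (Σ f, Option {x // x ∈ S.facet f}) → Fin n → ℤ
  | ⟨f, none⟩ => S.mu f
  | ⟨f, some x⟩ => S.mu f + S.dual f x

/-- Every point lies on a segment from some `mu f` to some `mu g`: by `exists_mu_sub`, `mu f + dual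
f x` is the first lattice step towards the adjacent facet. Lower bounds valid for the `mu` therefore
hold for all points, and the relation also provides binomial equations of the image. -/
theorem exists_smul_point (j) : ∃ (l : ℕ) (f g : ι),
    (l + 1) • S.point j = l • S.mu f + S.mu g := by
  obtain ⟨f, _ | ⟨x, hx⟩⟩ := j
  · exact ⟨0, f, f, by simp [point]⟩
  · obtain ⟨g, l, hg, -⟩ := S.exists_mu_sub hx
    refine ⟨l, f, g, ?_⟩
    rw [eq_add_of_sub_eq hg, point, smul_add, add_smul, add_smul, one_smul, one_smul]
    funext i
    simp
    ring

theorem neg_c_le_point (j) (x : V) : -(S.c x : ℝ) ≤ pairing (S.point j) (S.rvec x) := by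
  obtain ⟨l, f, g, h⟩ := S.exists_smul_point j
  have h1 := congrArg (fun u => pairing u (S.rvec x)) h
  simp only [← natCast_zsmul, pairing_smul_left, pairing_add_left] at h1
  push_cast at h1
  have hl : (0 : ℝ) ≤ l := Nat.cast_nonneg l
  have h2 := mul_le_mul_of_nonneg_left (S.neg_c_le f x) hl
  have h3 := S.neg_c_le g x
  by_contra hlt
  push Not at hlt
  have := mul_lt_mul_of_pos_left hlt (by positivity : (0 : ℝ) < l + 1)
  linarith

theorem point_sub_mem {σ : PointedCone ℝ (Fin n → ℝ)} {f : ι} (hσ : σ ≤ S.cone (S.facet f)) (j) :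
    S.point j - S.mu f ∈ dualMonoid σ := fun z hz =>
  S.pairing_nonneg_of_mem_cone (fun x hx => by
    rw [pairing_sub_left, S.pairing_mu hx]
    linarith [S.neg_c_le_point j x]) (hσ hz)

theorem mu_sub_mem {σ : PointedCone ℝ (Fin n → ℝ)} {f : ι} (hσ : σ ≤ S.cone (S.facet f)) (g) :
    S.mu g - S.mu f ∈ dualMonoid σ := S.point_sub_mem hσ ⟨g, none⟩

/-- The coordinate ring of a maximal chart is generated by the characters of the dual basis. -/
theorem awayLift_surjective {T : Type} (q : T → Fin n → ℤ) (f : ι) (k : T) (hk : q k = S.mu f)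
    (hq : ∀ x ∈ S.facet f, ∃ j, q j = S.mu f + S.dual f x)
    (h : ∀ j, q j - S.mu f ∈ dualMonoid (S.cone (S.facet f)))
    (hu : IsUnit ((monomialMap q (S.mu f) _ h : MvPolynomial T ℂ →+* coordRing (S.cone (S.facet f)))
      (MvPolynomial.X k))) :
    Function.Surjective (awayLift (MvPolynomial.homogeneousSubmodule T ℂ)
      (monomialMap q (S.mu f) _ h : MvPolynomial T ℂ →+* coordRing (S.cone (S.facet f))) hu) := by
  set φ := (monomialMap q (S.mu f) _ h : MvPolynomial T ℂ →+* coordRing (S.cone (S.facet f))) with hφ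
  set Λ := awayLift (MvPolynomial.homogeneousSubmodule T ℂ) φ hu with hΛ
  -- The inverted coordinate has image 1, so denominators disappear and the range contains the image
  -- of every homogeneous polynomial.
  have h1 : φ (MvPolynomial.X k) = 1 := by
    rw [hφ, RingHom.coe_coe, monomialMap_X, AddMonoidAlgebra.one_def]
    congr 1
    exact Subtype.ext (by simp [hk])
  have hmk : ∀ (e : ℕ) (a : MvPolynomial T ℂ),
      a ∈ MvPolynomial.homogeneousSubmodule T ℂ e → φ a ∈ Λ.range := by
    intro e a ha
    have := awayLift_mk _ φ hu (X_mem_homogeneousSubmodule k) e a (by simpa using ha)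
    rw [h1, one_pow, mul_one] at this
    exact ⟨_, this⟩
  let M : AddSubmonoid (dualMonoid (S.cone (S.facet f))) :=
    { carrier := {u | (AddMonoidAlgebra.single u 1 : coordRing _) ∈ Λ.range}
      zero_mem' := one_mem Λ.range
      add_mem' := fun {u w} hu hw => by
        have := mul_mem (show _ ∈ Λ.range from hu) (show _ ∈ Λ.range from hw)
        rwa [AddMonoidAlgebra.single_mul_single, mul_one] at this }
  have hdual : ∀ x ∈ S.facet f, S.dual f x ∈ dualMonoid (S.cone (S.facet f)) := fun x hx z hz =>
    S.mem_cone_facet_iff.1 hz x hx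
  have hM : ∀ x (hx : x ∈ S.facet f), (⟨S.dual f x, hdual x hx⟩ : dualMonoid _) ∈ M := by
    intro x hx
    obtain ⟨j, hj⟩ := hq x hx
    have := hmk 1 _ (X_mem_homogeneousSubmodule j)
    rw [hφ, RingHom.coe_coe, monomialMap_X] at this
    change _ ∈ Λ.range
    convert this using 3
    simp [hj]
  -- The coordinates of `u` in the dual basis are its values on the generators, which are
  -- nonnegative integers; so the dual vectors generate the monoid.
  have htop : ∀ u : dualMonoid (S.cone (S.facet f)), u ∈ M := by
    intro u
    have hnat : ∀ x ∈ S.facet f, ∃ a : ℕ, pairing u.1 (S.rvec x) = a := by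
      intro x hx
      have h0 := u.2 _ (S.rvec_mem_cone hx)
      rw [UnimodularSystem.rvec, pairing_toReal] at h0 ⊢
      obtain ⟨a, ha⟩ := Int.eq_ofNat_of_zero_le (by exact_mod_cast h0 : (0 : ℤ) ≤ _)
      exact ⟨a, by rw [ha]; rfl⟩
    choose! a ha using hnat
    have : u = ∑ x ∈ (S.facet f).attach, a x • (⟨S.dual f x, hdual x x.2⟩ : dualMonoid _) := by
      refine Subtype.ext (eq_of_forall_pairing fun z => ?_)
      rw [S.pairing_eq_sum f, AddSubmonoid.coe_finsetSum, pairing_sum_left, ← Finset.sum_attach]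
      refine Finset.sum_congr rfl fun x _ => ?_
      rw [AddSubmonoidClass.coe_nsmul, ← natCast_zsmul, pairing_smul_left, ha x x.2]
      push_cast
      ring
    rw [this]
    exact sum_mem fun x _ => nsmul_mem (hM x x.2) _
  rw [← RingHom.range_eq_top, eq_top_iff]
  intro g _
  induction g using AddMonoidAlgebra.induction_linear with
  | zero => exact zero_mem _
  | add g g' hg hg' => exact add_mem (hg trivial) (hg' trivial)
  | single u c =>
    have h2 := hmk 0 (MvPolynomial.C c)
      ((MvPolynomial.mem_homogeneousSubmodule _ _).2 (MvPolynomial.isHomogeneous_C T c))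
    have h3 := mul_mem h2 (show _ ∈ Λ.range from htop u)
    convert h3 using 1
    rw [hφ, RingHom.coe_coe, ← MvPolynomial.algebraMap_eq, AlgHom.commutes, ← Algebra.smul_def,
      AddMonoidAlgebra.smul_single, smul_eq_mul, mul_one]

variable (Δ : Fan n)

/-- The fan consists of the cones spanned by the faces of the system. -/
def Spans : Prop := ∀ σ, σ ∈ Δ.cones ↔ ∃ s, S.IsFace s ∧ σ = S.cone s

variable {S Δ}

theorem Spans.exists_le (hΔ : S.Spans Δ) (σ : Δ.cones) : ∃ f, σ.1 ≤ S.cone (S.facet f) := by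
  obtain ⟨s, ⟨f, hf⟩, hs⟩ := (hΔ σ).1 σ.2
  exact ⟨f, hs ▸ S.cone_mono hf⟩

theorem Spans.cone_facet_mem (hΔ : S.Spans Δ) (f : ι) : S.cone (S.facet f) ∈ Δ.cones :=
  (hΔ _).2 ⟨_, ⟨f, subset_rfl⟩, rfl⟩

section Embedding

variable {T : Type} (e : T ≃ Σ f, Option {x // x ∈ S.facet f})

/-- The projective morphism on a chart. -/
def chartMorphism {σ : PointedCone ℝ (Fin n → ℝ)} {f : ι} (hσ : σ ≤ S.cone (S.facet f)) :
    Spec (CommRingCat.of (coordRing σ)) ⟶ Proj (MvPolynomial.homogeneousSubmodule T ℂ) :=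
  monomialMorphism (q := fun j => S.point (e j)) (w := S.mu f) (fun j => S.point_sub_mem hσ (e j))
    (e.symm ⟨f, none⟩) (by
      rw [e.apply_symm_apply]
      simp [point, zero_mem])

theorem specMap_chartMorphism {σ τ : PointedCone ℝ (Fin n → ℝ)} (h : τ ≤ σ) {f g : ι}
    (hσ : σ ≤ S.cone (S.facet f)) (hτ : τ ≤ S.cone (S.facet g)) :
    Spec.map (CommRingCat.ofHom (coordRingMap h)) ≫ chartMorphism e hσ = chartMorphism e hτ :=
  specMap_monomialMorphism _ _ _ _ _ _ _ (S.mu_sub_mem hτ f) (S.mu_sub_mem (h.trans hσ) g)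

theorem chartMorphism_congr {σ : PointedCone ℝ (Fin n → ℝ)} {f g : ι}
    (hσ : σ ≤ S.cone (S.facet f)) (hσ' : σ ≤ S.cone (S.facet g)) :
    chartMorphism e hσ = chartMorphism e hσ' := by
  rw [← specMap_chartMorphism e le_rfl hσ hσ', coordRingMap_refl]
  have : Spec.map (CommRingCat.ofHom (RingHom.id (coordRing σ))) = 𝟙 _ := Spec.map_id _
  rw [this, Category.id_comp]

/-- The morphism from the toric variety to projective space given by the points of the system. -/
def embedding (hΔ : S.Spans Δ) :
    Δ.toricVariety ⟶ Proj (MvPolynomial.homogeneousSubmodule T ℂ) :=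
  colimit.desc Δ.chart
    { pt := Proj (MvPolynomial.homogeneousSubmodule T ℂ)
      ι :=
        { app := fun σ => chartMorphism e (hΔ.exists_le σ).choose_spec
          naturality := fun τ _ i =>
            (specMap_chartMorphism e (leOfHom i) _ (hΔ.exists_le τ).choose_spec).trans
              (Category.comp_id _).symm } }

theorem ι_embedding (hΔ : S.Spans Δ) (σ : Δ.cones) {f : ι} (hσ : σ.1 ≤ S.cone (S.facet f)) :
    Δ.inclusion σ ≫ embedding e hΔ = chartMorphism e hσ :=
  (colimit.ι_desc _ _).trans (chartMorphism_congr e (hΔ.exists_le σ).choose_spec hσ)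

theorem embedding_mem_basicOpen (hΔ : S.Spans Δ) (σ : Δ.cones) {f : ι}
    (hσ : σ.1 ≤ S.cone (S.facet f)) {g : MvPolynomial T ℂ} {d : ℕ}
    (hg : g ∈ MvPolynomial.homogeneousSubmodule T ℂ d) (hd : 0 < d)
    (p : PrimeSpectrum (coordRing σ.1)) :
    embedding e hΔ (Δ.inclusion σ p) ∈
      Proj.basicOpen (MvPolynomial.homogeneousSubmodule T ℂ) g ↔
      monomialMap (fun j => S.point (e j)) (S.mu f) σ.1 (fun j => S.point_sub_mem hσ (e j)) g
        ∉ p.asIdeal := by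
  have : embedding e hΔ (Δ.inclusion σ p) = chartMorphism e hσ p := by
    rw [← ι_embedding e hΔ σ hσ]
    rfl
  rw [this]
  exact monomialMorphism_mem_basicOpen _ _ _ hg hd p

/-- On a chart `σ` inside the cone of `g`, the coordinate of `mu f` becomes the character of `mu f -
mu g`. This form is nonnegative on `σ` and vanishes exactly on the intersection with the cone of
`f`, so the coordinate is invertible precisely on the overlap of the charts. -/
theorem range_ι (hΔ : S.Spans Δ) (f : ι) :
    Set.range (Δ.inclusion ⟨_, hΔ.cone_facet_mem f⟩) = embedding e hΔ ⁻¹'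
      (Proj.basicOpen (MvPolynomial.homogeneousSubmodule T ℂ)
        (MvPolynomial.X (e.symm ⟨f, none⟩)) : Set _) := by
  apply subset_antisymm
  · rintro _ ⟨p, rfl⟩
    refine (embedding_mem_basicOpen e hΔ ⟨_, hΔ.cone_facet_mem f⟩ (f := f) le_rfl
      (X_mem_homogeneousSubmodule _) one_pos p).2 fun hp => ?_
    rw [monomialMap_X] at hp
    refine p.2.ne_top (Ideal.eq_top_of_isUnit_mem _ hp (isUnit_single _ _ ?_))
    simp [point, zero_mem]
  · intro x hx
    obtain ⟨σ, p, rfl⟩ := Δ.inclusion_jointly_surjective x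
    obtain ⟨s, ⟨g, hg⟩, hs⟩ := (hΔ σ).1 σ.2
    have hσ : σ.1 ≤ S.cone (S.facet g) := hs ▸ S.cone_mono hg
    have hp := (embedding_mem_basicOpen e hΔ σ hσ (X_mem_homogeneousSubmodule _) one_pos p).1 hx
    rw [monomialMap_X] at hp
    have hu : S.mu f - S.mu g ∈ dualMonoid σ.1 := S.mu_sub_mem hσ f
    have hface : ∀ z, z ∈ σ.1 ⊓ S.cone (S.facet f) ↔
        z ∈ σ.1 ∧ pairing (S.mu f - S.mu g) z = 0 := by
      intro z
      rw [Submodule.mem_inf]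
      refine ⟨fun h => ⟨h.1, ?_⟩, fun h => ⟨h.1, ?_⟩⟩
      · rw [pairing_sub_left]
        linarith [S.pairing_mu_le (hσ h.1) f, S.pairing_mu_le h.2 g]
      · have hnn : ∀ x ∈ s, 0 ≤ pairing (S.mu f - S.mu g) (S.rvec x) := fun x hx =>
          hu _ (hs ▸ S.rvec_mem_cone hx)
        rw [hs] at h
        rw [← S.mem_cone_filter_iff hg hnn (t := s.filter fun x =>
          pairing (S.mu f - S.mu g) (S.rvec x) = 0) (Finset.filter_subset _ _)
          (fun x hx => by simp [hx])] at h
        refine S.cone_mono (fun x hx => S.mem_facet_of_le ?_) h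
        obtain ⟨hxs, hx0⟩ := Finset.mem_filter.1 hx
        rw [pairing_sub_left, S.pairing_mu (hg hxs)] at hx0
        linarith
    let τ : Δ.cones := ⟨_, Δ.face_mem σ σ.2 _ ⟨_, hu, hface⟩⟩
    let i : τ ⟶ σ := homOfLE (show σ.1 ⊓ S.cone (S.facet f) ≤ σ.1 from inf_le_left)
    let k : τ ⟶ ⟨_, hΔ.cone_facet_mem f⟩ :=
      homOfLE (show σ.1 ⊓ S.cone (S.facet f) ≤ _ from inf_le_right)
    have hr : p ∈ Set.range (Δ.chart.map i) := by
      rw [Δ.range_chart_map i ⟨_, hu⟩ hface]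
      intro h
      apply hp
      convert h using 4
      simp [point]
    obtain ⟨p', rfl⟩ := hr
    refine ⟨Δ.chart.map k p', ?_⟩
    change (Δ.chart.map k ≫ Δ.inclusion _) p' = (Δ.chart.map i ≫ Δ.inclusion _) p'
    rw [Δ.chart_map_inclusion, Δ.chart_map_inclusion]

/-- The sets `D₊` of the coordinates `mu f` need not cover the target. Where all of these
coordinates vanish, some other `X j` does not, and then neither does the binomial `X j ^ (l + 1) - X
f ^ l * X g` of `exists_smul_point`. Adding the sets `D₊` of the binomials gives a cover. Over the
first kind the morphism is affine with surjective ring map; over the second the preimage is empty,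
since the binomials pull back to zero. -/
theorem isClosedImmersion_embedding (hΔ : S.Spans Δ) : IsClosedImmersion (embedding e hΔ) := by
  choose l f g hrel using S.exists_smul_point
  let bin : T → MvPolynomial T ℂ := fun j => MvPolynomial.X j ^ (l (e j) + 1) -
    MvPolynomial.X (e.symm ⟨f (e j), none⟩) ^ l (e j) * MvPolynomial.X (e.symm ⟨g (e j), none⟩)
  have hbin : ∀ j, bin j ∈ MvPolynomial.homogeneousSubmodule T ℂ (l (e j) + 1) := by
    intro j
    refine sub_mem ?_ ?_
    · simpa using SetLike.pow_mem_graded (l (e j) + 1) (X_mem_homogeneousSubmodule j)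
    · simpa using SetLike.mul_mem_graded (SetLike.pow_mem_graded (l (e j))
        (X_mem_homogeneousSubmodule (e.symm ⟨f (e j), none⟩)))
        (X_mem_homogeneousSubmodule (e.symm ⟨g (e j), none⟩))
  let U : ι ⊕ T → (Proj (MvPolynomial.homogeneousSubmodule T ℂ)).Opens :=
    Sum.elim (fun f => Proj.basicOpen _ (MvPolynomial.X (e.symm ⟨f, none⟩)))
      (fun j => Proj.basicOpen _ (bin j))
  have hU : iSup U = ⊤ := by
    rw [eq_top_iff, ← iSup_basicOpen_X]
    refine iSup_le fun j p hp => ?_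
    rw [TopologicalSpace.Opens.mem_iSup]
    by_contra! H
    have h1 : ∀ f, MvPolynomial.X (e.symm ⟨f, none⟩) ∈ p.asHomogeneousIdeal := fun f => by
      have := H (Sum.inl f)
      exact not_not.1 this
    have h2 : bin j ∈ p.asHomogeneousIdeal := by
      have := H (Sum.inr j)
      exact not_not.1 this
    have h3 : (MvPolynomial.X j : MvPolynomial T ℂ) ^ (l (e j) + 1) ∈
        p.asHomogeneousIdeal.toIdeal := by
      have := add_mem (show bin j ∈ p.asHomogeneousIdeal.toIdeal from h2)
        (Ideal.mul_mem_left p.asHomogeneousIdeal.toIdeal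
          (MvPolynomial.X (e.symm ⟨f (e j), none⟩) ^ l (e j)) (h1 (g (e j))))
      simpa [bin] using this
    exact hp (p.isPrime.mem_of_pow_mem _ h3)
  refine IsZariskiLocalAtTarget.of_iSup_eq_top U hU ?_
  rintro (f | j)
  · have hk : S.point (e (e.symm ⟨f, none⟩)) = S.mu f := by rw [e.apply_symm_apply]; rfl
    refine isClosedImmersion_restrict_basicOpen _ _ _ _ _ one_pos
      (Δ.inclusion ⟨_, hΔ.cone_facet_mem f⟩)
      (ι_embedding e hΔ ⟨_, hΔ.cone_facet_mem f⟩ (f := f) le_rfl) (range_ι e hΔ f) ?_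
    exact S.awayLift_surjective (fun j => S.point (e j)) f _ hk
      (fun x hx => ⟨e.symm ⟨f, some ⟨x, hx⟩⟩, by simp [point]⟩) _ _
  · have : IsEmpty (embedding e hΔ ⁻¹ᵁ U (Sum.inr j)) := by
      refine ⟨fun ⟨x, hx⟩ => ?_⟩
      obtain ⟨σ, p, rfl⟩ := Δ.inclusion_jointly_surjective x
      obtain ⟨f', hσ⟩ := hΔ.exists_le σ
      refine (embedding_mem_basicOpen e hΔ σ hσ (hbin j) (Nat.succ_pos _) p).1 hx ?_
      have : monomialMap (fun j => S.point (e j)) (S.mu f') σ.1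
          (fun j => S.point_sub_mem hσ (e j)) (bin j) = 0 := by
        simp only [bin, map_sub, map_mul, map_pow, monomialMap_X, AddMonoidAlgebra.single_pow,
          AddMonoidAlgebra.single_mul_single, one_pow, mul_one]
        rw [sub_eq_zero]
        congr 1
        refine Subtype.ext ?_
        have h1 : ∀ f, S.point (e (e.symm ⟨f, none⟩)) = S.mu f := fun f => by
          rw [e.apply_symm_apply]; rfl
        simp only [AddSubmonoidClass.coe_nsmul, AddSubmonoid.coe_add, h1, smul_sub, hrel (e j)]
        rw [add_smul, one_smul]
        abel
      rw [this]
      exact zero_mem _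
    infer_instance

end Embedding

/-- The toric variety of an ample system is projective. -/
theorem Spans.isProjective [Finite ι] [Nonempty ι] (hΔ : S.Spans Δ) :
    IsProjective Δ.structureMap := by
  have : Fintype (Σ f, Option {x // x ∈ S.facet f}) := Fintype.ofFinite _
  have : Nonempty (Σ f, Option {x // x ∈ S.facet f}) := ⟨⟨Classical.arbitrary ι, none⟩⟩
  obtain ⟨N, hN⟩ := Nat.exists_eq_succ_of_ne_zero
    (Fintype.card_ne_zero (α := Σ f, Option {x // x ∈ S.facet f}))
  let e : Fin (N + 1) ≃ Σ f, Option {x // x ∈ S.facet f} := (Fintype.equivFinOfCardEq hN).symm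
  refine ⟨N, embedding e hΔ, isClosedImmersion_embedding e hΔ, ?_⟩
  refine colimit.hom_ext fun σ => ?_
  obtain ⟨f, hσ⟩ := hΔ.exists_le σ
  have h1 : Δ.inclusion σ ≫ embedding e hΔ = chartMorphism e hσ := ι_embedding e hΔ σ hσ
  refine Eq.trans ?_ (Δ.inclusion_structureMap σ).symm
  change Δ.inclusion σ ≫ embedding e hΔ ≫ projectiveSpaceMap N = _
  have h2 : chartMorphism e hσ ≫ projectiveSpaceMap N =
      Spec.map (CommRingCat.ofHom (algebraMap ℂ (coordRing σ.1))) := by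
    refine (specToProj_toSpecZero _ _ _ _ _ _).trans ?_
    congr 2
    refine RingHom.ext fun c => ?_
    exact (monomialMap (fun j => S.point (e j)) (S.mu f) σ.1 _).commutes c
  rw [← h2, ← h1]
  exact (Category.assoc _ _ _).symm

end AmpleSystem

end Projective

/-! ### The polytope of an ample system -/

/-- The face of a polytope on which a linear functional is maximal. -/
theorem mem_convexHull_of_max {E V : Type*} [AddCommGroup E] [Module ℝ E] (q : V → E)
    (l : E →ₗ[ℝ] ℝ) {M : ℝ} (hM : ∀ x, l (q x) ≤ M) {z : E} (hz : z ∈ convexHull ℝ (Set.range q)) :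
    l z ≤ M ∧ (l z = M → z ∈ convexHull ℝ (q '' {x | l (q x) = M})) := by
  refine convexHull_min (t := {z | l z ≤ M ∧
    (l z = M → z ∈ convexHull ℝ (q '' {x | l (q x) = M}))}) ?_ ?_ hz
  · rintro _ ⟨x, rfl⟩
    exact ⟨hM x, fun h => subset_convexHull ℝ _ ⟨x, h, rfl⟩⟩
  · intro y hy z hz a b ha hb hab
    have h1 := mul_le_mul_of_nonneg_left hy.1 ha
    have h2 := mul_le_mul_of_nonneg_left hz.1 hb
    have h3 : l (a • y + b • z) = a * l y + b * l z := by simp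
    have h4 : a * M + b * M = M := by rw [← add_mul, hab, one_mul]
    refine ⟨by rw [h3]; linarith, fun h => ?_⟩
    rw [h3] at h
    rcases ha.eq_or_lt with rfl | ha
    · have : b = 1 := by linarith
      subst this
      simp only [zero_smul, one_smul, zero_add]
      exact hz.2 (by linarith)
    rcases hb.eq_or_lt with rfl | hb
    · have : a = 1 := by linarith
      subst this
      simp only [zero_smul, one_smul, add_zero]
      exact hy.2 (by linarith)
    refine convex_convexHull ℝ _ (hy.2 ?_) (hz.2 ?_) ha.le hb.le hab
    · exact mul_left_cancel₀ ha.ne' (by linarith)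
    · exact mul_left_cancel₀ hb.ne' (by linarith)

/-- The pairing with a character, as a continuous linear functional. -/
def pairingCLM {n : ℕ} (u : Fin n → ℤ) : (Fin n → ℝ) →L[ℝ] ℝ where
  toFun := pairing u
  map_add' := pairing_add_right u
  map_smul' := pairing_smul_right u
  cont := continuous_pairing u

@[simp]
theorem pairingCLM_apply {n : ℕ} (u : Fin n → ℤ) (x : Fin n → ℝ) :
    pairingCLM u x = pairing u x := rfl

namespace AmpleSystem

variable {n : ℕ} {V ι : Type*} [DecidableEq V] (S : AmpleSystem n V ι)

theorem exists_notMem_facet [Nonempty ι] (x : V) : ∃ f, x ∉ S.facet f := by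
  obtain ⟨g, -, hg⟩ := S.exists_facet_of_notMem (f := Classical.arbitrary ι) (s := ∅) (x := x)
    (by simp) (by simp)
  exact ⟨g, hg⟩

variable [Fintype ι]

/-- The average of the characters of the facets. -/
def avg : (Fin n → ℝ) →L[ℝ] ℝ := (Fintype.card ι : ℝ)⁻¹ • ∑ f, pairingCLM (S.mu f)

/-- The support function, normalized by a linear function so as to become positive. -/
def height (x : V) : ℝ := S.c x + S.avg (S.rvec x)

/-- The vertices of the polytope of the system. -/
def vertex (x : V) : Fin n → ℝ := (S.height x)⁻¹ • S.rvec x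

/-- The functional that defines the facet `f` of the polytope. -/
def eta (f : ι) : (Fin n → ℝ) →L[ℝ] ℝ := S.avg - pairingCLM (S.mu f)

/-- The polytope of the system. -/
def polytope : Set (Fin n → ℝ) := convexHull ℝ (Set.range S.vertex)

theorem vertex_mem_polytope (x : V) : S.vertex x ∈ S.polytope := subset_convexHull ℝ _ ⟨x, rfl⟩

variable [Nonempty ι]

/-- The height is the average over all facets of the slack `mu f + c`, which is nonnegative and is
positive for a facet that misses `x`. -/
theorem height_pos (x : V) : 0 < S.height x := by
  have hcard : (0 : ℝ) < Fintype.card ι := by exact_mod_cast Fintype.card_pos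
  have : S.height x = (Fintype.card ι : ℝ)⁻¹ * ∑ f, (pairing (S.mu f) (S.rvec x) + S.c x) := by
    simp only [height, avg, _root_.smul_apply, _root_.sum_apply,
      pairingCLM_apply, Finset.sum_add_distrib, Finset.sum_const, Finset.card_univ, nsmul_eq_mul,
      smul_eq_mul]
    field_simp
    ring
  rw [this]
  refine mul_pos (inv_pos.2 hcard) ?_
  obtain ⟨f, hf⟩ := S.exists_notMem_facet x
  refine Finset.sum_pos' (fun g _ => S.mu_nonneg g x) ⟨f, Finset.mem_univ f, ?_⟩
  exact lt_of_le_of_ne (S.mu_nonneg f x) fun h => hf ((S.mu_eq_zero_iff f x).1 h.symm)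

theorem height_smul_vertex (x : V) : S.height x • S.vertex x = S.rvec x := by
  rw [vertex, smul_inv_smul₀ (S.height_pos x).ne']

theorem eta_vertex (f : ι) (x : V) :
    S.eta f (S.vertex x) = 1 - (S.height x)⁻¹ * (pairing (S.mu f) (S.rvec x) + S.c x) := by
  have h := (S.height_pos x).ne'
  rw [vertex, map_smul, smul_eq_mul, eta, _root_.sub_apply, pairingCLM_apply]
  have : S.avg (S.rvec x) = S.height x - S.c x := by rw [height]; ring
  rw [this]
  field_simp
  ring

theorem eta_vertex_le (f : ι) (x : V) : S.eta f (S.vertex x) ≤ 1 := by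
  rw [S.eta_vertex]
  have := mul_nonneg (inv_pos.2 (S.height_pos x)).le (S.mu_nonneg f x)
  unfold UnimodularSystem.rvec
  linarith

theorem eta_vertex_eq_iff (f : ι) (x : V) : S.eta f (S.vertex x) = 1 ↔ x ∈ S.facet f := by
  rw [S.eta_vertex, sub_eq_self, mul_eq_zero, ← S.mu_eq_zero_iff f x]
  exact or_iff_right (inv_pos.2 (S.height_pos x)).ne'

/-- Every vector is a nonnegative combination of the vertices of a facet. -/
theorem exists_eq_sum_vertex (z : Fin n → ℝ) : ∃ (f : ι) (a : V → ℝ),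
    (∀ x ∈ S.facet f, 0 ≤ a x) ∧ z = ∑ x ∈ S.facet f, a x • S.vertex x := by
  obtain ⟨f, hf⟩ := S.exists_mem_cone_facet z
  refine ⟨f, fun x => pairing (S.dual f x) z * S.height x, fun x hx =>
    mul_nonneg (S.mem_cone_facet_iff.1 hf x hx) (S.height_pos x).le, ?_⟩
  conv_lhs => rw [← S.sum_dual_rvec f z]
  exact Finset.sum_congr rfl fun x _ => by rw [mul_smul, S.height_smul_vertex]

theorem eta_sum_vertex (f : ι) (a : V → ℝ) :
    S.eta f (∑ x ∈ S.facet f, a x • S.vertex x) = ∑ x ∈ S.facet f, a x := by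
  rw [map_sum]
  exact Finset.sum_congr rfl fun x hx => by
    rw [map_smul, (S.eta_vertex_eq_iff f x).2 hx, smul_eq_mul, mul_one]

theorem zero_mem_polytope [Nonempty V] : (0 : Fin n → ℝ) ∈ S.polytope := by
  let x := Classical.arbitrary V
  obtain ⟨f, a, ha, hx⟩ := S.exists_eq_sum_vertex (-S.vertex x)
  have hsum : 0 ≤ ∑ y ∈ S.facet f, a y := Finset.sum_nonneg ha
  rcases hsum.eq_or_lt with h0 | hpos
  · rw [eq_comm, Finset.sum_eq_zero_iff_of_nonneg ha] at h0
    rw [Finset.sum_eq_zero fun y hy => by rw [h0 y hy, zero_smul], neg_eq_zero] at hx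
    rw [← hx]
    exact S.vertex_mem_polytope x
  · set A := ∑ y ∈ S.facet f, a y with hA
    have h1 : A⁻¹ • -S.vertex x ∈ S.polytope := by
      rw [hx, Finset.smul_sum]
      simp only [smul_smul]
      refine (convex_convexHull ℝ _).sum_mem (fun y hy => mul_nonneg (inv_pos.2 hpos).le (ha y hy))
        ?_ fun y _ => S.vertex_mem_polytope y
      rw [← Finset.mul_sum, inv_mul_cancel₀ hpos.ne']
    -- With `-v = A q` for a point `q` of the polytope, the origin is the combination of `v` and `q`
    -- with weights proportional to 1 and `A`.
    have h2 := (convex_convexHull ℝ (Set.range S.vertex)) (S.vertex_mem_polytope x) h1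
      (a := (1 + A)⁻¹) (b := A * (1 + A)⁻¹) (by positivity) (by positivity) (by field_simp)
    have h3 : (0 : Fin n → ℝ) = (1 + A)⁻¹ • S.vertex x +
        (A * (1 + A)⁻¹) • A⁻¹ • -S.vertex x := by
      rw [smul_smul, mul_right_comm, mul_inv_cancel₀ hpos.ne', one_mul, smul_neg, add_neg_cancel]
    exact h3 ▸ h2

/-- If `z` lies in the cone of `f`, then `eta f` is the total weight of `z` in the vertices of `f`.
Weight at most 1 puts `z` on a segment from the origin to a point of that facet. -/
theorem mem_polytope_of_eta_le [Nonempty V] {z : Fin n → ℝ} (hz : ∀ f, S.eta f z ≤ 1) :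
    z ∈ S.polytope := by
  obtain ⟨f, a, ha, rfl⟩ := S.exists_eq_sum_vertex z
  have h1 := hz f
  rw [S.eta_sum_vertex] at h1
  rcases (Finset.sum_nonneg ha).eq_or_lt with h0 | hpos
  · rw [eq_comm, Finset.sum_eq_zero_iff_of_nonneg ha] at h0
    rw [Finset.sum_eq_zero fun y hy => by rw [h0 y hy, zero_smul]]
    exact S.zero_mem_polytope
  · set A := ∑ y ∈ S.facet f, a y with hA
    have h2 : A⁻¹ • ∑ x ∈ S.facet f, a x • S.vertex x ∈ S.polytope := by
      rw [Finset.smul_sum]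
      simp only [smul_smul]
      refine (convex_convexHull ℝ _).sum_mem (fun y hy => mul_nonneg (inv_pos.2 hpos).le (ha y hy))
        ?_ fun y _ => S.vertex_mem_polytope y
      rw [← Finset.mul_sum, inv_mul_cancel₀ hpos.ne']
    have h3 := (convex_convexHull ℝ (Set.range S.vertex)) h2 S.zero_mem_polytope
      (a := A) (b := 1 - A) hpos.le (by linarith) (by ring)
    rwa [smul_zero, add_zero, smul_inv_smul₀ hpos.ne'] at h3

theorem zero_mem_intrinsicInterior [Nonempty V] :
    (0 : Fin n → ℝ) ∈ intrinsicInterior ℝ S.polytope := by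
  refine interior_subset_intrinsicInterior (mem_interior.2 ⟨⋂ f, {z | S.eta f z < 1}, ?_, ?_, ?_⟩)
  · exact fun z hz => S.mem_polytope_of_eta_le fun f => (Set.mem_iInter.1 hz f).le
  · exact isOpen_iInter_of_finite fun f => isOpen_lt (S.eta f).continuous continuous_const
  · simp

/-- The sum of `eta g` over all facets containing `s` is maximal exactly at the vertices common to
those facets, and these are the elements of `s`. -/
theorem exists_functional {s : Finset V} (hs : S.IsFace s) : ∃ (l : (Fin n → ℝ) →L[ℝ] ℝ) (M : ℝ),
    0 < M ∧ (∀ x, l (S.vertex x) ≤ M) ∧ ∀ x, l (S.vertex x) = M ↔ x ∈ s := by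
  classical
  obtain ⟨f, hf⟩ := hs
  let G : Finset ι := Finset.univ.filter fun g => s ⊆ S.facet g
  have hG : ∀ g, g ∈ G ↔ s ⊆ S.facet g := fun g => by simp [G]
  have hM : ∑ g ∈ G, (1 : ℝ) = G.card := by simp
  refine ⟨∑ g ∈ G, S.eta g, G.card, ?_, fun x => ?_, fun x => ?_⟩
  · exact_mod_cast Finset.card_pos.2 ⟨f, (hG f).2 hf⟩
  · rw [_root_.sum_apply, ← hM]
    exact Finset.sum_le_sum fun g _ => S.eta_vertex_le g x
  · rw [_root_.sum_apply, ← hM,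
      Finset.sum_eq_sum_iff_of_le fun g _ => S.eta_vertex_le g x]
    constructor
    · intro h
      by_contra hx
      obtain ⟨g, hg, hxg⟩ := S.exists_facet_of_notMem hf hx
      exact hxg ((S.eta_vertex_eq_iff g x).1 (h g ((hG g).2 hg)))
    · exact fun hx g hg => (S.eta_vertex_eq_iff g x).2 ((hG g).1 hg hx)

theorem vertex_mem_convexHull_iff {s : Finset V} (x : V) :
    S.vertex x ∈ convexHull ℝ (S.vertex '' s) ↔ x ∈ s := by
  refine ⟨fun h => ?_, fun h => subset_convexHull ℝ _ ⟨x, h, rfl⟩⟩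
  obtain ⟨f, hf⟩ := S.exists_mem_facet x
  obtain ⟨l, M, -, hl, hl'⟩ := S.exists_functional (s := {x}) ⟨f, by simpa using hf⟩
  by_contra hx
  have h1 : convexHull ℝ (S.vertex '' s) ⊆ {z | l z < M} := by
    refine convexHull_min ?_ (convex_halfSpace_lt l.toLinearMap.isLinear M)
    rintro _ ⟨y, hy, rfl⟩
    refine lt_of_le_of_ne (hl y) fun h => hx ?_
    rw [← Finset.mem_singleton.1 ((hl' y).1 h)]
    exact hy
  exact (h1 h).ne ((hl' x).2 (Finset.mem_singleton_self x))

theorem vertex_injective : Function.Injective S.vertex := by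
  intro x y h
  have := (S.vertex_mem_convexHull_iff (s := {y}) x).1 (by
    rw [h]; exact (S.vertex_mem_convexHull_iff y).2 (Finset.mem_singleton_self y))
  exact Finset.mem_singleton.1 this

theorem isProperFace_convexHull [Nonempty V] {s : Finset V} (hs : S.IsFace s) :
    IsProperFace S.polytope (convexHull ℝ (S.vertex '' s)) := by
  obtain ⟨l, M, hM, hl, hl'⟩ := S.exists_functional hs
  have hle : ∀ z ∈ convexHull ℝ (S.vertex '' s), l z = M := by
    intro z hz
    refine convexHull_min ?_ (convex_hyperplane l.toLinearMap.isLinear M) hz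
    rintro _ ⟨x, hx, rfl⟩
    exact (hl' x).2 hx
  have hmax := fun z hz => mem_convexHull_of_max S.vertex (l : (Fin n → ℝ) →ₗ[ℝ] ℝ) hl (z := z) hz
  constructor
  · rintro ⟨z₀, hz₀⟩
    refine ⟨l, Set.ext fun z => ⟨fun hz => ⟨?_, fun y hy => ?_⟩, fun hz => ?_⟩⟩
    · exact convexHull_mono (Set.image_subset_range _ _) hz
    · rw [hle z hz]
      exact (hmax y hy).1
    · have h1 : M ≤ l z := by
        rw [← hle z₀ hz₀]
        exact hz.2 z₀ (convexHull_mono (Set.image_subset_range _ _) hz₀)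
      have h2 := (hmax z hz.1).2 (le_antisymm (hmax z hz.1).1 h1)
      refine convexHull_mono (Set.image_mono ?_) h2
      exact fun x hx => (hl' x).1 hx
  · intro h
    have := hle 0 (h ▸ S.zero_mem_polytope)
    rw [map_zero] at this
    exact hM.ne this

/-- If `l` exposes the face with maximum `M`, then `avg - M⁻¹ l` is bounded below by `-c` on the
generators, with equality exactly at the vertices on the face, so `isFace_of_tight` applies. -/
theorem exists_eq_convexHull [Fintype V] [Nonempty V] {F : Set (Fin n → ℝ)}
    (hF : IsProperFace S.polytope F) :
    ∃ s, S.IsFace s ∧ F = convexHull ℝ (S.vertex '' s) := by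
  classical
  rcases F.eq_empty_or_nonempty with rfl | hne
  · exact ⟨∅, ⟨Classical.arbitrary ι, by simp⟩, by simp⟩
  obtain ⟨l, hl⟩ := hF.1 hne
  obtain ⟨z₀, hz₀⟩ := hne
  have hz₀' := hz₀
  rw [hl] at hz₀'
  set M := l z₀ with hM
  have hle : ∀ x, l (S.vertex x) ≤ M := fun x => hz₀'.2 _ (S.vertex_mem_polytope x)
  -- The vertices positively span the space, so a nonpositive maximum would force `l = 0` and the
  -- face would be the whole polytope.
  have hpos : 0 < M := by
    by_contra hneg
    push Not at hneg
    have h1 : ∀ z, l z ≤ 0 := by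
      intro z
      obtain ⟨f, a, ha, rfl⟩ := S.exists_eq_sum_vertex z
      rw [map_sum]
      refine Finset.sum_nonpos fun x hx => ?_
      rw [map_smul, smul_eq_mul]
      exact mul_nonpos_of_nonneg_of_nonpos (ha x hx) ((hle x).trans hneg)
    have h2 : ∀ z, l z = 0 := fun z => le_antisymm (h1 z) (by
      have := h1 (-z)
      rw [map_neg] at this
      linarith)
    refine hF.2 ?_
    rw [hl]
    ext z
    simp [h2]
  let s : Finset V := Finset.univ.filter fun x => l (S.vertex x) = M
  have hs : ∀ x, x ∈ s ↔ l (S.vertex x) = M := fun x => by simp [s]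
  have hlv : ∀ x, (S.avg - M⁻¹ • l) (S.rvec x) =
      -S.c x + S.height x * (1 - M⁻¹ * l (S.vertex x)) := by
    intro x
    have h1 : l (S.rvec x) = S.height x * l (S.vertex x) := by
      rw [← S.height_smul_vertex x, map_smul, smul_eq_mul]
    have h2 : S.avg (S.rvec x) = S.height x - S.c x := by rw [height]; ring
    rw [_root_.sub_apply, _root_.smul_apply, smul_eq_mul, h1, h2]
    ring
  refine ⟨s, S.isFace_of_tight s (S.avg - M⁻¹ • l : (Fin n → ℝ) →L[ℝ] ℝ).toLinearMap
    (fun x => ?_) (fun x hx => ?_), ?_⟩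
  · change _ ≤ (S.avg - M⁻¹ • l) (S.rvec x)
    rw [hlv]
    have h3 : M⁻¹ * l (S.vertex x) ≤ 1 := by
      rw [inv_mul_le_iff₀ hpos, mul_one]
      exact hle x
    have := mul_nonneg (S.height_pos x).le (sub_nonneg.2 h3)
    linarith
  · change (S.avg - M⁻¹ • l) (S.rvec x) = _
    rw [hlv, (hs x).1 hx, inv_mul_cancel₀ hpos.ne', sub_self, mul_zero, add_zero]
  · have hmax := fun z hz =>
      mem_convexHull_of_max S.vertex (l : (Fin n → ℝ) →ₗ[ℝ] ℝ) hle (z := z) hz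
    have hset : {x | (l : (Fin n → ℝ) →ₗ[ℝ] ℝ) (S.vertex x) = M} = (s : Set V) :=
      Set.ext fun x => (hs x).symm
    apply subset_antisymm
    · intro z hz
      rw [hl] at hz
      rw [← hset]
      exact (hmax z hz.1).2 (le_antisymm (hmax z hz.1).1 (hz.2 z₀ hz₀'.1))
    · intro z hz
      have h1 : l z = M := by
        refine convexHull_min ?_ (convex_hyperplane l.toLinearMap.isLinear M) hz
        rintro _ ⟨x, hx, rfl⟩
        exact (hs x).1 hx
      rw [hl]
      refine ⟨convexHull_mono (Set.image_subset_range _ _) hz, fun y hy => ?_⟩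
      rw [h1]
      exact (hmax y hy).1

theorem linearIndependent_vertex {f : ι} {s : Finset V} (hs : s ⊆ S.facet f) :
    LinearIndependent ℝ fun x : s => S.vertex x := by
  have h1 : LinearIndependent ℝ fun x : s => S.rvec x :=
    (S.linearIndepOn_rvec f).mono (by exact_mod_cast hs)
  exact h1.units_smul fun x => Units.mk0 _ (inv_pos.2 (S.height_pos x)).ne'

theorem isSimplicialPolytope [Fintype V] [Nonempty V] : IsSimplicialPolytope S.polytope := by
  classical
  refine ⟨⟨Finset.univ.image S.vertex, by simp [polytope]⟩, fun F hF => ?_⟩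
  obtain ⟨s, ⟨f, hs⟩, rfl⟩ := S.exists_eq_convexHull hF
  refine ⟨s.image S.vertex, ?_, by rw [Finset.coe_image]⟩
  have h1 := (S.linearIndependent_vertex hs).affineIndependent
  have h2 := h1.range
  have h3 : (Set.range fun x : s => S.vertex x) = ↑(s.image S.vertex) := by
    ext z
    simp
  rw [h3] at h2
  exact h2

theorem hull_convexHull_vertex (s : Finset V) :
    PointedCone.hull ℝ (convexHull ℝ (S.vertex '' s)) = S.cone s := by
  apply le_antisymm
  · refine Submodule.span_le.2 (convexHull_min ?_ (PointedCone.convex (S.cone s)))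
    rintro _ ⟨x, hx, rfl⟩
    exact smul_mem_cone (S.rvec_mem_cone hx) (inv_pos.2 (S.height_pos x)).le
  · refine Submodule.span_le.2 ?_
    rintro _ ⟨x, hx, rfl⟩
    rw [← S.height_smul_vertex x]
    exact smul_mem_cone (PointedCone.subset_hull (subset_convexHull ℝ _ (Set.mem_image_of_mem _ hx)))
      (S.height_pos x).le

/-- The fan of an ample system is strongly polytopal. -/
theorem Spans.isStronglyPolytopal [Fintype V] [Nonempty V] {S : AmpleSystem n V ι} {Δ : Fan n}
    (hΔ : S.Spans Δ) : Δ.IsStronglyPolytopal := by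
  refine ⟨S.polytope, S.isSimplicialPolytope, S.zero_mem_intrinsicInterior, Set.ext fun σ => ?_⟩
  rw [hΔ σ]
  constructor
  · rintro ⟨s, hs, rfl⟩
    exact ⟨_, S.isProperFace_convexHull hs, (S.hull_convexHull_vertex s).symm⟩
  · rintro ⟨F, hF, rfl⟩
    obtain ⟨s, hs, rfl⟩ := S.exists_eq_convexHull hF
    exact ⟨s, hs, S.hull_convexHull_vertex s⟩

/-- The complex of an ample system is polytopal. -/
theorem isPolytopal [Fintype V] [Nonempty V] (K : AbstractSimplicialComplex V)
    (hK : ∀ s : Finset V, s.Nonempty → (s ∈ K.faces ↔ S.IsFace s)) : IsPolytopal K := by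
  refine ⟨n, S.polytope, S.isSimplicialPolytope, ?_⟩
  have hext : ∀ x, S.vertex x ∈ S.polytope.extremePoints ℝ := by
    intro x
    obtain ⟨f, hf⟩ := S.exists_mem_facet x
    have h := (S.isProperFace_convexHull (s := {x}) ⟨f, by simpa using hf⟩).1.isExtreme
    rw [Finset.coe_singleton, Set.image_singleton, convexHull_singleton] at h
    exact isExtreme_singleton.1 h
  refine ⟨Equiv.ofBijective (fun x => ⟨S.vertex x, hext x⟩) ⟨fun x y h => ?_, ?_⟩, fun s hs => ?_⟩
  · exact S.vertex_injective (congrArg Subtype.val h)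
  · rintro ⟨z, hz⟩
    obtain ⟨x, rfl⟩ := extremePoints_convexHull_subset hz
    exact ⟨x, rfl⟩
  · rw [hK s hs]
    constructor
    · intro h
      exact ⟨_, S.isProperFace_convexHull h, fun x => (S.vertex_mem_convexHull_iff x).symm⟩
    · rintro ⟨F, hF, h⟩
      obtain ⟨t, ht, rfl⟩ := S.exists_eq_convexHull hF
      have : s = t := Finset.ext fun x => (h x).trans (S.vertex_mem_convexHull_iff x)
      exact this ▸ ht

end AmpleSystem

/-! ### The fan of an ample system -/

theorem toReal_injective {n : ℕ} : Function.Injective (toReal (n := n)) := fun u v h => by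
  funext i
  have := congrFun h i
  simpa [toReal] using this

theorem toReal_sum_smul {n : ℕ} {V : Type*} (s : Finset V) (a : V → ℤ) (v : V → Fin n → ℤ) :
    toReal (∑ x ∈ s, a x • v x) = ∑ x ∈ s, (a x : ℝ) • toReal (v x) := by
  funext i
  simp [toReal, Finset.sum_apply]

namespace UnimodularSystem

variable {n : ℕ} {V ι : Type*} [DecidableEq V] (S : UnimodularSystem n V ι)

theorem linearIndependent_vec (f : ι) : LinearIndependent ℤ fun x : S.facet f => S.vec x := by
  rw [Fintype.linearIndependent_iff]
  intro a h x
  have h1 := (linearIndepOn_finset_iff.1 (S.linearIndepOn_rvec f))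
    (fun y => if hy : y ∈ S.facet f then (a ⟨y, hy⟩ : ℝ) else 0) (by
      rw [← Finset.sum_attach]
      have := congrArg toReal h
      have h0 : toReal (0 : Fin n → ℤ) = 0 := by funext i; simp [toReal]
      rw [toReal_sum_smul, h0] at this
      simpa [rvec] using this) x x.2
  simpa using h1

theorem span_vec (f : ι) : ⊤ ≤ Submodule.span ℤ (Set.range fun x : S.facet f => S.vec x) := by
  intro z _
  have : z = ∑ x ∈ S.facet f, (∑ i, S.dual f x i * z i) • S.vec x := by
    apply toReal_injective
    rw [toReal_sum_smul]
    conv_lhs => rw [← S.sum_dual f (toReal z)]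
    exact Finset.sum_congr rfl fun x _ => by rw [pairing_toReal]
  rw [this]
  exact Submodule.sum_mem _ fun x hx =>
    Submodule.smul_mem _ _ (Submodule.subset_span ⟨⟨x, hx⟩, rfl⟩)

/-- The lattice basis given by a facet. -/
def basis (f : ι) : Module.Basis (S.facet f) ℤ (Fin n → ℤ) :=
  Module.Basis.mk (S.linearIndependent_vec f) (S.span_vec f)

theorem exists_basis {f : ι} {s : Finset V} (hs : s ⊆ S.facet f) :
    ∃ (b : Module.Basis (Fin n) ℤ (Fin n → ℤ)) (t : Set (Fin n)),
      S.cone s = PointedCone.hull ℝ ((fun i => toReal (b i)) '' t) := by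
  have hcard : Fintype.card (S.facet f) = n := by
    rw [← Module.finrank_eq_card_basis (S.basis f), Module.finrank_fin_fun]
  let e := Fintype.equivFinOfCardEq hcard
  refine ⟨(S.basis f).reindex e, {i | (e.symm i : V) ∈ s}, ?_⟩
  rw [cone]
  congr 1
  ext z
  constructor
  · rintro ⟨x, hx, rfl⟩
    exact ⟨e ⟨x, hs hx⟩, by simpa using hx, by simp [basis, rvec]⟩
  · rintro ⟨i, hi, rfl⟩
    exact ⟨e.symm i, hi, by simp [basis, rvec]⟩

end UnimodularSystem

namespace AmpleSystem

variable {n : ℕ} {V ι : Type*} [DecidableEq V] (S : AmpleSystem n V ι)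

theorem cone_singleton (x : V) : S.cone {x} = PointedCone.hull ℝ {S.rvec x} := by
  rw [UnimodularSystem.cone, Finset.coe_singleton, Set.image_singleton]

theorem cone_singleton_le_iff {f : ι} {t : Finset V} (ht : t ⊆ S.facet f) (x : V) :
    S.cone {x} ≤ S.cone t ↔ x ∈ t :=
  ⟨fun h => S.subset_of_cone_le ht h (Finset.mem_singleton_self x),
    fun h => S.cone_mono (Finset.singleton_subset_iff.2 h)⟩

/-- The supporting form is the sum of `mu h - mu f` over all facets `h` containing `t`. It is
nonnegative on the cone of `f`, and a generator of `s` at which it vanishes lies in all these `h`,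
hence in `t`. -/
theorem cone_inf_iff [Fintype ι] {f g : ι} {s t : Finset V} (hs : s ⊆ S.facet f)
    (ht : t ⊆ S.facet g) :
    ∃ u : Fin n → ℤ, (∀ x ∈ S.cone s, 0 ≤ pairing u x) ∧
      ∀ x, x ∈ S.cone s ⊓ S.cone t ↔ x ∈ S.cone s ∧ pairing u x = 0 := by
  classical
  let G : Finset ι := Finset.univ.filter fun h => t ⊆ S.facet h
  have hG : ∀ h, h ∈ G ↔ t ⊆ S.facet h := fun h => by simp [G]
  let u : Fin n → ℤ := ∑ h ∈ G, (S.mu h - S.mu f)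
  have hu : ∀ z, pairing u z = ∑ h ∈ G, (pairing (S.mu h) z - pairing (S.mu f) z) := fun z => by
    simp only [u, pairing_sum_left, pairing_sub_left]
  have hnn : ∀ z ∈ S.cone (S.facet f), ∀ h ∈ G,
      0 ≤ pairing (S.mu h) z - pairing (S.mu f) z := fun z hz h _ =>
    sub_nonneg.2 (S.pairing_mu_le hz h)
  have hpos : ∀ z ∈ S.cone s, 0 ≤ pairing u z := fun z hz => by
    rw [hu]
    exact Finset.sum_nonneg (hnn z (S.cone_mono hs hz))
  refine ⟨u, hpos, fun z => ?_⟩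
  rw [Submodule.mem_inf]
  refine and_congr_right fun hzs => ⟨fun hzt => ?_, fun h0 => ?_⟩
  · refine le_antisymm ?_ (hpos z hzs)
    rw [hu]
    exact Finset.sum_nonpos fun h hh =>
      sub_nonpos.2 (S.pairing_mu_le (S.cone_mono ((hG h).1 hh) hzt) f)
  · have h1 := (S.mem_cone_filter_iff hs (u := u) (t := s.filter fun x => pairing u (S.rvec x) = 0)
      (fun x hx => hpos _ (S.rvec_mem_cone hx)) (Finset.filter_subset _ _)
      (fun x hx => by simp [hx]) z).2 ⟨hzs, h0⟩
    refine S.cone_mono (fun x hx => ?_) h1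
    obtain ⟨hxs, hx0⟩ := Finset.mem_filter.1 hx
    by_contra hxt
    obtain ⟨h, hh, hxh⟩ := S.exists_facet_of_notMem ht hxt
    rw [hu, Finset.sum_eq_zero_iff_of_nonneg (hnn _ (S.rvec_mem_cone (hs hxs)))] at hx0
    have h2 := hx0 h ((hG h).2 hh)
    rw [S.pairing_mu (hs hxs)] at h2
    exact hxh (S.mem_facet_of_le (by linarith))

/-- The fan whose cones are spanned by the faces of an ample system. -/
def fan [Finite V] [Fintype ι] : Fan n where
  cones := {σ | ∃ s, S.IsFace s ∧ σ = S.cone s}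
  finite := by
    refine (Set.finite_range S.cone).subset ?_
    rintro _ ⟨s, -, rfl⟩
    exact ⟨s, rfl⟩
  rational := by
    classical
    rintro _ ⟨s, -, rfl⟩
    refine ⟨s.image S.vec, ?_⟩
    rw [Finset.coe_image, Set.image_image]
    rfl
  stronglyConvex := by
    rintro _ ⟨s, ⟨f, hs⟩, rfl⟩ z hz hz'
    rw [← S.sum_dual_rvec f z]
    refine Finset.sum_eq_zero fun x hx => ?_
    have h1 := ((S.mem_cone_iff hs).1 hz x hx).1
    have h2 := ((S.mem_cone_iff hs).1 hz' x hx).1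
    rw [pairing_neg_right] at h2
    rw [le_antisymm (by linarith) h1, zero_smul]
  face_mem := by
    classical
    rintro _ ⟨s, ⟨f, hs⟩, rfl⟩ τ ⟨u, hu, hτ⟩
    refine ⟨s.filter fun x => pairing u (S.rvec x) = 0,
      ⟨f, (Finset.filter_subset _ _).trans hs⟩, ?_⟩
    ext z
    rw [hτ, S.mem_cone_filter_iff hs (fun x hx => hu _ (S.rvec_mem_cone hx))
      (Finset.filter_subset _ _) (fun x hx => by simp [hx])]
  inf_isFace := by
    rintro _ ⟨s, ⟨f, hs⟩, rfl⟩ _ ⟨t, ⟨g, ht⟩, rfl⟩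
    exact S.cone_inf_iff hs ht

variable [Finite V] [Fintype ι]

theorem spans_fan : S.Spans S.fan := fun _ => Iff.rfl

theorem isComplete_fan [Nonempty ι] : S.fan.IsComplete := fun z => by
  obtain ⟨f, hf⟩ := S.exists_mem_cone_facet z
  exact ⟨_, ⟨_, ⟨f, subset_rfl⟩, rfl⟩, hf⟩

theorem isNonsingular_fan : S.fan.IsNonsingular := by
  rintro _ ⟨s, ⟨f, hs⟩, rfl⟩
  exact S.exists_basis hs

theorem cone_singleton_mem_rays (x : V) : S.cone {x} ∈ S.fan.rays := by
  obtain ⟨f, hf⟩ := S.exists_mem_facet x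
  exact ⟨⟨{x}, ⟨f, by simpa using hf⟩, rfl⟩, S.rvec x, S.rvec_ne_zero hf, S.cone_singleton x⟩

theorem exists_cone_singleton_of_mem_rays {ρ : PointedCone ℝ (Fin n → ℝ)} (hρ : ρ ∈ S.fan.rays) :
    ∃ x, S.cone {x} = ρ := by
  obtain ⟨⟨s, ⟨f, hs⟩, rfl⟩, v, hv, h⟩ := hρ
  have hmem : ∀ x ∈ s, ∃ a : ℝ, S.rvec x = a • v := by
    intro x hx
    have := S.rvec_mem_cone hx
    rw [h, Submodule.mem_span_singleton] at this
    obtain ⟨a, ha⟩ := this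
    exact ⟨a, ha.symm⟩
  obtain ⟨x, hx⟩ : s.Nonempty := by
    rw [Finset.nonempty_iff_ne_empty]
    rintro rfl
    have : v ∈ S.cone ∅ := by rw [h]; exact PointedCone.subset_hull rfl
    simp [UnimodularSystem.cone] at this
    exact hv this
  refine ⟨x, ?_⟩
  congr 1
  refine (Finset.eq_singleton_iff_unique_mem.2 ⟨hx, fun y hy => ?_⟩).symm
  by_contra hne
  obtain ⟨a, ha⟩ := hmem x hx
  obtain ⟨b, hb⟩ := hmem y hy
  have h1 := S.pairing_dual_rvec (hs hx) (hs hx)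
  have h2 := S.pairing_dual_rvec (hs hx) (hs hy)
  rw [ha, pairing_smul_right, if_pos rfl] at h1
  rw [hb, pairing_smul_right, if_neg (Ne.symm hne)] at h2
  rcases mul_eq_zero.1 h2 with h3 | h3
  · exact S.rvec_ne_zero (hs hy) (by rw [hb, h3, zero_smul])
  · rw [h3, mul_zero] at h1
    exact zero_ne_one h1

theorem isOver_fan (K : AbstractSimplicialComplex V)
    (hK : ∀ s : Finset V, s.Nonempty → (s ∈ K.faces ↔ S.IsFace s)) : S.fan.IsOver K := by
  refine ⟨Equiv.ofBijective (fun x => ⟨S.cone {x}, S.cone_singleton_mem_rays x⟩)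
    ⟨fun x y h => ?_, fun ρ => ?_⟩, fun s hs => ?_⟩
  · obtain ⟨f, hf⟩ := S.exists_mem_facet y
    have h1 : S.cone {x} ≤ S.cone {y} := (congrArg Subtype.val h).le
    exact Finset.mem_singleton.1 ((S.cone_singleton_le_iff (by simpa using hf) x).1 h1)
  · obtain ⟨x, hx⟩ := S.exists_cone_singleton_of_mem_rays ρ.2
    exact ⟨x, Subtype.ext hx⟩
  · rw [hK s hs]
    constructor
    · rintro ⟨f, hf⟩
      exact ⟨S.cone s, ⟨s, ⟨f, hf⟩, rfl⟩, fun x => (S.cone_singleton_le_iff hf x).symm⟩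
    · rintro ⟨_, ⟨t, ⟨f, ht⟩, rfl⟩, h⟩
      have : s = t := Finset.ext fun x => (h x).trans (S.cone_singleton_le_iff ht x)
      exact this ▸ ⟨f, ht⟩

end AmpleSystem

/-! ### Smooth fans in the plane, through their row spaces -/

section Cyclic

variable {M : ℕ}

theorem cyclic_induction {P : Fin (M + 3) → Prop} (c : Fin (M + 3)) (h0 : P c)
    (hs : ∀ l, P l → P (l + 1)) (l : Fin (M + 3)) : P l := by
  have h : ∀ (t : ℕ) (ht : t < M + 3), P (c + ⟨t, ht⟩) := by
    intro t
    induction t with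
    | zero =>
      intro _
      convert h0 using 1
      exact add_zero c
    | succ t ih =>
      intro ht
      have := hs _ (ih (by omega))
      rw [add_assoc] at this
      convert this using 2
      ext
      simp [Fin.val_add, Nat.mod_eq_of_lt ht]
  have := h (l - c : Fin (M + 3)).1 (l - c).2
  rwa [Fin.eta, add_sub_cancel] at this

theorem cyclic_induction_down {P : Fin (M + 3) → Prop} (c : Fin (M + 3)) (h0 : P c)
    (hs : ∀ l, P (l + 1) → P l) (l : Fin (M + 3)) : P l := by
  have := cyclic_induction (P := fun l => P (-l)) (-c) (by simpa using h0) (fun l hl => by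
    refine hs _ ?_
    rwa [neg_add, neg_add_cancel_right]) (-l)
  simpa using this

theorem fin_add_one_ne (i : Fin (M + 3)) : i + 1 ≠ i := by simp

theorem fin_add_one_add_one_ne (i : Fin (M + 3)) : i + 1 + 1 ≠ i := by
  rw [add_assoc, ne_eq, add_eq_left, Fin.ext_iff]
  simp [Fin.val_add, Nat.mod_eq_of_lt (show 2 < M + 3 by omega)]

end Cyclic

/-- The space of rows of the matrix with columns the primitive ray generators `w_0, …, w_{m-1}`, in
cyclic order, of a smooth complete fan in the plane: consecutive generators form a lattice basis,
and span a cone that contains no other generator. -/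
structure IsFanRows {M : ℕ} (R : Submodule ℝ (Fin (M + 3) → ℝ)) : Prop where
  exists_dual : ∀ a, ∃ p q : Fin (M + 3) → ℤ, (fun i => (p i : ℝ)) ∈ R ∧ (fun i => (q i : ℝ)) ∈ R ∧
    p a = 1 ∧ p (a + 1) = 0 ∧ q a = 0 ∧ q (a + 1) = 1 ∧
    ∀ i, i ≠ a → i ≠ a + 1 → ¬ (0 ≤ p i ∧ 0 ≤ q i)
  eq_zero : ∀ r ∈ R, ∀ a, r a = 0 → r (a + 1) = 0 → r = 0

namespace IsFanRows

variable {M : ℕ} {R : Submodule ℝ (Fin (M + 3) → ℝ)} (hR : IsFanRows R)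

include hR

/-- In terms of generators, `w_i = p i • w_a + q i • w_{a+1}`. -/
theorem exists_coord (a : Fin (M + 3)) : ∃ p q : Fin (M + 3) → ℤ,
    (∀ r ∈ R, ∀ i, r i = r a * p i + r (a + 1) * q i) ∧
    (fun i => (p i : ℝ)) ∈ R ∧ (fun i => (q i : ℝ)) ∈ R ∧
    p a = 1 ∧ p (a + 1) = 0 ∧ q a = 0 ∧ q (a + 1) = 1 ∧
    ∀ i, i ≠ a → i ≠ a + 1 → ¬ (0 ≤ p i ∧ 0 ≤ q i) := by
  obtain ⟨p, q, hp, hq, h1, h2, h3, h4, h5⟩ := hR.exists_dual a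
  refine ⟨p, q, fun r hr i => ?_, hp, hq, h1, h2, h3, h4, h5⟩
  have := hR.eq_zero (r - r a • (fun i => (p i : ℝ)) - r (a + 1) • (fun i => (q i : ℝ)))
    (sub_mem (sub_mem hr (R.smul_mem _ hp)) (R.smul_mem _ hq)) a (by simp [h1, h3])
    (by simp [h2, h4])
  have := congrFun this i
  simp only [Pi.sub_apply, Pi.smul_apply, smul_eq_mul, Pi.zero_apply] at this
  linarith

/-- The change of basis between neighbouring cones has determinant ±1. The sign is +1, since
otherwise both cones would lie on the same side of their common ray and one would contain a
generator of the other. -/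
theorem det_succ {r s : Fin (M + 3) → ℝ} (hr : r ∈ R) (hs : s ∈ R) (a : Fin (M + 3)) :
    r a * s (a + 1) - r (a + 1) * s a =
      r (a + 1) * s (a + 1 + 1) - r (a + 1 + 1) * s (a + 1) := by
  obtain ⟨p, q, hc, hp, hq, h1, h2, h3, h4, h5⟩ := hR.exists_coord a
  obtain ⟨p', q', hc', hp', hq', h1', h2', h3', h4', h5'⟩ := hR.exists_coord (a + 1)
  have e1 : (0 : ℤ) = p' a + q (a + 1 + 1) * q' a := by
    have := hc' _ hq a
    rw [h3, h4] at this
    push_cast at this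
    rw [one_mul] at this
    exact_mod_cast this
  have e2 : (1 : ℤ) = p (a + 1 + 1) * q' a := by
    have := hc' _ hp a
    rw [h1, h2] at this
    push_cast at this
    rw [zero_mul, zero_add] at this
    exact_mod_cast this
  have e3 : q' a = -1 := by
    rcases Int.isUnit_iff.1 (IsUnit.of_mul_eq_one_right _ e2.symm) with h | h
    · exfalso
      rw [h, mul_one] at e1 e2
      have h6 := h5' a (Ne.symm (fin_add_one_ne a)) (Ne.symm (fin_add_one_add_one_ne a))
      have h7 := h5 (a + 1 + 1) (fin_add_one_add_one_ne a) (fin_add_one_ne _)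
      omega
    · exact h
  have e4 := hc' r hr a
  have e5 := hc' s hs a
  rw [e3] at e4 e5
  push_cast at e4 e5
  rw [e4, e5]
  ring

/-- The determinants of consecutive columns agree. -/
theorem det_eq {r s : Fin (M + 3) → ℝ} (hr : r ∈ R) (hs : s ∈ R) (i a : Fin (M + 3)) :
    r a * s (a + 1) - r (a + 1) * s a = r i * s (i + 1) - r (i + 1) * s i :=
  cyclic_induction (P := fun a => r a * s (a + 1) - r (a + 1) * s a =
    r i * s (i + 1) - r (i + 1) * s i) i rfl (fun l hl => by rw [← hR.det_succ hr hs, hl]) a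

theorem ne_zero_succ {b : Fin (M + 3) → ℝ} (hb : b ∈ R) {i : Fin (M + 3)} (hbi : b i = 0)
    (hb0 : b ≠ 0) : b (i + 1) ≠ 0 := fun h => hb0 (hR.eq_zero b hb i hbi h)

/-! ### Coordinates in which the ray `i` is the first basis vector. -/

section Frame

variable {a b : Fin (M + 3) → ℝ} (ha : a ∈ R) (hb : b ∈ R) {i : Fin (M + 3)} (hai : a i = 1)
  (hbi : b i = 0)

include ha hb hai hbi

theorem det_frame (l : Fin (M + 3)) : a l * b (l + 1) - a (l + 1) * b l = b (i + 1) := by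
  rw [hR.det_eq ha hb i l, hai, hbi]
  ring

/-- Not both coordinates of `w_i` in the frame `w_l, w_{l+1}` are nonnegative. -/
theorem not_nonneg_frame (hb0 : b (i + 1) ≠ 0) {l : Fin (M + 3)} (hl : i ≠ l) (hl' : i ≠ l + 1) :
    ¬ (0 ≤ b (l + 1) / b (i + 1) ∧ 0 ≤ -b l / b (i + 1)) := by
  obtain ⟨p, q, hc, -, -, -, -, -, -, h5⟩ := hR.exists_coord l
  have e1 := hc a ha i
  have e2 := hc b hb i
  have e3 := hR.det_frame ha hb hai hbi l
  rw [hai] at e1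
  rw [hbi] at e2
  have hp : (p i : ℝ) = b (l + 1) / b (i + 1) := by
    rw [eq_div_iff hb0, ← e3]
    linear_combination (-b (l + 1)) * e1 + a (l + 1) * e2
  have hq : (q i : ℝ) = -b l / b (i + 1) := by
    rw [eq_div_iff hb0, ← e3]
    linear_combination (b l) * e1 - a l * e2
  rw [← hp, ← hq]
  exact_mod_cast h5 i hl hl'

/-- A generator on the line of `w_i` other than `w_i` is opposite to it. -/
theorem neg_of_eq_zero (hb0 : b ≠ 0) {l : Fin (M + 3)} (hl : l ≠ i) (hbl : b l = 0) :
    a l < 0 := by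
  have h0 := hR.ne_zero_succ hb hbi hb0
  obtain ⟨p, q, hc, -, -, -, -, -, -, h5⟩ := hR.exists_coord i
  have e1 := hc a ha l
  have e2 := hc b hb l
  rw [hbi, zero_mul, zero_add, hbl, eq_comm, mul_eq_zero, or_iff_right h0] at e2
  rw [hai, e2, mul_zero, add_zero, one_mul] at e1
  have h6 := h5 l hl (fun h => h0 (h ▸ hbl))
  have hq : q l = 0 := by exact_mod_cast e2
  rw [e1]
  have : p l < 0 := by omega
  exact_mod_cast this

theorem eq_of_eq_zero (hb0 : b ≠ 0) {j l : Fin (M + 3)} (hj : j ≠ i) (hbj : b j = 0)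
    (hl : l ≠ i) (hbl : b l = 0) : l = j := by
  by_contra hne
  have h1 := hR.neg_of_eq_zero ha hb hai hbi hb0 hj hbj
  have h2 := hR.neg_of_eq_zero ha hb hai hbi hb0 hl hbl
  have h3 := hR.neg_of_eq_zero (a := (a j)⁻¹ • a) (R.smul_mem _ ha) hb
    (by simp [h1.ne]) hbj hb0 hne hbl
  simp only [Pi.smul_apply, smul_eq_mul] at h3
  exact absurd h3 (not_lt.2 (mul_nonneg_of_nonpos_of_nonpos (inv_neg''.2 h1).le h2.le))

/-- If the line of `w_i` carries two generators, then no cone crosses it. -/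
theorem mul_succ_nonneg (hb0 : b ≠ 0) {j : Fin (M + 3)} (hj : j ≠ i) (hbj : b j = 0)
    (l : Fin (M + 3)) : 0 ≤ b l * b (l + 1) := by
  have h0 := hR.ne_zero_succ hb hbi hb0
  by_contra hneg
  push Not at hneg
  have hbl : b l ≠ 0 := fun h => by simp [h] at hneg
  have hbl' : b (l + 1) ≠ 0 := fun h => by simp [h] at hneg
  have h1 := hR.not_nonneg_frame ha hb hai hbi h0 (l := l) (fun h => hbl (h ▸ hbi))
    (fun h => hbl' (h ▸ hbi))
  have haj := hR.neg_of_eq_zero ha hb hai hbi hb0 hj hbj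
  have h0' : b (j + 1) ≠ 0 := fun h => hb0 (hR.eq_zero b hb j hbj h)
  have h2 := hR.not_nonneg_frame (a := (a j)⁻¹ • a) (R.smul_mem _ ha) hb (by simp [haj.ne]) hbj h0'
    (l := l) (fun h => hbl (h ▸ hbj)) (fun h => hbl' (h ▸ hbj))
  have h3 := hR.det_frame ha hb hai hbi j
  rw [hbj, mul_zero, sub_zero] at h3
  -- The cones following the opposite rays `w_i` and `w_j` lie in different half planes. A cone
  -- crossing the line would contain one of these two rays, and the signs decide which.
  have h4 : b (i + 1) * b (j + 1) < 0 := by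
    rw [← h3, mul_assoc]
    exact mul_neg_of_neg_of_pos haj (mul_self_pos.2 h0')
  simp only [div_nonneg_iff] at h1 h2
  rcases mul_neg_iff.1 hneg with ⟨h5, h6⟩ | ⟨h5, h6⟩ <;>
    rcases mul_neg_iff.1 h4 with ⟨h7, h8⟩ | ⟨h7, h8⟩
  · exact h2 ⟨Or.inr ⟨h6.le, h8.le⟩, Or.inr ⟨by linarith, h8.le⟩⟩
  · exact h1 ⟨Or.inr ⟨h6.le, h7.le⟩, Or.inr ⟨by linarith, h7.le⟩⟩
  · exact h1 ⟨Or.inl ⟨h6.le, h7.le⟩, Or.inl ⟨by linarith, h7.le⟩⟩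
  · exact h2 ⟨Or.inl ⟨h6.le, h8.le⟩, Or.inl ⟨by linarith, h8.le⟩⟩

/-- A cone entering the open upper half plane anywhere but at `w_i` would contain `w_i`. So walking
backwards from a generator with `b > 0` stays in that half plane until `i` is reached. -/
theorem pos_of_succ_pos (hD : 0 < b (i + 1)) {l : Fin (M + 3)} (hl : l ≠ i) (h : 0 < b (l + 1)) :
    0 < b l := by
  by_contra hneg
  push Not at hneg
  refine hR.not_nonneg_frame ha hb hai hbi hD.ne' hl.symm (fun h' => ?_)
    ⟨div_nonneg h.le hD.le, div_nonneg (by linarith) hD.le⟩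
  rw [← h', hbi] at h
  exact h.false

theorem succ_neg_of_neg (hD : 0 < b (i + 1)) {l : Fin (M + 3)} (hl : l + 1 ≠ i) (h : b l < 0) :
    b (l + 1) < 0 := by
  by_contra hneg
  push Not at hneg
  refine hR.not_nonneg_frame ha hb hai hbi hD.ne' (fun h' => ?_) hl.symm
    ⟨div_nonneg hneg hD.le, div_nonneg (by linarith) hD.le⟩
  rw [← h', hbi] at h
  exact h.false

end Frame

/-- Two smooth fans with a common row `b`, in which the vertex `i` is sent to the first basis
vector: they differ by shears of the two half planes bounded by the line of `w_i`. -/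
theorem exists_shear_of_pos {R' : Submodule ℝ (Fin (M + 3) → ℝ)} (hR' : IsFanRows R')
    {a a' b : Fin (M + 3) → ℝ} (ha : a ∈ R) (hb : b ∈ R) (ha' : a' ∈ R') (hb' : b ∈ R')
    {i : Fin (M + 3)} (hai : a i = 1) (hai' : a' i = 1) (hbi : b i = 0) (hD : 0 < b (i + 1)) :
    ∃ e d : ℝ, (∀ l, a' l = a l + e * b l + d * |b l|) ∧ ((∀ l, l ≠ i → b l ≠ 0) → d = 0) := by
  have hb0 : b ≠ 0 := fun h => by simp [h] at hD
  -- Both fans have the same consecutive determinants, so the ratio `(a' - a) / b` is carried from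
  -- one ray to the next as long as `b` does not vanish. It is therefore a constant `x` above the
  -- line and a constant `y` below it.
  have hprop : ∀ l, (a' l - a l) * b (l + 1) = (a' (l + 1) - a (l + 1)) * b l := fun l => by
    have h1 := hR.det_frame ha hb hai hbi l
    have h2 := hR'.det_frame ha' hb' hai' hbi l
    linear_combination h2 - h1
  have hprev : b (i - 1) < 0 := by
    have h1 := hR.det_frame ha hb hai hbi (i - 1)
    rw [sub_add_cancel, hbi, hai] at h1
    linarith
  set x := (a' (i + 1) - a (i + 1)) / b (i + 1) with hx
  set y := (a' (i - 1) - a (i - 1)) / b (i - 1) with hy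
  have hpos : ∀ l, 0 < b l → a' l - a l = x * b l := by
    refine cyclic_induction (i + 1) (fun _ => (div_mul_cancel₀ _ hD.ne').symm) fun l ih hl => ?_
    by_cases hli : l = i
    · rw [hli]
      exact (div_mul_cancel₀ _ hD.ne').symm
    · have h1 := hR.pos_of_succ_pos ha hb hai hbi hD hli hl
      have h2 := hprop l
      rw [ih h1] at h2
      exact mul_right_cancel₀ h1.ne' (by linarith)
  have hneg : ∀ l, b l < 0 → a' l - a l = y * b l := by
    refine cyclic_induction_down (i - 1) (fun _ => (div_mul_cancel₀ _ hprev.ne).symm)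
      fun l ih hl => ?_
    by_cases hli : l + 1 = i
    · rw [eq_sub_of_add_eq hli]
      exact (div_mul_cancel₀ _ hprev.ne).symm
    · have h1 := hR.succ_neg_of_neg ha hb hai hbi hD hli hl
      have h2 := hprop l
      rw [ih h1] at h2
      exact mul_right_cancel₀ h1.ne (by linarith)
  have hzero : ∀ l, b l = 0 → a' l - a l = 0 := by
    intro l hl
    have h1 := hprop l
    rw [hl, mul_zero] at h1
    exact (mul_eq_zero.1 h1).resolve_right fun h => hb0 (hR.eq_zero b hb l hl h)
  refine ⟨(x + y) / 2, (x - y) / 2, fun l => ?_, fun hne => ?_⟩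
  · rcases lt_trichotomy (b l) 0 with h | h | h
    · rw [abs_of_neg h]
      linear_combination hneg l h
    · rw [h, abs_zero]
      linear_combination hzero l h
    · rw [abs_of_pos h]
      linear_combination hpos l h
  -- Without an opposite ray some cone crosses the line directly, and the ratio passes through it,
  -- giving `x = y`.
  · obtain ⟨l, h1, h2⟩ : ∃ l, 0 < b l ∧ b (l + 1) < 0 := by
      by_contra! hno
      have hall : ∀ l, 0 < b l := cyclic_induction (i + 1) hD fun l hl => by
        refine lt_of_le_of_ne (hno l hl) (Ne.symm (hne _ fun h => ?_))
        rw [← h, add_sub_cancel_right] at hprev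
        exact hprev.not_gt hl
      exact (hall i).ne' hbi
    have h3 := hprop l
    rw [hpos l h1, hneg _ h2] at h3
    have h4 : (x - y) * (b l * b (l + 1)) = 0 := by linear_combination h3
    rw [(mul_eq_zero.1 h4).resolve_right (mul_neg_of_pos_of_neg h1 h2).ne, zero_div]

theorem exists_shear {R' : Submodule ℝ (Fin (M + 3) → ℝ)} (hR' : IsFanRows R')
    {a a' b : Fin (M + 3) → ℝ} (ha : a ∈ R) (hb : b ∈ R) (ha' : a' ∈ R') (hb' : b ∈ R')
    {i : Fin (M + 3)} (hai : a i = 1) (hai' : a' i = 1) (hbi : b i = 0) (hb0 : b ≠ 0) :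
    ∃ e d : ℝ, (∀ l, a' l = a l + e * b l + d * |b l|) ∧ ((∀ l, l ≠ i → b l ≠ 0) → d = 0) := by
  rcases (hR.ne_zero_succ hb hbi hb0).lt_or_gt with h | h
  · obtain ⟨e, d, h1, h2⟩ := hR.exists_shear_of_pos hR' ha (neg_mem hb) ha' (neg_mem hb') hai hai'
      (b := -b) (by simp [hbi]) (by simpa using h)
    refine ⟨-e, d, fun l => ?_, fun hne => h2 fun l hl => by simpa using hne l hl⟩
    rw [h1 l, Pi.neg_apply, abs_neg]
    ring
  · exact hR.exists_shear_of_pos hR' ha hb ha' hb' hai hai' hbi h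

theorem exists_row (i : Fin (M + 3)) : ∃ a ∈ R, a i = 1 := by
  obtain ⟨p, q, hp, -, h1, -⟩ := hR.exists_dual i
  exact ⟨_, hp, by simp [h1]⟩

theorem exists_row_zero (i : Fin (M + 3)) : ∃ b ∈ R, b i = 0 ∧ b ≠ 0 := by
  obtain ⟨p, q, -, hq, -, -, h1, h2, -⟩ := hR.exists_dual i
  refine ⟨_, hq, by simp [h1], fun h => ?_⟩
  have := congrFun h (i + 1)
  simp [h2] at this

end IsFanRows

/-- The Euclidean norm is strictly convex on a planar cone. -/
theorem norm_strictly_convex {x₁ y₁ x₂ y₂ α β : ℝ} (hdet : x₁ * y₂ - x₂ * y₁ ≠ 0)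
    (h : ¬ (0 ≤ α ∧ 0 ≤ β)) :
    α * √(x₁ ^ 2 + y₁ ^ 2) + β * √(x₂ ^ 2 + y₂ ^ 2) <
      √((α * x₁ + β * x₂) ^ 2 + (α * y₁ + β * y₂) ^ 2) := by
  set u := √(x₁ ^ 2 + y₁ ^ 2) with hu
  set v := √(x₂ ^ 2 + y₂ ^ 2) with hv
  have hu2 : u ^ 2 = x₁ ^ 2 + y₁ ^ 2 := Real.sq_sqrt (by positivity)
  have hv2 : v ^ 2 = x₂ ^ 2 + y₂ ^ 2 := Real.sq_sqrt (by positivity)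
  have hu0 : 0 ≤ u := Real.sqrt_nonneg _
  have hv0 : 0 ≤ v := Real.sqrt_nonneg _
  have hdot : (x₁ * x₂ + y₁ * y₂) ^ 2 < (u * v) ^ 2 := by
    rw [mul_pow, hu2, hv2]
    have := sq_pos_of_ne_zero hdet
    nlinarith
  have huv : 0 < u * v := by
    rcases (mul_nonneg hu0 hv0).eq_or_lt with h0 | h0
    · rw [← h0] at hdot
      nlinarith [sq_nonneg (x₁ * x₂ + y₁ * y₂)]
    · exact h0
  have hup : 0 < u := pos_of_mul_pos_left huv hv0
  have hvp : 0 < v := pos_of_mul_pos_right huv hu0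
  by_cases hs : α * u + β * v < 0
  · exact hs.trans_le (Real.sqrt_nonneg _)
  push Not at hs
  have hαβ : α * β < 0 := by
    by_contra hnn
    push Not at hnn
    rcases mul_nonneg_iff.1 hnn with h1 | h1
    · exact h h1
    · have h2 : α * u ≤ 0 := mul_nonpos_of_nonpos_of_nonneg h1.1 hu0
      have h3 : β * v ≤ 0 := mul_nonpos_of_nonpos_of_nonneg h1.2 hv0
      have h4 : α * u = 0 := by linarith
      have h5 : β * v = 0 := by linarith
      exact h ⟨((mul_eq_zero.1 h4).resolve_right hup.ne').ge,
        ((mul_eq_zero.1 h5).resolve_right hvp.ne').ge⟩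
  have hlt : x₁ * x₂ + y₁ * y₂ < u * v := lt_of_abs_lt (abs_lt_of_sq_lt_sq hdot huv.le)
  refine Real.lt_sqrt_of_sq_lt ?_
  have h1 := mul_lt_mul_of_neg_left hlt hαβ
  have h2 : (α * x₁ + β * x₂) ^ 2 + (α * y₁ + β * y₂) ^ 2 =
      α ^ 2 * u ^ 2 + β ^ 2 * v ^ 2 + 2 * (α * β * (x₁ * x₂ + y₁ * y₂)) := by
    rw [hu2, hv2]
    ring
  have h3 : (α * u + β * v) ^ 2 = α ^ 2 * u ^ 2 + β ^ 2 * v ^ 2 + 2 * (α * β * (u * v)) := by ring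
  linarith

/-! ### Compatible families of planar fans -/

/-- A family of smooth planar fans indexed by the transversals `k` of a family of sets `κ i`, such
that changing `k` at `i` does not change the projection along the `i`-th ray. -/
structure FanFamily {M : ℕ} (κ : Fin (M + 3) → Type*) where
  rows : (∀ i, κ i) → Submodule ℝ (Fin (M + 3) → ℝ)
  isFanRows : ∀ k, IsFanRows (rows k)
  mem_update : ∀ k i y, ∀ r ∈ rows k, r i = 0 → r ∈ rows (Function.update k i y)

namespace FanFamily

variable {M : ℕ} {κ : Fin (M + 3) → Type*} (Φ : FanFamily κ)

/-- A relation restricts, on every transversal, to a linear relation between the ray generators. -/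
def IsRelation (ρ : (Σ i, κ i) → ℝ) : Prop :=
  ∀ k, ∀ r ∈ Φ.rows k, ∑ l, r l * ρ ⟨l, k l⟩ = 0

variable {Φ}

/-- Pair `a'` with `ρ` on the new transversal and substitute the shear: the rows `a` and `b`
contribute zero, and only the `|b|` term and the change of coefficient at `i` remain. A nonzero
change thus forces `d ≠ 0`, hence a ray opposite to `i`. -/
theorem exists_shear {k : ∀ i, κ i} {i : Fin (M + 3)} {y : κ i} {a a' b : Fin (M + 3) → ℝ}
    (ha : a ∈ Φ.rows k) (hb : b ∈ Φ.rows k) (ha' : a' ∈ Φ.rows (Function.update k i y))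
    (hai : a i = 1) (hai' : a' i = 1) (hbi : b i = 0) (hb0 : b ≠ 0) :
    ∃ e d : ℝ, (∀ l, a' l = a l + e * b l + d * |b l|) ∧ ((∀ l, l ≠ i → b l ≠ 0) → d = 0) ∧
      ∀ ρ, Φ.IsRelation ρ → ρ ⟨i, y⟩ - ρ ⟨i, k i⟩ = -d * ∑ l, |b l| * ρ ⟨l, k l⟩ := by
  obtain ⟨e, d, h1, h2⟩ := (Φ.isFanRows k).exists_shear (Φ.isFanRows _) ha hb ha'
    (Φ.mem_update k i y b hb hbi) hai hai' hbi hb0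
  refine ⟨e, d, h1, h2, fun ρ hρ => ?_⟩
  have e1 := hρ k a ha
  have e2 := hρ k b hb
  have e3 := hρ _ a' ha'
  have e4 : ∑ l, a' l * ρ ⟨l, Function.update k i y l⟩ =
      ∑ l, a' l * ρ ⟨l, k l⟩ + (ρ ⟨i, y⟩ - ρ ⟨i, k i⟩) := by
    rw [← Finset.sum_erase_add Finset.univ (fun l => a' l * ρ ⟨l, Function.update k i y l⟩)
        (Finset.mem_univ i),
      ← Finset.sum_erase_add Finset.univ (fun l => a' l * ρ ⟨l, k l⟩) (Finset.mem_univ i)]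
    have : ∑ l ∈ Finset.univ.erase i, a' l * ρ ⟨l, Function.update k i y l⟩ =
        ∑ l ∈ Finset.univ.erase i, a' l * ρ ⟨l, k l⟩ :=
      Finset.sum_congr rfl fun l hl => by
        rw [Function.update_of_ne (Finset.ne_of_mem_erase hl)]
    rw [this, Function.update_self, hai']
    ring
  have e5 : ∑ l, a' l * ρ ⟨l, k l⟩ = d * ∑ l, |b l| * ρ ⟨l, k l⟩ := by
    have : ∀ l, a' l * ρ ⟨l, k l⟩ = a l * ρ ⟨l, k l⟩ + e * (b l * ρ ⟨l, k l⟩) +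
        d * (|b l| * ρ ⟨l, k l⟩) := fun l => by rw [h1 l]; ring
    rw [Finset.sum_congr rfl fun l _ => this l, Finset.sum_add_distrib, Finset.sum_add_distrib,
      ← Finset.mul_sum, ← Finset.mul_sum, e1, e2]
    ring
  rw [e4, e5] at e3
  linarith

variable (Φ)

/-- All relations agree on the copies of the vertex `i`. -/
def IsTrivialAt (i : Fin (M + 3)) : Prop :=
  ∀ ρ, Φ.IsRelation ρ → ∀ y y' : κ i, ρ ⟨i, y⟩ = ρ ⟨i, y'⟩

variable {Φ}

theorem exists_relation_of_not_isTrivialAt {i : Fin (M + 3)} (h : ¬ Φ.IsTrivialAt i)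
    (k : ∀ i, κ i) : ∃ ρ, Φ.IsRelation ρ ∧ ∃ y, ρ ⟨i, y⟩ - ρ ⟨i, k i⟩ ≠ 0 := by
  unfold IsTrivialAt at h
  push Not at h
  obtain ⟨ρ, hρ, y, y', hne⟩ := h
  refine ⟨ρ, hρ, ?_⟩
  by_contra! hall
  exact hne (by linarith [hall y, hall y'])

theorem exists_row_one_zero {k : ∀ i, κ i} {i j : Fin (M + 3)} {b : Fin (M + 3) → ℝ}
    (hb : b ∈ Φ.rows k) (hbi : b i = 0) (hbj : b j = 1) : ∃ a ∈ Φ.rows k, a i = 1 ∧ a j = 0 := by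
  obtain ⟨a, ha, hai⟩ := (Φ.isFanRows k).exists_row i
  exact ⟨a - a j • b, sub_mem ha (Submodule.smul_mem _ _ hb), by simp [hbi, hai], by simp [hbj]⟩

/-- Two vertices that are not on a common line through the origin are not both nontrivial. -/
theorem isTrivialAt_of_ne_zero {k : ∀ i, κ i} {i j : Fin (M + 3)} (hi : ¬ Φ.IsTrivialAt i)
    {b : Fin (M + 3) → ℝ} (hb : b ∈ Φ.rows k) (hbi : b i = 0) (hbj : b j ≠ 0) :
    Φ.IsTrivialAt j := by
  by_contra hj
  wlog hb1 : b j = 1 generalizing b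
  · exact this (b := (b j)⁻¹ • b) (Submodule.smul_mem _ _ hb) (by simp [hbi]) (by simp [hbj])
      (by simp [hbj])
  have hij : i ≠ j := fun h => hbj (h ▸ hbi)
  obtain ⟨ρ, hρ, y, hy⟩ := exists_relation_of_not_isTrivialAt hi k
  obtain ⟨ρ', hρ', y', hy'⟩ := exists_relation_of_not_isTrivialAt hj k
  have ne_of_one : ∀ {r : Fin (M + 3) → ℝ} {l}, r l = 1 → r ≠ 0 := fun h h0 => by simp [h0] at h
  obtain ⟨a, ha, hai, haj⟩ := exists_row_one_zero hb hbi hb1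
  -- The digits record whether the copies at `i` and at `j` have been changed. Every change keeps
  -- one of the two coordinate rows.
  have hb10 := Φ.mem_update k i y b hb hbi
  obtain ⟨a', ha', hai', haj'⟩ := exists_row_one_zero hb10 hbi hb1
  have ha01 := Φ.mem_update k j y' a ha haj
  obtain ⟨b', hb', hbj', hbi'⟩ := exists_row_one_zero ha01 haj hai
  have hb11 : b' ∈ Φ.rows (Function.update (Function.update k i y) j y') := by
    rw [Function.update_comm hij]
    exact Φ.mem_update _ i y b' hb' hbi'
  obtain ⟨e₁, d₁, h₁, -, h₁'⟩ := exists_shear ha hb ha' hai hai' hbi (ne_of_one hb1)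
  obtain ⟨e₂, d₂, h₂, z₂, h₂'⟩ := exists_shear hb ha hb' hb1 hbj' haj (ne_of_one hai)
  obtain ⟨e₃, d₃, h₃, z₃, h₃'⟩ := exists_shear hb10 ha' hb11 hb1 hbj' haj' (ne_of_one hai')
  have hd₁ : d₁ ≠ 0 := by
    rintro rfl
    exact hy (by rw [h₁' ρ hρ]; ring)
  have hd₂ : d₂ ≠ 0 := by
    rintro rfl
    exact hy' (by rw [h₂' ρ' hρ']; ring)
  have hd₃ : d₃ ≠ 0 := by
    rintro rfl
    have := h₃' ρ' hρ'
    rw [Function.update_of_ne hij.symm] at this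
    exact hy' (by rw [this]; ring)
  -- The normalization at the other ray turns the shears into `a' = a + d₁ (|b| - b)` and `b' = b +
  -- d₂ (|a| - a) = b + d₃ (|a'| - a')`, each moving only one half plane.
  have s₁ : e₁ = -d₁ := by
    have := h₁ j
    rw [haj, haj', hb1] at this
    norm_num at this
    linarith
  have s₂ : e₂ = -d₂ := by
    have := h₂ i
    rw [hbi, hbi', hai] at this
    norm_num at this
    linarith
  have s₃ : e₃ = -d₃ := by
    have := h₃ i
    rw [hbi, hbi', hai'] at this
    norm_num at this
    linarith
  -- As `d₂` and `d₃` are nonzero, the fan of `k` and the one changed at `i` both contain a ray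
  -- opposite to `j`, namely `l` and `l'`.
  obtain ⟨l, hlj, hl⟩ : ∃ l, l ≠ j ∧ a l = 0 := by
    by_contra! h
    exact hd₂ (z₂ h)
  obtain ⟨l', hlj', hl'⟩ : ∃ l, l ≠ j ∧ a' l = 0 := by
    by_contra! h
    exact hd₃ (z₃ h)
  have hbl : b l < 0 := (Φ.isFanRows k).neg_of_eq_zero hb ha hb1 haj (ne_of_one hai) hlj hl
  have hbl' : b l' < 0 :=
    (Φ.isFanRows _).neg_of_eq_zero hb10 ha' hb1 haj' (ne_of_one hai') hlj' hl'
  -- At `l` the second shear gives `b' = b`, so the third forces `a' l ≥ 0`; but `a' l = -2 d₁ b l`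
  -- with `b l < 0`.
  have hpos : 0 < d₁ := by
    have t₁ := h₁ l
    have t₂ := h₂ l
    have t₃ := h₃ l
    rw [hl, abs_of_neg hbl, s₁] at t₁
    rw [hl, abs_zero] at t₂
    rw [s₃] at t₃
    have t₄ : d₃ * (|a' l| - a' l) = 0 := by linarith
    have t₅ : 0 ≤ a' l := by
      rw [← sub_eq_zero.1 ((mul_eq_zero.1 t₄).resolve_left hd₃)]
      exact abs_nonneg _
    have t₆ : 0 ≤ d₁ * (-b l) := by linarith
    exact lt_of_le_of_ne (nonneg_of_mul_nonneg_left t₆ (by linarith)) (Ne.symm hd₁)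
  -- At `l'` the third shear gives `b' = b`, while `a l' = 2 d₁ b l'` is negative, so the second
  -- shear changes `b`: a contradiction.
  have t₁ := h₁ l'
  have t₂ := h₂ l'
  have t₃ := h₃ l'
  rw [hl', abs_of_neg hbl', s₁] at t₁
  rw [hl', abs_zero] at t₃
  have t₄ : a l' < 0 := by nlinarith
  rw [abs_of_neg t₄, s₂] at t₂
  have t₅ : d₂ * a l' = 0 := by linarith
  exact (mul_ne_zero hd₂ t₄.ne) t₅

/-- A choice of ray generators of a planar fan, and their norms, define a strictly convex function.
-/
theorem _root_.ToricWedge.IsFanRows.exists_norm {R : Submodule ℝ (Fin (M + 3) → ℝ)}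
    (hR : IsFanRows R) : ∃ w : Fin (M + 3) → ℝ, ∀ (f : Fin (M + 3) → ℝ) (a i : Fin (M + 3)),
      (∀ r ∈ R, ∑ l, r l * f l = 0) → i ≠ a → i ≠ a + 1 → f i = 1 →
      (∀ l, l ≠ a → l ≠ a + 1 → l ≠ i → f l = 0) → 0 < ∑ l, w l * f l := by
  obtain ⟨x, y, -, hx, hy, x0, x1, y0, y1, -⟩ := hR.exists_coord 0
  -- The norms are taken in the coordinates of the basis `w_0, w_1`. The relation reads `w_i = -f a
  -- • w_a - f (a + 1) • w_{a+1}`, with coefficients that are not both nonnegative.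
  refine ⟨fun l => √((x l : ℝ) ^ 2 + (y l : ℝ) ^ 2), fun f a i hf hia hia' hfi hfl => ?_⟩
  have hsum : ∀ r : Fin (M + 3) → ℝ,
      ∑ l, r l * f l = r a * f a + r (a + 1) * f (a + 1) + r i := by
    intro r
    rw [← Finset.sum_subset (Finset.subset_univ ({a, a + 1, i} : Finset (Fin (M + 3))))]
    · rw [Finset.sum_insert, Finset.sum_insert, Finset.sum_singleton, hfi]
      · ring
      · simpa using hia'.symm
      · simp [hia.symm]
    · intro l _ hl
      simp only [Finset.mem_insert, Finset.mem_singleton, not_or] at hl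
      rw [hfl l hl.1 hl.2.1 hl.2.2, mul_zero]
  obtain ⟨p, q, -, hp, hq, h1, h2, h3, h4, h5⟩ := hR.exists_coord a
  have e1 := hf _ hp
  have e2 := hf _ hq
  have e3 := hf _ hx
  have e4 := hf _ hy
  rw [hsum] at e1 e2 e3 e4 ⊢
  rw [h1, h2] at e1
  rw [h3, h4] at e2
  push_cast at e1 e2
  have hpa : (p i : ℝ) = -f a := by linarith
  have hqa : (q i : ℝ) = -f (a + 1) := by linarith
  have hdet := hR.det_eq hx hy 0 a
  rw [x0, x1, y0, y1] at hdet
  have hns : ¬ (0 ≤ -f a ∧ 0 ≤ -f (a + 1)) := by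
    rw [← hpa, ← hqa]
    exact_mod_cast h5 i hia hia'
  have := norm_strictly_convex (x₁ := x a) (y₁ := y a) (x₂ := x (a + 1)) (y₂ := y (a + 1))
    (by rw [hdet]; norm_num) hns
  have ex : (x i : ℝ) = -f a * x a + -f (a + 1) * x (a + 1) := by linarith
  have ey : (y i : ℝ) = -f a * y a + -f (a + 1) * y (a + 1) := by linarith
  rw [← ex, ← ey] at this
  linarith

theorem exists_large {Ω : Type*} [Fintype Ω] (A H : Ω → ℝ) (hH : ∀ ω, 0 ≤ H ω)
    (hA : ∀ ω, H ω = 0 → 0 < A ω) : ∃ N : ℝ, ∀ ω, 0 < A ω + N * H ω := by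
  -- Terms with `H ω = 0` count as zero under the division convention; the added 1 makes the
  -- inequality strict.
  refine ⟨∑ ω, |A ω| / H ω + 1, fun ω => ?_⟩
  rcases (hH ω).eq_or_lt with h | h
  · rw [← h, mul_zero, add_zero]
    exact hA ω h.symm
  · have h1 : |A ω| / H ω ≤ ∑ ω, |A ω| / H ω :=
      Finset.single_le_sum (f := fun ω => |A ω| / H ω)
        (fun ω _ => div_nonneg (abs_nonneg _) (hH ω)) (Finset.mem_univ ω)
    have h2 := mul_le_mul_of_nonneg_right h1 h.le
    rw [div_mul_cancel₀ _ h.ne'] at h2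
    have h3 := neg_abs_le (A ω)
    rw [add_mul, one_mul]
    linarith

/-- A common strictly convex function for all the fans of the family. -/
theorem exists_support {Ω : Type*} [Fintype Ω] (ρ : Ω → (Σ i, κ i) → ℝ)
    (k : Ω → ∀ i, κ i) (a i : Ω → Fin (M + 3)) (hρ : ∀ ω, Φ.IsRelation (ρ ω))
    (hia : ∀ ω, i ω ≠ a ω) (hia' : ∀ ω, i ω ≠ a ω + 1) (h1 : ∀ ω, ρ ω ⟨i ω, k ω (i ω)⟩ = 1)
    (h0 : ∀ ω l, l ≠ a ω → l ≠ a ω + 1 → l ≠ i ω → ρ ω ⟨l, k ω l⟩ = 0) (k₀ : ∀ i, κ i) :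
    ∃ C : Fin (M + 3) → ℝ, ∀ ω, 0 < ∑ l, C l * ρ ω ⟨l, k₀ l⟩ := by
  obtain ⟨w, hw⟩ := (Φ.isFanRows k₀).exists_norm
  have hconst : ∀ ω, (∀ l, ρ ω ⟨l, k₀ l⟩ = ρ ω ⟨l, k ω l⟩) →
      0 < ∑ l, w l * ρ ω ⟨l, k₀ l⟩ := by
    intro ω h
    refine hw (fun l => ρ ω ⟨l, k₀ l⟩) (a ω) (i ω) (hρ ω k₀) (hia ω) (hia' ω) ?_ fun l p q r => ?_
    · simpa only [h] using h1 ω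
    · simpa only [h] using h0 ω l p q r
  by_cases hall : ∀ j, Φ.IsTrivialAt j
  · exact ⟨w, fun ω => hconst ω fun l => hall l _ (hρ ω) _ _⟩
  push Not at hall
  obtain ⟨j, hj⟩ := hall
  obtain ⟨b, hb, hbj, hb0⟩ := (Φ.isFanRows k₀).exists_row_zero j
  obtain ⟨r, hr, hrj⟩ := (Φ.isFanRows k₀).exists_row j
  obtain ⟨j', hjj', hbj'⟩ : ∃ j', j' ≠ j ∧ b j' = 0 := by
    by_contra! hne
    obtain ⟨σ, hσ, y, hy⟩ := exists_relation_of_not_isTrivialAt hj k₀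
    obtain ⟨r', hr', hrj'⟩ := (Φ.isFanRows (Function.update k₀ j y)).exists_row j
    obtain ⟨e, d, -, hd, h⟩ := exists_shear hr hb hr' hrj hrj' hbj hb0
    rw [h σ hσ, hd hne] at hy
    simp at hy
  have htriv : ∀ l, l ≠ j → l ≠ j' → Φ.IsTrivialAt l := fun l hl hl' =>
    isTrivialAt_of_ne_zero hj hb hbj fun hbl =>
      hl' ((Φ.isFanRows k₀).eq_of_eq_zero hr hb hrj hbj hb0 hjj' hbj' hl hbl)
  have heq : ∀ ω l, b l ≠ 0 → ρ ω ⟨l, k₀ l⟩ = ρ ω ⟨l, k ω l⟩ := fun ω l hl =>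
    htriv l (fun h => hl (h ▸ hbj)) (fun h => hl (h ▸ hbj')) _ (hρ ω) _ _
  -- Since `b` has constant sign on the cone `a ω`, the relation satisfied by `b` reduces the sum to
  -- `|b (i ω)|` plus or minus `b (i ω)`.
  have hH : ∀ ω, 0 ≤ ∑ l, |b l| * ρ ω ⟨l, k₀ l⟩ := by
    intro ω
    have hsum : ∀ s : Fin (M + 3) → ℝ, (∀ l, b l = 0 → s l = 0) →
        ∑ l, s l * ρ ω ⟨l, k₀ l⟩ = s (a ω) * ρ ω ⟨a ω, k ω (a ω)⟩ +
          s (a ω + 1) * ρ ω ⟨a ω + 1, k ω (a ω + 1)⟩ + s (i ω) := by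
      intro s hs
      have : ∑ l, s l * ρ ω ⟨l, k₀ l⟩ = ∑ l, s l * ρ ω ⟨l, k ω l⟩ :=
        Finset.sum_congr rfl fun l _ => by
          by_cases hbl : b l = 0
          · rw [hs l hbl, zero_mul, zero_mul]
          · rw [heq ω l hbl]
      rw [this, ← Finset.sum_subset
        (Finset.subset_univ ({a ω, a ω + 1, i ω} : Finset (Fin (M + 3))))]
      · rw [Finset.sum_insert, Finset.sum_insert, Finset.sum_singleton, h1 ω]
        · ring
        · simpa using (hia' ω).symm
        · simp [(hia ω).symm]
      · intro l _ hl
        simp only [Finset.mem_insert, Finset.mem_singleton, not_or] at hl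
        rw [h0 ω l hl.1 hl.2.1 hl.2.2, mul_zero]
    have e1 := hρ ω k₀ b hb
    rw [hsum b fun _ h => h] at e1
    rw [hsum (fun l => |b l|) fun l h => by simp [h]]
    have hsign := (Φ.isFanRows k₀).mul_succ_nonneg hr hb hrj hbj hb0 hjj' hbj' (a ω)
    rcases mul_nonneg_iff.1 hsign with ⟨p, q⟩ | ⟨p, q⟩
    · rw [abs_of_nonneg p, abs_of_nonneg q]
      linarith [le_abs_self (b (i ω))]
    · rw [abs_of_nonpos p, abs_of_nonpos q]
      linarith [neg_abs_le (b (i ω))]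
  -- If the `|b|` term vanishes, the shear formula makes the coefficients on the line `b = 0`
  -- independent of the copy; those off the line are so by triviality. Then the norm estimate
  -- applies.
  obtain ⟨N, hN⟩ := exists_large (fun ω => ∑ l, w l * ρ ω ⟨l, k₀ l⟩)
    (fun ω => ∑ l, |b l| * ρ ω ⟨l, k₀ l⟩) hH (fun ω hω => by
      refine hconst ω fun l => ?_
      by_cases hbl : b l = 0
      · obtain ⟨s, hs, hsl⟩ := (Φ.isFanRows k₀).exists_row l
        obtain ⟨s', hs', hsl'⟩ :=
          (Φ.isFanRows (Function.update k₀ l (k ω l))).exists_row l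
        obtain ⟨e, d, -, -, h⟩ := exists_shear hs hb hs' hsl hsl' hbl hb0
        have := h (ρ ω) (hρ ω)
        rw [hω, mul_zero] at this
        linarith
      · exact heq ω l hbl)
  refine ⟨fun l => w l + N * |b l|, fun ω => ?_⟩
  have := hN ω
  rw [Finset.mul_sum, ← Finset.sum_add_distrib] at this
  convert this using 2
  ring

end FanFamily

/-! ### Iterated wedges of polygons -/

/-- A solvable finite system of strict homogeneous linear inequalities has an integral solution. -/
theorem exists_int_of_exists_real {Ω V : Type*} [Fintype Ω] [Fintype V] (ρ : Ω → V → ℝ)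
    (c : V → ℝ) (hc : ∀ ω, 0 < ∑ y, c y * ρ ω y) :
    ∃ c' : V → ℤ, ∀ ω, 0 < ∑ y, (c' y : ℝ) * ρ ω y := by
  -- After scaling by `N` every sum exceeds `∑ |ρ|`, which bounds the error made by rounding.
  obtain ⟨N, hN⟩ := FanFamily.exists_large (fun ω => -∑ y, |ρ ω y|) (fun ω => ∑ y, c y * ρ ω y)
    (fun ω => (hc ω).le) (fun ω h => absurd h (hc ω).ne')
  refine ⟨fun y => round (N * c y), fun ω => (hN ω).trans_le ?_⟩
  rw [Finset.mul_sum, ← Finset.sum_neg_distrib, ← Finset.sum_add_distrib]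
  refine Finset.sum_le_sum fun y _ => ?_
  have h1 := abs_sub_round (N * c y)
  have h2 : |(N * c y - round (N * c y)) * ρ ω y| ≤ 1 * |ρ ω y| := by
    rw [abs_mul]
    exact mul_le_mul_of_nonneg_right (h1.trans (by norm_num)) (abs_nonneg _)
  have h3 := le_abs_self ((N * c y - round (N * c y)) * ρ ω y)
  linarith

/-! ### Combinatorics of the facets of the iterated wedge. -/

section Facets

variable {M : ℕ} {κ : Fin (M + 3) → Type*} [∀ i, Fintype (κ i)] [∀ i, DecidableEq (κ i)]

/-- The facets of the iterated wedge of the polygon: all the copies of the two ends of an edge, and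
all copies but one of every other vertex. -/
def wedgeFacet (f : Fin (M + 3) × ∀ i, κ i) : Finset (Σ i, κ i) :=
  Finset.univ.filter fun x => x.1 = f.1 ∨ x.1 = f.1 + 1 ∨ x.2 ≠ f.2 x.1

theorem mem_wedgeFacet {f : Fin (M + 3) × ∀ i, κ i} {x : Σ i, κ i} :
    x ∈ wedgeFacet f ↔ x.1 = f.1 ∨ x.1 = f.1 + 1 ∨ x.2 ≠ f.2 x.1 := by
  simp [wedgeFacet]

theorem notMem_wedgeFacet {f : Fin (M + 3) × ∀ i, κ i} {x : Σ i, κ i} :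
    x ∉ wedgeFacet f ↔ x.1 ≠ f.1 ∧ x.1 ≠ f.1 + 1 ∧ x = ⟨x.1, f.2 x.1⟩ := by
  rw [mem_wedgeFacet]
  push Not
  refine and_congr_right fun _ => and_congr_right fun _ => ⟨fun h => ?_, fun h => ?_⟩
  · rw [← h]
  · obtain ⟨i, l⟩ := x
    simpa using h

/-- The removed copy becomes the missing copy of its vertex. If that vertex is an end of the edge,
the edge is replaced by the neighbouring edge through its other end. -/
theorem exists_adj_wedgeFacet (f : Fin (M + 3) × ∀ i, κ i) {x : Σ i, κ i}
    (hx : x ∈ wedgeFacet f) : ∃ g, wedgeFacet f \ {x} ⊆ wedgeFacet g ∧ x ∉ wedgeFacet g := by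
  obtain ⟨a, k⟩ := f
  obtain ⟨i, l⟩ := x
  rw [mem_wedgeFacet] at hx
  have hne : ∀ (j : Fin (M + 3)) (y : κ j), ⟨j, y⟩ ∈ wedgeFacet (a, k) \ {⟨i, l⟩} →
      (j = a ∨ j = a + 1 ∨ y ≠ k j) ∧ (j = i → y ≠ Function.update k i l j) := by
    intro j y h
    simp only [Finset.mem_sdiff, mem_wedgeFacet, Finset.mem_singleton] at h
    refine ⟨h.1, ?_⟩
    rintro rfl rfl
    exact h.2 (by simp)
  have hupd : ∀ j (y : κ j), j ≠ i → y ≠ k j → y ≠ Function.update k i l j := by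
    intro j y h h'
    rwa [Function.update_of_ne h]
  have key : ∀ b, i ≠ b → i ≠ b + 1 → (∀ j, j = a ∨ j = a + 1 → j ≠ i → j = b ∨ j = b + 1) →
      ∃ g, wedgeFacet (a, k) \ {⟨i, l⟩} ⊆ wedgeFacet g ∧ ⟨i, l⟩ ∉ wedgeFacet g := by
    intro b h1 h2 h3
    refine ⟨(b, Function.update k i l), ?_, ?_⟩
    · rintro ⟨j, y⟩ hy
      obtain ⟨h4, h5⟩ := hne j y hy
      rw [mem_wedgeFacet]
      by_cases hj : j = i
      · exact Or.inr (Or.inr (h5 hj))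
      · rcases h4 with h4 | h4 | h4
        · exact (h3 j (Or.inl h4) hj).imp_right Or.inl
        · exact (h3 j (Or.inr h4) hj).imp_right Or.inl
        · exact Or.inr (Or.inr (hupd j y hj h4))
    · rw [mem_wedgeFacet]
      simp [h1, h2]
  by_cases hia : i = a
  · subst hia
    refine key (i + 1) (fin_add_one_ne i).symm (fin_add_one_add_one_ne i).symm ?_
    rintro j (rfl | rfl) hj
    · exact absurd rfl hj
    · exact Or.inl rfl
  by_cases hia' : i = a + 1
  · subst hia'
    refine key (a - 1) ?_ (by simp) ?_
    · intro h
      have := fin_add_one_add_one_ne (a - 1)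
      rw [sub_add_cancel] at this
      exact this h
    · rintro j (rfl | rfl) hj
      · exact Or.inr (by simp)
      · exact absurd rfl hj
  · exact key a hia hia' fun j hj _ => hj

theorem exists_mem_wedgeFacet [∀ i, Nonempty (κ i)] (x : Σ i, κ i) : ∃ f, x ∈ wedgeFacet f :=
  ⟨(x.1, fun _ => Classical.arbitrary _), mem_wedgeFacet.2 (Or.inl rfl)⟩

/-- What matters is the set `T` of vertices all of whose copies lie in `s`. It must lie in an edge,
and each vertex outside `T` has a missing copy to serve as the value of `k`. -/
theorem mem_multiWedge_polygon_iff (J : Fin (M + 3) → ℕ+) (s : Finset (Σ i, Fin (J i)))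
    (hs : s.Nonempty) :
    s ∈ (multiWedge (polygon (M + 3)) J).faces ↔ ∃ f, s ⊆ wedgeFacet f := by
  have hpoly : ∀ t : Finset (Fin (M + 3)), t.Nonempty →
      (t ∈ (polygon (M + 3)).faces ↔ ∃ a, t ⊆ {a, a + 1}) := fun t ht => by
    change t.Nonempty ∧ (∃ i, t ⊆ {i, finRotate (M + 3) i}) ↔ _
    simp only [finRotate_apply, ht, true_and]
  constructor
  · rintro ⟨-, h⟩
    let T : Finset (Fin (M + 3)) := Finset.univ.filter fun i => ∀ l, (⟨i, l⟩ : Σ i, Fin (J i)) ∈ s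
    have hT : ∀ i, i ∈ T ↔ ∀ l, (⟨i, l⟩ : Σ i, Fin (J i)) ∈ s := fun i => by simp [T]
    obtain ⟨a, ha⟩ : ∃ a, T ⊆ {a, a + 1} := by
      rcases T.eq_empty_or_nonempty with h0 | h0
      · exact ⟨0, by simp [h0]⟩
      · exact (hpoly T h0).1 (h T h0 fun w hw => (hT w.1).1 hw w.2)
    have hk : ∀ i, ∃ l : Fin (J i), i ∉ T → (⟨i, l⟩ : Σ i, Fin (J i)) ∉ s := by
      intro i
      by_cases hi : i ∈ T
      · exact ⟨⟨0, (J i).pos⟩, fun h => absurd hi h⟩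
      · have := mt (hT i).2 hi
        push Not at this
        obtain ⟨l, hl⟩ := this
        exact ⟨l, fun _ => hl⟩
    choose k hk using hk
    refine ⟨(a, k), fun x hx => mem_wedgeFacet.2 ?_⟩
    by_cases hi : x.1 ∈ T
    · have := ha hi
      simp only [Finset.mem_insert, Finset.mem_singleton] at this
      exact this.imp_right Or.inl
    · refine Or.inr (Or.inr fun h => hk x.1 hi ?_)
      have h' : x.2 = k x.1 := h
      rwa [← h']
  · rintro ⟨⟨a, k⟩, h⟩
    refine ⟨hs, fun t ht hts => (hpoly t ht).2 ⟨a, fun i hi => ?_⟩⟩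
    have := mem_wedgeFacet.1 (h (hts ⟨i, k i⟩ hi))
    simpa using this

end Facets

/-! ### From a system over the wedge to planar fans, and back to a support function. -/

namespace UnimodularSystem

variable {n M : ℕ} {κ : Fin (M + 3) → Type*} [∀ i, Fintype (κ i)] [∀ i, DecidableEq (κ i)]
  (S : UnimodularSystem n (Σ i, κ i) (Fin (M + 3) × ∀ i, κ i))

/-- The facets are those of the iterated wedge of a polygon, and no other vector of the system lies
in the cone of a facet after projection along the copies off the transversal. -/
structure IsWedge : Prop where
  facet_eq : ∀ f, S.facet f = wedgeFacet f
  not_nonneg : ∀ f, ∀ x ∉ wedgeFacet f, ¬ (0 ≤ pairing (S.dual f ⟨f.1, f.2 f.1⟩) (S.rvec x) ∧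
    0 ≤ pairing (S.dual f ⟨f.1 + 1, f.2 (f.1 + 1)⟩) (S.rvec x))

/-- The linear forms that vanish off the transversal `k`, restricted to the transversal. -/
def transversalRows (k : ∀ i, κ i) : Submodule ℝ (Fin (M + 3) → ℝ) where
  carrier := {r | ∃ l : (Fin n → ℝ) →ₗ[ℝ] ℝ, ∀ x : Σ i, κ i,
    l (S.rvec x) = if x.2 = k x.1 then r x.1 else 0}
  zero_mem' := ⟨0, fun x => by simp⟩
  add_mem' := by
    rintro r r' ⟨l, hl⟩ ⟨l', hl'⟩
    refine ⟨l + l', fun x => ?_⟩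
    rw [LinearMap.add_apply, hl, hl']
    split_ifs <;> simp
  smul_mem' := by
    rintro c r ⟨l, hl⟩
    refine ⟨c • l, fun x => ?_⟩
    rw [LinearMap.smul_apply, hl]
    split_ifs <;> simp

variable {S}

/-- The fans of the transversals, for a unimodular system over the iterated wedge of a polygon. -/
def IsWedge.fanFamily (hS : S.IsWedge) : FanFamily κ where
  rows := S.transversalRows
  isFanRows k := by
    refine ⟨fun a => ?_, fun r hr a ha ha' => ?_⟩
    · have hmem : ∀ x : Σ i, κ i, x ∈ S.facet (a, k) ↔ x.1 = a ∨ x.1 = a + 1 ∨ x.2 ≠ k x.1 :=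
        fun x => by rw [hS.facet_eq, mem_wedgeFacet]
      have h1 : (⟨a, k a⟩ : Σ i, κ i) ∈ S.facet (a, k) := by simp [hmem]
      have h2 : (⟨a + 1, k (a + 1)⟩ : Σ i, κ i) ∈ S.facet (a, k) := by simp [hmem]
      have hne : (⟨a, k a⟩ : Σ i, κ i) ≠ ⟨a + 1, k (a + 1)⟩ := fun h =>
        fin_add_one_ne a (congrArg Sigma.fst h).symm
      let P : (Σ i, κ i) → Fin (M + 3) → ℤ := fun y j =>
        ∑ t, S.dual (a, k) y t * S.vec ⟨j, k j⟩ t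
      have hP : ∀ y j, (P y j : ℝ) = pairing (S.dual (a, k) y) (S.rvec ⟨j, k j⟩) :=
        fun y j => (pairing_toReal _ _).symm
      have hrow : ∀ i (y : Σ i, κ i), y = ⟨i, k i⟩ → y ∈ S.facet (a, k) →
          (fun j => (P y j : ℝ)) ∈ S.transversalRows k := by
        intro i y hyi hy
        refine ⟨(pairingCLM (S.dual (a, k) y)).toLinearMap, fun x => ?_⟩
        change pairing _ _ = _
        split_ifs with hx
        · refine Eq.trans ?_ (hP y x.1).symm
          rw [← hx]
        · rw [S.pairing_dual_rvec hy ((hmem x).2 (Or.inr (Or.inr hx))), if_neg]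
          rintro rfl
          rw [hyi] at hx
          exact hx rfl
      refine ⟨P ⟨a, k a⟩, P ⟨a + 1, k (a + 1)⟩, hrow a _ rfl h1, hrow (a + 1) _ rfl h2,
        ?_, ?_, ?_, ?_, ?_⟩
      · have := hP ⟨a, k a⟩ a
        rw [S.pairing_dual_rvec h1 h1, if_pos rfl] at this
        exact_mod_cast this
      · have := hP ⟨a, k a⟩ (a + 1)
        rw [S.pairing_dual_rvec h1 h2, if_neg hne] at this
        exact_mod_cast this
      · have := hP ⟨a + 1, k (a + 1)⟩ a
        rw [S.pairing_dual_rvec h2 h1, if_neg hne.symm] at this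
        exact_mod_cast this
      · have := hP ⟨a + 1, k (a + 1)⟩ (a + 1)
        rw [S.pairing_dual_rvec h2 h2, if_pos rfl] at this
        exact_mod_cast this
      · intro i hi hi' h
        refine hS.not_nonneg (a, k) ⟨i, k i⟩ (notMem_wedgeFacet.2 ⟨hi, hi', rfl⟩) ⟨?_, ?_⟩
        · rw [← hP]
          exact_mod_cast h.1
        · rw [← hP]
          exact_mod_cast h.2
    · obtain ⟨l, hl⟩ := hr
      have h0 : l = 0 := by
        refine LinearMap.ext fun z => ?_
        rw [← S.sum_dual_rvec (a, k) z, map_sum, LinearMap.zero_apply]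
        refine Finset.sum_eq_zero fun x hx => ?_
        rw [hS.facet_eq, mem_wedgeFacet] at hx
        rw [map_smul, hl]
        split_ifs with h
        · rcases hx with hx | hx | hx
          · rw [hx, ha, smul_zero]
          · rw [hx, ha', smul_zero]
          · exact absurd h hx
        · rw [smul_zero]
      funext j
      have := hl ⟨j, k j⟩
      rw [h0] at this
      simpa using this.symm
  mem_update := by
    rintro k i y r ⟨l, hl⟩ hri
    -- The same linear form serves: as `r i = 0`, it vanishes on all copies of `i`, whichever one
    -- belongs to the transversal.
    refine ⟨l, fun x => ?_⟩
    rw [hl]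
    obtain ⟨j, z⟩ := x
    by_cases hj : j = i
    · subst hj
      simp [hri]
    · simp [hj]

theorem IsWedge.isRelation (hS : S.IsWedge) {ρ : (Σ i, κ i) → ℝ} (hρ : ∑ y, ρ y • S.rvec y = 0) :
    hS.fanFamily.IsRelation ρ := by
  rintro k r ⟨l, hl⟩
  have := congrArg l hρ
  rw [map_sum, map_zero, Fintype.sum_sigma] at this
  rw [← this]
  refine Finset.sum_congr rfl fun i _ => ?_
  rw [Finset.sum_eq_single (k i)]
  · rw [map_smul, hl]
    simp [mul_comm]
  · intro y _ hy
    rw [map_smul, hl, if_neg hy, smul_zero]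
  · simp

/-- A unimodular system over the iterated wedge of a polygon has a strictly convex integral support
function. -/
theorem IsWedge.exists_c [∀ i, Nonempty (κ i)] (hS : S.IsWedge) : ∃ c : (Σ i, κ i) → ℤ,
    ∀ f, ∀ x ∉ S.facet f, ∑ y ∈ S.facet f, c y * pairing (S.dual f y) (S.rvec x) < c x := by
  let Ω := {ω : (Fin (M + 3) × ∀ i, κ i) × Σ i, κ i // ω.2 ∉ S.facet ω.1}
  -- This relation expands an outside vector in the basis of a facet. On the facet's own transversal
  -- it is supported on the edge and that vector.
  let ρ : Ω → (Σ i, κ i) → ℝ := fun ω y => (if y = ω.1.2 then 1 else 0) -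
    if y ∈ S.facet ω.1.1 then pairing (S.dual ω.1.1 y) (S.rvec ω.1.2) else 0
  have hmem : ∀ ω : Ω, ω.1.2.1 ≠ ω.1.1.1 ∧ ω.1.2.1 ≠ ω.1.1.1 + 1 ∧
      ω.1.2 = ⟨ω.1.2.1, ω.1.1.2 ω.1.2.1⟩ := fun ω => by
    rw [← notMem_wedgeFacet, ← hS.facet_eq]
    exact ω.2
  have hρ : ∀ ω, hS.fanFamily.IsRelation (ρ ω) := by
    intro ω
    refine hS.isRelation ?_
    simp only [ρ, sub_smul, Finset.sum_sub_distrib, ite_smul, one_smul, zero_smul,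
      Finset.sum_ite_eq', Finset.mem_univ, if_true, Finset.sum_ite_mem, Finset.univ_inter]
    rw [S.sum_dual_rvec, sub_self]
  let k₀ : ∀ i, κ i := fun i => Classical.arbitrary _
  obtain ⟨C, hC⟩ := FanFamily.exists_support ρ (fun ω => ω.1.1.2) (fun ω => ω.1.1.1)
    (fun ω => ω.1.2.1) hρ (fun ω => (hmem ω).1) (fun ω => (hmem ω).2.1) (fun ω => by
      rw [← (hmem ω).2.2]
      simp [ρ, ω.2]) (fun ω l h1 h2 h3 => by
      have h4 : (⟨l, ω.1.1.2 l⟩ : Σ i, κ i) ∉ S.facet ω.1.1 := by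
        rw [hS.facet_eq]
        exact notMem_wedgeFacet.2 ⟨h1, h2, rfl⟩
      have h5 : (⟨l, ω.1.1.2 l⟩ : Σ i, κ i) ≠ ω.1.2 := fun h => h3 (congrArg Sigma.fst h)
      simp [ρ, h4, h5]) k₀
  -- The real support function vanishes off one transversal; rounding then gives integers.
  obtain ⟨c, hc⟩ := exists_int_of_exists_real ρ (fun y => if y.2 = k₀ y.1 then C y.1 else 0)
    (fun ω => by
      have := hC ω
      rw [Fintype.sum_sigma]
      simpa only [ite_mul, zero_mul, Finset.sum_ite_eq', Finset.mem_univ, if_true] using this)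
  refine ⟨c, fun f x hx => ?_⟩
  have := hc ⟨(f, x), hx⟩
  simp only [ρ, mul_sub, Finset.sum_sub_distrib, mul_ite, mul_one, mul_zero,
    Finset.sum_ite_eq', Finset.mem_univ, if_true, Finset.sum_ite_mem, Finset.univ_inter] at this
  linarith

/-- The ample system of a unimodular system over the iterated wedge of a polygon. -/
def IsWedge.ampleSystem [∀ i, Nonempty (κ i)] (hS : S.IsWedge) :
    AmpleSystem n (Σ i, κ i) (Fin (M + 3) × ∀ i, κ i) :=
  have key : ∀ f x, pairing (-∑ y ∈ S.facet f, hS.exists_c.choose y • S.dual f y) (S.rvec x) +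
      hS.exists_c.choose x = hS.exists_c.choose x -
        ∑ y ∈ S.facet f, hS.exists_c.choose y * pairing (S.dual f y) (S.rvec x) := fun f x => by
    rw [pairing_neg_left, pairing_sum_left]
    simp only [pairing_smul_left]
    ring
  have zero : ∀ f, ∀ x ∈ S.facet f, (hS.exists_c.choose x : ℝ) -
      ∑ y ∈ S.facet f, hS.exists_c.choose y * pairing (S.dual f y) (S.rvec x) = 0 :=
    fun f x hx => by
      rw [Finset.sum_eq_single x, S.pairing_dual_rvec hx hx, if_pos rfl, mul_one, sub_self]
      · intro y hy hne
        rw [S.pairing_dual_rvec hy hx, if_neg hne, mul_zero]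
      · exact fun h => absurd hx h
  have pos : ∀ f, ∀ x ∉ S.facet f, 0 < (hS.exists_c.choose x : ℝ) -
      ∑ y ∈ S.facet f, hS.exists_c.choose y * pairing (S.dual f y) (S.rvec x) :=
    fun f x hx => sub_pos.2 (hS.exists_c.choose_spec f x hx)
  { S with
    mu := fun f => -∑ y ∈ S.facet f, hS.exists_c.choose y • S.dual f y
    c := hS.exists_c.choose
    mu_nonneg := fun f x => by
      refine le_of_le_of_eq ?_ (key f x).symm
      by_cases hx : x ∈ S.facet f
      · exact (zero f x hx).ge
      · exact (pos f x hx).le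
    mu_eq_zero_iff := fun f x => by
      refine Iff.trans (iff_of_eq (congrArg (· = 0) (key f x))) ⟨fun h => ?_, zero f x⟩
      by_contra hx
      exact (pos f x hx).ne' h
    exists_adj := fun f x hx => by
      simp only [hS.facet_eq] at hx ⊢
      exact exists_adj_wedgeFacet f hx
    exists_mem_facet := fun x => by
      simp only [hS.facet_eq]
      exact exists_mem_wedgeFacet x }

theorem IsWedge.ampleSystem_toUnimodularSystem [∀ i, Nonempty (κ i)] (hS : S.IsWedge) :
    hS.ampleSystem.toUnimodularSystem = S := rfl

theorem IsWedge.isFace_iff [∀ i, Nonempty (κ i)] (hS : S.IsWedge) (s : Finset (Σ i, κ i)) :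
    hS.ampleSystem.IsFace s ↔ ∃ f, s ⊆ wedgeFacet f :=
  exists_congr fun f => by rw [ampleSystem_toUnimodularSystem, hS.facet_eq]

end UnimodularSystem

/-! ### The unimodular system of a toric manifold -/

/-- The unimodular system of a single lattice basis. -/
def UnimodularSystem.ofBasis {n : ℕ} (b : Module.Basis (Fin n) ℤ (Fin n → ℤ)) :
    UnimodularSystem n (Fin n) Unit :=
  have key : ∀ i z, pairing (fun t => b.repr (Pi.single t 1) i) (toReal z) = b.repr z i := by
    intro i z
    rw [pairing_toReal]
    conv_rhs => rw [← Finset.univ_sum_single z, map_sum]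
    rw [Finset.sum_apply']
    push_cast
    refine Finset.sum_congr rfl fun t _ => ?_
    have : (Pi.single t (z t) : Fin n → ℤ) = z t • Pi.single t 1 := by
      rw [← Pi.single_smul, smul_eq_mul, mul_one]
    rw [this, map_smul, Finsupp.smul_apply, smul_eq_mul]
    push_cast
    ring
  { vec := b
    facet := fun _ => Finset.univ
    dual := fun _ i t => b.repr (Pi.single t 1) i
    pairing_dual := fun _ i _ j _ => by
      rw [key, b.repr_self, Finsupp.single_apply]
      by_cases h : i = j
      · simp [h]
      · simp [h, Ne.symm h]
    sum_dual := fun _ z => by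
      have h1 : ∀ t, ∑ i, pairing (fun t => b.repr (Pi.single t 1) i) (Pi.single t 1) •
          toReal (b i) = Pi.single t 1 := fun t => by
        have h2 : (Pi.single t 1 : Fin n → ℝ) = toReal (Pi.single t 1) := by
          funext j
          by_cases h : j = t <;> simp [toReal, h]
        rw [h2]
        conv_rhs => rw [← b.sum_repr (Pi.single t 1), toReal_sum_smul]
        simp only [key]
      have h3 : z = ∑ t, z t • Pi.single t (1 : ℝ) := by
        funext j
        simp [Finset.sum_apply, Pi.single_apply]
      conv_rhs => rw [h3, Finset.sum_congr rfl fun t _ => congrArg (z t • ·) (h1 t).symm]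
      simp only [Finset.smul_sum]
      rw [Finset.sum_comm]
      refine Finset.sum_congr rfl fun i _ => ?_
      conv_lhs => rw [h3]
      rw [pairing_sum_right, Finset.sum_smul]
      refine Finset.sum_congr rfl fun t _ => ?_
      rw [pairing_smul_right, smul_smul] }

theorem hull_singleton_eq {n : ℕ} {v w : Fin n → ℝ} (hw : w ∈ PointedCone.hull ℝ {v})
    (hw0 : w ≠ 0) : PointedCone.hull ℝ {w} = PointedCone.hull ℝ {v} := by
  refine le_antisymm (Submodule.span_le.2 (by simpa using hw)) (Submodule.span_le.2 ?_)
  obtain ⟨t, rfl⟩ := Submodule.mem_span_singleton.1 hw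
  have ht : (t : ℝ) ≠ 0 := fun h => hw0 (by
    change (t : ℝ) • v = 0
    rw [h, zero_smul])
  have := smul_mem_cone (PointedCone.subset_hull (R := ℝ) (Set.mem_singleton (t • v)))
    (inv_nonneg.2 t.2)
  have h2 : (t : ℝ)⁻¹ • (t • v) = v := by
    change (t : ℝ)⁻¹ • ((t : ℝ) • v) = v
    rw [smul_smul, inv_mul_cancel₀ ht, one_smul]
  rw [h2] at this
  simpa using this

section

variable {n : ℕ}

open UnimodularSystem

theorem ofBasis_rvec_ne_zero (b : Module.Basis (Fin n) ℤ (Fin n → ℤ)) (i : Fin n) :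
    toReal (b i) ≠ 0 :=
  (ofBasis b).rvec_ne_zero (f := ()) (Finset.mem_univ i)

/-- Primitive vectors on the same ray are equal. -/
theorem eq_of_hull_eq {b b' : Module.Basis (Fin n) ℤ (Fin n → ℤ)} {i j : Fin n}
    (h : PointedCone.hull ℝ {toReal (b i)} = PointedCone.hull ℝ {toReal (b' j)}) :
    b i = b' j := by
  have aux : ∀ {b b' : Module.Basis (Fin n) ℤ (Fin n → ℤ)} {i j : Fin n},
      PointedCone.hull ℝ {toReal (b i)} = PointedCone.hull ℝ {toReal (b' j)} →
      ∃ a : ℤ, 0 < a ∧ b i = a • b' j := by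
    intro b b' i j h
    have h1 : toReal (b i) ∈ PointedCone.hull ℝ {toReal (b' j)} := by
      rw [← h]
      exact PointedCone.subset_hull rfl
    obtain ⟨t, ht⟩ := Submodule.mem_span_singleton.1 h1
    change (t : ℝ) • toReal (b' j) = _ at ht
    have h2 := congrArg (pairing ((ofBasis b').dual () j)) ht
    rw [pairing_smul_right, show pairing ((ofBasis b').dual () j) (toReal (b' j)) = 1 from
      ((ofBasis b').pairing_dual () j (Finset.mem_univ _) j (Finset.mem_univ _)).trans (if_pos rfl),
      mul_one, pairing_toReal] at h2
    have h3 : (t : ℝ) ≠ 0 := fun h => ofBasis_rvec_ne_zero b i (by rw [← ht, h, zero_smul])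
    have h4 : 0 < (t : ℝ) := lt_of_le_of_ne t.2 (Ne.symm h3)
    rw [h2] at h4
    refine ⟨_, by exact_mod_cast h4, toReal_injective ?_⟩
    rw [← ht, h2]
    funext l
    simp [toReal]
  obtain ⟨a, ha, h1⟩ := aux h
  obtain ⟨a', ha', h2⟩ := aux h.symm
  have h3 : a * a' = 1 := by
    have h4 : (a * a') • b i = (1 : ℤ) • b i := by
      rw [mul_smul, ← h2, ← h1, one_smul]
    exact smul_left_injective ℤ (b.ne_zero i) h4
  rw [h1, Int.eq_one_of_mul_eq_one_right ha.le h3, one_smul]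

/-- The vectors `vec x` are the primitive generators of the rays of the fan. -/
structure Fan.IsLabelling (Δ : Fan n) {V : Type*} (vec : V → Fin n → ℤ) : Prop where
  exists_basis : ∀ x, ∃ (b : Module.Basis (Fin n) ℤ (Fin n → ℤ)) (i : Fin n), vec x = b i
  cone_mem : ∀ x, PointedCone.hull ℝ {toReal (vec x)} ∈ Δ.cones
  exists_of_mem_rays : ∀ ρ ∈ Δ.rays, ∃ x, ρ = PointedCone.hull ℝ {toReal (vec x)}
  injective : Function.Injective vec

variable {Δ : Fan n} {V : Type*}

theorem Fan.IsNonsingular.exists_finset (hΔ : Δ.IsNonsingular) {σ} (hσ : σ ∈ Δ.cones) :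
    ∃ (b : Module.Basis (Fin n) ℤ (Fin n → ℤ)) (s : Finset (Fin n)), σ = (ofBasis b).cone s := by
  classical
  obtain ⟨b, s, rfl⟩ := hΔ σ hσ
  refine ⟨b, s.toFinset, ?_⟩
  unfold UnimodularSystem.cone
  rw [Set.coe_toFinset]
  rfl

/-- The cones spanned by part of the generators of a cone of the fan. -/
theorem Fan.cone_mem_of_subset {b : Module.Basis (Fin n) ℤ (Fin n → ℤ)} {s t : Finset (Fin n)}
    (hs : (ofBasis b).cone s ∈ Δ.cones) (hts : t ⊆ s) : (ofBasis b).cone t ∈ Δ.cones := by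
  -- The sum of the dual vectors of `s \ t` is a supporting form that vanishes, among the generators
  -- in `s`, exactly on `t`.
  have hu : ∀ i, pairing (∑ j ∈ s \ t, (ofBasis b).dual () j) ((ofBasis b).rvec i) =
      if i ∈ s \ t then 1 else 0 := by
    intro i
    rw [pairing_sum_left]
    simp [(ofBasis b).pairing_dual_rvec (f := ()) (Finset.mem_univ _) (Finset.mem_univ _)]
  have hu0 : ∀ i ∈ s, 0 ≤ pairing (∑ j ∈ s \ t, (ofBasis b).dual () j) ((ofBasis b).rvec i) := by
    intro i _
    rw [hu]
    split_ifs <;> norm_num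
  refine Δ.face_mem _ hs _ ⟨∑ j ∈ s \ t, (ofBasis b).dual () j,
    fun z hz => (ofBasis b).pairing_nonneg_of_mem_cone hu0 hz,
    (ofBasis b).mem_cone_filter_iff (f := ()) (Finset.subset_univ s) hu0 hts fun i hi => ?_⟩
  rw [hu]
  simp [hi]

theorem Fan.IsNonsingular.exists_generator (hΔ : Δ.IsNonsingular) {ρ} (hρ : ρ ∈ Δ.rays) :
    ∃ (b : Module.Basis (Fin n) ℤ (Fin n → ℤ)) (i : Fin n),
      ρ = PointedCone.hull ℝ {toReal (b i)} := by
  obtain ⟨hρ, v, hv, rfl⟩ := hρ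
  obtain ⟨b, s, hs⟩ := hΔ.exists_finset hρ
  rcases s.eq_empty_or_nonempty with rfl | ⟨i, hi⟩
  · refine absurd ?_ hv
    have : v ∈ PointedCone.hull ℝ {v} := PointedCone.subset_hull rfl
    rw [hs] at this
    simpa [UnimodularSystem.cone] using this
  · refine ⟨b, i, (hull_singleton_eq ?_ (ofBasis_rvec_ne_zero b i)).symm⟩
    rw [hs]
    exact (ofBasis b).rvec_mem_cone hi

theorem Fan.IsNonsingular.exists_labelling (hΔ : Δ.IsNonsingular) (e : V ≃ Δ.rays) :
    ∃ vec : V → Fin n → ℤ, Δ.IsLabelling vec ∧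
      ∀ x, (e x).1 = PointedCone.hull ℝ {toReal (vec x)} := by
  choose b i h using fun x => hΔ.exists_generator (e x).2
  refine ⟨fun x => b x (i x), ⟨fun x => ⟨b x, i x, rfl⟩, fun x => ?_, fun ρ hρ => ?_, ?_⟩, h⟩
  · rw [← h]
    exact (e x).2.1
  · refine ⟨e.symm ⟨ρ, hρ⟩, ?_⟩
    rw [← h]
    simp
  · intro x y hxy
    refine e.injective (Subtype.ext ?_)
    rw [h, h]
    exact congrArg (fun v => PointedCone.hull ℝ {toReal v}) hxy

theorem isClosed_ofBasis_cone (b : Module.Basis (Fin n) ℤ (Fin n → ℤ)) (s : Finset (Fin n)) :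
    IsClosed ((ofBasis b).cone s : Set (Fin n → ℝ)) := by
  have : ((ofBasis b).cone s : Set (Fin n → ℝ)) =
      ⋂ i, {z | 0 ≤ pairing ((ofBasis b).dual () i) z} ∩
        {z | i ∉ s → pairing ((ofBasis b).dual () i) z = 0} := by
    ext z
    rw [SetLike.mem_coe, (ofBasis b).mem_cone_iff (f := ()) (Finset.subset_univ s),
      Set.mem_iInter]
    exact forall_congr' fun i => ⟨fun h => h (Finset.mem_univ i), fun h _ => h⟩
  rw [this]
  refine isClosed_iInter fun i => (isClosed_le continuous_const (continuous_pairing _)).inter ?_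
  by_cases hi : i ∈ s
  · simp [hi]
  · simpa [hi] using isClosed_eq (continuous_pairing _) continuous_const

/-- In a complete fan, a maximal cone is full-dimensional. -/
theorem Fan.IsComplete.eq_univ_of_maximal (hc : Δ.IsComplete) (hns : Δ.IsNonsingular)
    {b : Module.Basis (Fin n) ℤ (Fin n → ℤ)} {s : Finset (Fin n)}
    (hs : (ofBasis b).cone s ∈ Δ.cones)
    (hmax : ∀ τ ∈ Δ.cones, (ofBasis b).cone s ≤ τ → τ ≤ (ofBasis b).cone s) :
    s = Finset.univ := by
  by_contra hne
  obtain ⟨i₀, hi₀⟩ : ∃ i, i ∉ s := by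
    by_contra! h
    exact hne (Finset.eq_univ_iff_forall.2 h)
  set S := ofBasis b with hS
  -- A relatively interior point, perturbed out of the span of the cone. One cone contains
  -- infinitely many of the perturbations, hence also their limit `z`, hence the whole cone of `s`;
  -- this contradicts maximality.
  let z := ∑ i ∈ s, S.rvec i
  have hz : z ∈ S.cone s := Submodule.sum_mem _ fun i hi => S.rvec_mem_cone hi
  have : Finite Δ.cones := Δ.finite
  choose τ hτ hmem using fun N : ℕ => hc (z + (1 / ((N : ℝ) + 1)) • S.rvec i₀)
  obtain ⟨⟨σ, hσ⟩, hinf⟩ := Finite.exists_infinite_fiber fun N => (⟨τ N, hτ N⟩ : Δ.cones)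
  have hinf' : {N : ℕ | z + (1 / ((N : ℝ) + 1)) • S.rvec i₀ ∈ σ}.Infinite := by
    refine (Set.infinite_coe_iff.1 hinf).mono fun N hN => ?_
    have : τ N = σ := congrArg Subtype.val hN
    exact this ▸ hmem N
  have hzσ : z ∈ σ := by
    have hcl : IsClosed (σ : Set (Fin n → ℝ)) := by
      obtain ⟨b', s', rfl⟩ := hns.exists_finset hσ
      exact isClosed_ofBasis_cone b' s'
    refine hcl.mem_of_frequently_of_tendsto (Nat.frequently_atTop_iff_infinite.2 hinf') ?_
    have := (tendsto_one_div_add_atTop_nhds_zero_nat (𝕜 := ℝ)).smul_const (S.rvec i₀)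
    simpa using this.const_add z
  obtain ⟨u, hu, hu'⟩ := Δ.inf_isFace _ hs σ hσ
  have hle : S.cone s ≤ σ := by
    refine Submodule.span_le.2 ?_
    rintro _ ⟨i, hi, rfl⟩
    have h0 := ((hu' z).1 ⟨hz, hzσ⟩).2
    rw [pairing_sum_right, Finset.sum_eq_zero_iff_of_nonneg fun i hi => hu _ (S.rvec_mem_cone hi)]
      at h0
    exact ((hu' _).2 ⟨S.rvec_mem_cone hi, h0 i hi⟩).2
  obtain ⟨N, hN⟩ := hinf'.nonempty
  have h1 := ((S.mem_cone_iff (f := ()) (Finset.subset_univ s)).1 (hmax σ hσ hle hN) i₀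
    (Finset.mem_univ _)).2 hi₀
  have h2 := ((S.mem_cone_iff (f := ()) (Finset.subset_univ s)).1 hz i₀ (Finset.mem_univ _)).2 hi₀
  rw [pairing_add_right, h2, pairing_smul_right,
    S.pairing_dual_rvec (f := ()) (Finset.mem_univ _) (Finset.mem_univ _), if_pos rfl] at h1
  have : (0 : ℝ) < 1 / ((N : ℝ) + 1) := by positivity
  linarith

/-! ### Cones of a nonsingular fan in terms of primitive ray generators. -/

namespace Fan.IsLabelling

variable {vec : V → Fin n → ℤ}

/-- Each edge of `σ` is a ray of the fan, hence labelled. Conversely, a labelled ray inside `σ` is a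
face of `σ`, so a basis vector occurring in its generator lies on that ray, and primitive vectors on
one ray coincide. -/
theorem exists_frame (hv : Δ.IsLabelling vec) (hns : Δ.IsNonsingular) {σ} (hσ : σ ∈ Δ.cones) :
    ∃ (b : Module.Basis (Fin n) ℤ (Fin n → ℤ)) (s : Finset (Fin n)), σ = (ofBasis b).cone s ∧
      (∀ i ∈ s, ∃ x, vec x = b i) ∧ ∀ x, toReal (vec x) ∈ σ → ∃ i ∈ s, vec x = b i := by
  obtain ⟨b, s, rfl⟩ := hns.exists_finset hσ
  refine ⟨b, s, rfl, fun i hi => ?_, fun x hx => ?_⟩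
  · have h1 := Fan.cone_mem_of_subset hσ (Finset.singleton_subset_iff.2 hi)
    have h2 : (ofBasis b).cone {i} = PointedCone.hull ℝ {toReal (b i)} := by
      rw [UnimodularSystem.cone, Finset.coe_singleton, Set.image_singleton]
      rfl
    rw [h2] at h1
    obtain ⟨x, hx⟩ := hv.exists_of_mem_rays _ ⟨h1, _, ofBasis_rvec_ne_zero b i, rfl⟩
    obtain ⟨b', j, hj⟩ := hv.exists_basis x
    refine ⟨x, ?_⟩
    rw [hj] at hx ⊢
    exact (eq_of_hull_eq hx).symm
  · obtain ⟨u, hu, hu'⟩ := Δ.inf_isFace _ hσ _ (hv.cone_mem x)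
    have h0 := ((hu' _).1 ⟨hx, PointedCone.subset_hull rfl⟩).2
    have hd := ((ofBasis b).mem_cone_iff (f := ()) (Finset.subset_univ s)).1 hx
    rw [(ofBasis b).pairing_eq_sum (), Finset.sum_eq_zero_iff_of_nonneg] at h0
    · obtain ⟨i, hi, hid⟩ : ∃ i ∈ (ofBasis b).facet (),
          pairing ((ofBasis b).dual () i) (toReal (vec x)) ≠ 0 := by
        by_contra! h
        obtain ⟨b', j, hj⟩ := hv.exists_basis x
        refine ofBasis_rvec_ne_zero b' j ?_
        rw [← hj, ← (ofBasis b).sum_dual_rvec () (toReal (vec x))]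
        exact Finset.sum_eq_zero fun i hi => by rw [h i hi, zero_smul]
      have his : i ∈ s := by
        by_contra h
        exact hid ((hd i hi).2 h)
      refine ⟨i, his, ?_⟩
      have hmem := ((hu' _).2 ⟨(ofBasis b).rvec_mem_cone his,
        (mul_eq_zero.1 (h0 i hi)).resolve_left hid⟩).2
      have := hull_singleton_eq hmem (ofBasis_rvec_ne_zero b i)
      obtain ⟨b', j, hj⟩ := hv.exists_basis x
      rw [hj] at this ⊢
      exact (eq_of_hull_eq this).symm
    · intro i hi
      by_cases his : i ∈ s
      · exact mul_nonneg (hd i hi).1 (hu _ ((ofBasis b).rvec_mem_cone his))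
      · rw [(hd i hi).2 his, zero_mul]

theorem eq_hull (hv : Δ.IsLabelling vec) (hns : Δ.IsNonsingular) {σ} (hσ : σ ∈ Δ.cones) :
    σ = PointedCone.hull ℝ ((fun x => toReal (vec x)) '' {x | toReal (vec x) ∈ σ}) := by
  refine le_antisymm ?_ (Submodule.span_le.2 ?_)
  · obtain ⟨b, s, h, h1, -⟩ := hv.exists_frame hns hσ
    conv_lhs => rw [h]
    refine Submodule.span_mono ?_
    rintro _ ⟨i, hi, rfl⟩
    obtain ⟨x, hx⟩ := h1 i hi
    refine ⟨x, ?_, congrArg toReal hx⟩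
    rw [Set.mem_ofPred_eq, hx, h]
    exact (ofBasis b).rvec_mem_cone hi
  · rintro _ ⟨x, hx, rfl⟩
    exact hx

/-- The unimodular system of a complete nonsingular fan over the complex with facets `F`. -/
theorem exists_unimodularSystem [Fintype V] [DecidableEq V] {ι : Type*} [Nonempty ι]
    (hv : Δ.IsLabelling vec) (hc : Δ.IsComplete) (hns : Δ.IsNonsingular) (F : ι → Finset V)
    (hF : ∀ s : Finset V, s.Nonempty →
      ((∃ σ ∈ Δ.cones, ∀ x, x ∈ s ↔ toReal (vec x) ∈ σ) ↔ ∃ f, s ⊆ F f))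
    (hne : ∀ f, (F f).Nonempty) (hmax : ∀ f g, F f ⊆ F g → F f = F g) :
    ∃ S : UnimodularSystem n V ι, S.vec = vec ∧ S.facet = F ∧
      ∀ σ, σ ∈ Δ.cones ↔ ∃ s, (∃ f, s ⊆ F f) ∧ σ = S.cone s := by
  classical
  have hdual : ∀ f, ∃ D : V → Fin n → ℤ,
      (∀ x ∈ F f, ∀ y ∈ F f, pairing (D x) (toReal (vec y)) = if x = y then 1 else 0) ∧
      ∀ z, ∑ x ∈ F f, pairing (D x) z • toReal (vec x) = z := by
    intro f
    obtain ⟨σ, hσ, hxσ⟩ := (hF (F f) (hne f)).2 ⟨f, subset_rfl⟩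
    obtain ⟨b, s, hs, h1, h2⟩ := hv.exists_frame hns hσ
    -- The generators in a larger cone form a face containing `F f`, hence equal to it; so `σ` is
    -- maximal and therefore full-dimensional.
    have huniv : s = Finset.univ := by
      refine hc.eq_univ_of_maximal hns (b := b) (hs ▸ hσ) fun τ hτ hle => ?_
      rw [← hs] at hle ⊢
      let t := Finset.univ.filter fun x => toReal (vec x) ∈ τ
      have hsub : F f ⊆ t := fun x hx =>
        Finset.mem_filter.2 ⟨Finset.mem_univ _, hle ((hxσ x).1 hx)⟩
      obtain ⟨g, hg⟩ := (hF t ((hne f).mono hsub)).1 ⟨τ, hτ, fun x => by simp [t]⟩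
      have heq := hmax f g (hsub.trans hg)
      rw [hv.eq_hull hns hτ, hv.eq_hull hns hσ]
      refine Submodule.span_mono (Set.image_mono fun x hx => (hxσ x).1 ?_)
      rw [heq]
      exact hg (Finset.mem_filter.2 ⟨Finset.mem_univ _, hx⟩)
    subst huniv
    choose i _ hi using fun x : F f => h2 x ((hxσ x).1 x.2)
    have hinj : Function.Injective i := fun x y h => Subtype.ext (hv.injective (by
      rw [hi, hi, h]))
    have hsurj : Function.Surjective i := by
      intro j
      obtain ⟨x, hx⟩ := h1 j (Finset.mem_univ j)
      have hxF : x ∈ F f := by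
        rw [hxσ, hx, hs]
        exact (ofBasis b).rvec_mem_cone (Finset.mem_univ j)
      exact ⟨⟨x, hxF⟩, b.injective (by rw [← hi, ← hx])⟩
    refine ⟨fun x => if h : x ∈ F f then (ofBasis b).dual () (i ⟨x, h⟩) else 0,
      fun x hx y hy => ?_, fun z => ?_⟩
    · beta_reduce
      rw [dif_pos hx, hi ⟨y, hy⟩]
      refine ((ofBasis b).pairing_dual_rvec (f := ()) (Finset.mem_univ _)
        (Finset.mem_univ _)).trans ?_
      simp [hinj.eq_iff]
    · conv_rhs => rw [← (ofBasis b).sum_dual_rvec () z]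
      rw [← Finset.sum_attach]
      refine Fintype.sum_bijective i ⟨hinj, hsurj⟩ _ _ fun x => ?_
      beta_reduce
      rw [dif_pos x.2, hi x]
      rfl
  choose D hD1 hD2 using hdual
  let S : UnimodularSystem n V ι := ⟨vec, F, D, hD1, hD2⟩
  have hcone : ∀ σ ∈ Δ.cones, ∀ s : Finset V, (∀ x, x ∈ s ↔ toReal (vec x) ∈ σ) →
      σ = S.cone s := by
    intro σ hσ s hs
    conv_lhs => rw [hv.eq_hull hns hσ]
    have : {x | toReal (vec x) ∈ σ} = (s : Set V) := Set.ext fun x => (hs x).symm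
    rw [this]
    rfl
  refine ⟨S, rfl, rfl, fun σ => ⟨fun hσ => ?_, ?_⟩⟩
  · refine ⟨Finset.univ.filter fun x => toReal (vec x) ∈ σ, ?_, hcone σ hσ _ fun x => by simp⟩
    rcases (Finset.univ.filter fun x => toReal (vec x) ∈ σ).eq_empty_or_nonempty with h | h
    · exact ⟨Classical.arbitrary ι, by rw [h]; exact Finset.empty_subset _⟩
    · exact (hF _ h).1 ⟨σ, hσ, fun x => by simp⟩
  · rintro ⟨s, hs, rfl⟩
    rcases s.eq_empty_or_nonempty with rfl | h
    · obtain ⟨σ, hσ, -⟩ := hc 0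
      obtain ⟨b, s, rfl⟩ := hns.exists_finset hσ
      have := Fan.cone_mem_of_subset hσ (Finset.empty_subset s)
      simpa [UnimodularSystem.cone] using this
    · obtain ⟨σ, hσ, hx⟩ := (hF s h).2 hs
      rwa [← hcone σ hσ s hx]

end Fan.IsLabelling

end

/-! ### Toric manifolds over iterated wedges of polygons -/

section Maximal

variable {M : ℕ} {κ : Fin (M + 3) → Type*} [∀ i, Fintype (κ i)] [∀ i, DecidableEq (κ i)]

/-- On complements, whatever `g` misses is missed by `f`. So the edge of `f` lies in that of `g`,
the edges agree, and so do the missing copies; at the ends of the edge `k` plays no role. -/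
theorem wedgeFacet_eq_of_subset {f g : Fin (M + 3) × ∀ i, κ i}
    (h : wedgeFacet f ⊆ wedgeFacet g) : wedgeFacet f = wedgeFacet g := by
  obtain ⟨a, k⟩ := f
  obtain ⟨a', k'⟩ := g
  have key : ∀ i, i ≠ a' → i ≠ a' + 1 → i ≠ a ∧ i ≠ a + 1 ∧ k' i = k i := by
    intro i h1 h2
    have := mt (@h ⟨i, k' i⟩) (notMem_wedgeFacet.2 ⟨h1, h2, rfl⟩)
    rw [mem_wedgeFacet] at this
    push Not at this
    exact this
  have haa : a = a' := by
    by_contra hne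
    have h1 : a = a' + 1 := by
      by_contra h1
      exact (key a hne h1).1 rfl
    subst h1
    exact (key (a' + 1 + 1) (fin_add_one_add_one_ne a') (fin_add_one_ne _)).2.1 rfl
  subst haa
  ext x
  simp only [mem_wedgeFacet]
  by_cases h1 : x.1 = a
  · simp [h1]
  by_cases h2 : x.1 = a + 1
  · simp [h2]
  simp [h1, h2, (key x.1 h1 h2).2.2]

theorem wedgeFacet_nonempty (f : Fin (M + 3) × ∀ i, κ i) : (wedgeFacet f).Nonempty :=
  ⟨⟨f.1, f.2 f.1⟩, mem_wedgeFacet.2 (Or.inl rfl)⟩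

end Maximal

/-- In a fan, the cone of a facet of an iterated wedge does not contain the projections of other
rays. -/
theorem UnimodularSystem.isWedge_of_fan {n M : ℕ} {κ : Fin (M + 3) → Type*}
    [∀ i, Fintype (κ i)] [∀ i, DecidableEq (κ i)]
    {S : UnimodularSystem n (Σ i, κ i) (Fin (M + 3) × ∀ i, κ i)} {Δ : Fan n}
    (hfacet : S.facet = wedgeFacet) (hmem : ∀ f, S.cone (wedgeFacet f) ∈ Δ.cones)
    (hcone : ∀ f x, S.rvec x ∈ S.cone (wedgeFacet f) → x ∈ wedgeFacet f) : S.IsWedge := by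
  refine ⟨fun f => by rw [hfacet], ?_⟩
  rintro ⟨a, k⟩ x hx ⟨h1, h2⟩
  obtain ⟨hxa, hxa', hxk⟩ := notMem_wedgeFacet.1 hx
  let T : Finset (Σ i, κ i) := Finset.univ.filter fun y => y.2 ≠ k y.1
  have hT : ∀ b, T ⊆ wedgeFacet (b, k) := fun b y hy =>
    mem_wedgeFacet.2 (Or.inr (Or.inr (Finset.mem_filter.1 hy).2))
  obtain ⟨N, hN0, hN⟩ : ∃ N : ℝ, 0 ≤ N ∧
      ∀ y, 0 ≤ pairing (S.dual (a, k) y) (S.rvec x) + N := by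
    refine ⟨∑ y, |pairing (S.dual (a, k) y) (S.rvec x)|,
      Finset.sum_nonneg fun _ _ => abs_nonneg _, fun y => ?_⟩
    have := Finset.single_le_sum (f := fun y => |pairing (S.dual (a, k) y) (S.rvec x)|)
      (fun _ _ => abs_nonneg _) (Finset.mem_univ y)
    have h3 := neg_abs_le (pairing (S.dual (a, k) y) (S.rvec x))
    linarith
  -- A large multiple of the vectors off the transversal makes the remaining coordinates nonnegative
  -- and lifts `x` from the projected cone into the cone of `(a, k)`.
  let z := S.rvec x + N • ∑ y ∈ T, S.rvec y
  have hz : z ∈ S.cone (wedgeFacet (a, k)) := by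
    have hF : S.facet (a, k) = wedgeFacet (a, k) := by rw [hfacet]
    rw [← hF, S.mem_cone_facet_iff]
    intro y hy
    have h3 : pairing (S.dual (a, k) y) (∑ y ∈ T, S.rvec y) = if y ∈ T then 1 else 0 := by
      rw [pairing_sum_right, Finset.sum_congr rfl fun t ht =>
        S.pairing_dual_rvec hy (hF ▸ hT a ht)]
      simp
    rw [pairing_add_right, pairing_smul_right, h3]
    by_cases hyT : y ∈ T
    · rw [if_pos hyT, mul_one]
      exact hN y
    · rw [if_neg hyT, mul_zero, add_zero]
      have hyk : y = ⟨y.1, k y.1⟩ := by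
        have : y.2 = k y.1 := by simpa [T] using hyT
        rw [← this]
      rw [hF, mem_wedgeFacet] at hy
      rcases hy with hy | hy | hy
      · rw [hyk, hy]
        exact h1
      · rw [hyk, hy]
        exact h2
      · exact absurd hy (by simpa [T] using hyT)
  -- The summands of `z` lie in the cone of `(x.1, k)`, which meets the cone of `(a, k)` in a face.
  -- A face containing `z` contains the summand `x`.
  have hxF : S.rvec x ∈ S.cone (wedgeFacet (x.1, k)) :=
    S.rvec_mem_cone (mem_wedgeFacet.2 (Or.inl rfl))
  have hTF : ∑ y ∈ T, S.rvec y ∈ S.cone (wedgeFacet (x.1, k)) :=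
    Submodule.sum_mem _ fun y hy => S.rvec_mem_cone (hT _ hy)
  obtain ⟨u, hu, hu'⟩ := Δ.inf_isFace _ (hmem (x.1, k)) _ (hmem (a, k))
  have h0 := ((hu' z).1 ⟨add_mem hxF (smul_mem_cone hTF hN0), hz⟩).2
  rw [pairing_add_right, pairing_smul_right] at h0
  have h3 := hu _ hxF
  have h4 := mul_nonneg hN0 (hu _ hTF)
  exact hx (hcone _ x ((hu' _).2 ⟨hxF, by linarith⟩).2)

theorem Fan.IsToricManifoldOver.exists_ampleSystem {n M : ℕ} {J : Fin (M + 3) → ℕ+} {Δ : Fan n}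
    (hΔ : Δ.IsToricManifoldOver (multiWedge (polygon (M + 3)) J)) :
    ∃ S : AmpleSystem n (Σ i, Fin (J i)) (Fin (M + 3) × ∀ i, Fin (J i)), S.Spans Δ := by
  obtain ⟨hc, hns, e, he⟩ := hΔ
  obtain ⟨vec, hv, hvec⟩ := hns.exists_labelling e
  have hle : ∀ x σ, (e x : PointedCone ℝ (Fin n → ℝ)) ≤ σ ↔ toReal (vec x) ∈ σ := by
    intro x σ
    rw [hvec]
    exact Submodule.span_singleton_le_iff_mem _ _
  have hF : ∀ s : Finset (Σ i, Fin (J i)), s.Nonempty →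
      ((∃ σ ∈ Δ.cones, ∀ x, x ∈ s ↔ toReal (vec x) ∈ σ) ↔ ∃ f, s ⊆ wedgeFacet f) := by
    intro s hs
    rw [← mem_multiWedge_polygon_iff J s hs, he s hs]
    simp only [hle]
  obtain ⟨S, hSv, hSf, hS⟩ := hv.exists_unimodularSystem hc hns wedgeFacet hF
    wedgeFacet_nonempty fun f g => wedgeFacet_eq_of_subset
  have hW : S.IsWedge := by
    refine UnimodularSystem.isWedge_of_fan (Δ := Δ) hSf
      (fun f => (hS _).2 ⟨_, ⟨f, subset_rfl⟩, rfl⟩) fun f x hx => ?_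
    have hrvec : ∀ x, S.rvec x = toReal (vec x) := fun x => by
      rw [UnimodularSystem.rvec, hSv]
    obtain ⟨σ, hσ, h⟩ := (hF _ (wedgeFacet_nonempty f)).2 ⟨f, subset_rfl⟩
    rw [h, ← hrvec]
    refine (Submodule.span_le.2 ?_ : S.cone (wedgeFacet f) ≤ σ) hx
    rintro _ ⟨y, hy, rfl⟩
    rw [hrvec]
    exact (h y).1 hy
  refine ⟨hW.ampleSystem, fun σ => ?_⟩
  rw [hS]
  exact exists_congr fun s => and_congr_left' (hW.isFace_iff s).symm

/-! ### A toric manifold over every iterated wedge of a polygon -/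

/-- A unimodular system from integral matrices with an arbitrary index set of coordinates. -/
def UnimodularSystem.ofMatrix {V ι B : Type*} [DecidableEq V] [Fintype B] (vec : V → B → ℤ)
    (facet : ι → Finset V) (dual : ι → V → B → ℤ)
    (h : ∀ f, ∀ x ∈ facet f, ∀ y ∈ facet f, ∑ b, dual f x b * vec y b = if x = y then 1 else 0)
    (hcard : ∀ f, (facet f).card = Fintype.card B) :
    UnimodularSystem (Fintype.card B) V ι where
  vec x := vec x ∘ (Fintype.equivFin B).symm
  facet := facet
  dual f x := dual f x ∘ (Fintype.equivFin B).symm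
  pairing_dual f x hx y hy := by
    rw [pairing_toReal]
    simp only [Function.comp_apply]
    rw [Equiv.sum_comp (Fintype.equivFin B).symm fun b => dual f x b * vec y b, h f x hx y hy]
    split_ifs <;> simp
  sum_dual f z := by
    classical
    have h1 : (Matrix.of fun (x : facet f) b => dual f x b) *
        (Matrix.of fun b (x : facet f) => vec x b) = 1 := by
      ext x y
      simp only [Matrix.mul_apply, Matrix.of_apply, Matrix.one_apply]
      rw [h f x x.2 y y.2]
      by_cases hxy : x = y
      · simp [hxy]
      · rw [if_neg hxy, if_neg fun h => hxy (Subtype.ext h)]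
    -- A one-sided inverse of a square integral matrix is two-sided, so duality alone yields the
    -- basis expansion.
    replace h1 := (Matrix.mul_eq_one_comm_of_card_eq _ _ _ (by simpa using hcard f)).1 h1
    have h2 : ∀ b b', ∑ x ∈ facet f, (vec x b : ℝ) * dual f x b' = if b = b' then 1 else 0 := by
      intro b b'
      have := congrFun (congrFun h1 b) b'
      simp only [Matrix.mul_apply, Matrix.of_apply, Matrix.one_apply] at this
      rw [Finset.sum_coe_sort (facet f) fun x => vec x b * dual f x b'] at this
      exact_mod_cast this
    funext j
    simp only [Finset.sum_apply, Pi.smul_apply, smul_eq_mul, pairing, toReal, Function.comp_apply,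
      Finset.sum_mul]
    rw [Finset.sum_comm]
    have h3 : ∀ i, ∑ x ∈ facet f, (dual f x ((Fintype.equivFin B).symm i) : ℝ) * z i *
        vec x ((Fintype.equivFin B).symm j) = if j = i then z i else 0 := by
      intro i
      have := h2 ((Fintype.equivFin B).symm j) ((Fintype.equivFin B).symm i)
      simp only [EmbeddingLike.apply_eq_iff_eq] at this
      rw [← mul_one (z i), ← mul_ite_zero, ← this, Finset.mul_sum]
      exact Finset.sum_congr rfl fun x _ => by ring
    simp [h3]

section Extension

variable {M : ℕ} {κ : Fin (M + 3) → Type*} [∀ i, Fintype (κ i)] [∀ i, DecidableEq (κ i)]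

/-- The coordinates of the canonical extension: those of the plane, and one for every added
vertex. -/
abbrev ExtIndex (k₀ : ∀ i, κ i) : Type _ := Fin 2 ⊕ {x : Σ i, κ i // x.2 ≠ k₀ x.1}

theorem card_wedgeFacet (k₀ : ∀ i, κ i) (f : Fin (M + 3) × ∀ i, κ i) :
    (wedgeFacet f).card = Fintype.card (ExtIndex k₀) := by
  have hinj : ∀ k : ∀ i, κ i, Function.Injective fun i => (⟨i, k i⟩ : Σ i, κ i) :=
    fun k i j h => congrArg Sigma.fst h
  have h1 : (wedgeFacet f)ᶜ = ({f.1, f.1 + 1}ᶜ : Finset (Fin (M + 3))).image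
      fun i => (⟨i, f.2 i⟩ : Σ i, κ i) := by
    ext x
    rw [Finset.mem_compl, notMem_wedgeFacet]
    simp only [Finset.mem_image, Finset.mem_compl, Finset.mem_insert, Finset.mem_singleton, not_or]
    constructor
    · exact fun h => ⟨x.1, ⟨h.1, h.2.1⟩, h.2.2.symm⟩
    · rintro ⟨i, hi, rfl⟩
      exact ⟨hi.1, hi.2, rfl⟩
  have h2 : (Finset.univ.filter fun x : Σ i, κ i => x.2 ≠ k₀ x.1)ᶜ =
      Finset.univ.image fun i => (⟨i, k₀ i⟩ : Σ i, κ i) := by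
    ext x
    simp only [Finset.mem_compl, Finset.mem_filter, Finset.mem_univ, true_and, not_not,
      Finset.mem_image]
    constructor
    · exact fun h => ⟨x.1, by rw [← h]⟩
    · rintro ⟨i, rfl⟩
      rfl
  have e1 := Finset.card_add_card_compl (wedgeFacet f)
  have e2 := Finset.card_add_card_compl (Finset.univ.filter fun x : Σ i, κ i => x.2 ≠ k₀ x.1)
  have e3 := Finset.card_add_card_compl ({f.1, f.1 + 1} : Finset (Fin (M + 3)))
  rw [h1, Finset.card_image_of_injective _ (hinj _)] at e1
  rw [h2, Finset.card_image_of_injective _ (hinj _), Finset.card_univ, Fintype.card_fin] at e2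
  rw [Finset.card_pair (fin_add_one_ne f.1).symm, Fintype.card_fin] at e3
  rw [Fintype.card_sum, Fintype.card_fin, Fintype.card_subtype]
  omega

variable (w : Fin (M + 3) → Fin 2 → ℤ)

/-- The rays of the canonical extension of the rays `w` in the plane. -/
def extVec (k₀ : ∀ i, κ i) (x : Σ i, κ i) : ExtIndex k₀ → ℤ
  | .inl t => if x.2 = k₀ x.1 then w x.1 t else 0
  | .inr y => (if x = y then 1 else 0) - if x.2 = k₀ x.1 ∧ x.1 = y.1.1 then 1 else 0

/-- The dual basis of two consecutive rays, as functions on the copies of these rays. -/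
def planeDual (a j : Fin (M + 3)) : Fin 2 → ℤ :=
  if j = a then ![w (a + 1) 1, -w (a + 1) 0]
  else if j = a + 1 then ![-w a 1, w a 0] else 0

/-- The values of a dual vector of the canonical extension on the rays. -/
def extVal (f : Fin (M + 3) × ∀ i, κ i) (x y : Σ i, κ i) : ℤ :=
  if y ∈ wedgeFacet f then if x = y then 1 else 0
  else planeDual w f.1 x.1 ⬝ᵥ w y.1 - if x.1 = y.1 then 1 else 0

/-- The dual vectors of the canonical extension. -/
def extDual (k₀ : ∀ i, κ i) (f : Fin (M + 3) × ∀ i, κ i) (x : Σ i, κ i) : ExtIndex k₀ → ℤ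
  | .inl t => planeDual w f.1 x.1 t
  | .inr y => extVal w f x y

/-- Consecutive rays form a lattice basis. -/
def IsUnimodularCycle : Prop := ∀ a, w a 0 * w (a + 1) 1 - w a 1 * w (a + 1) 0 = 1

variable {w}

/-- The copies of `i` in the extension add up to `(w i, 0)`, so a dual vector must have this total
on them. This is what dictates the value of `extVal` at the missing copy. -/
theorem sum_extVal (hw : IsUnimodularCycle w) {f : Fin (M + 3) × ∀ i, κ i} {x : Σ i, κ i}
    (hx : x ∈ wedgeFacet f) (i : Fin (M + 3)) :
    ∑ l, extVal w f x ⟨i, l⟩ = planeDual w f.1 x.1 ⬝ᵥ w i := by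
  obtain ⟨a, k⟩ := f
  obtain ⟨j, l₀⟩ := x
  have hdet := hw a
  by_cases hi : i = a ∨ i = a + 1
  · have h1 : ∀ l, extVal w (a, k) ⟨j, l₀⟩ ⟨i, l⟩ =
        if (⟨j, l₀⟩ : Σ i, κ i) = ⟨i, l⟩ then 1 else 0 := fun l =>
      if_pos (mem_wedgeFacet.2 (hi.imp_right Or.inl))
    simp only [h1]
    by_cases hj : j = i
    · subst hj
      have : ∀ l, ((⟨j, l₀⟩ : Σ i, κ i) = ⟨j, l⟩) ↔ l₀ = l := fun l => by simp
      simp only [this, Finset.sum_ite_eq, Finset.mem_univ, if_true]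
      rcases hi with rfl | rfl
      · simp only [planeDual, if_true, dotProduct, Fin.sum_univ_two, Matrix.cons_val_zero,
          Matrix.cons_val_one]
        linarith
      · simp only [planeDual, fin_add_one_ne, if_true, if_false, dotProduct, Fin.sum_univ_two,
          Matrix.cons_val_zero, Matrix.cons_val_one]
        linarith
    · have h2 : ∀ l, (⟨j, l₀⟩ : Σ i, κ i) ≠ ⟨i, l⟩ := fun l h => hj (congrArg Sigma.fst h)
      simp only [h2, if_false, Finset.sum_const_zero]
      rcases hi with rfl | rfl
      · simp only [planeDual, hj, if_false]
        split_ifs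
        · simp only [dotProduct, Fin.sum_univ_two, Matrix.cons_val_zero, Matrix.cons_val_one]
          ring
        · simp
      · simp only [planeDual, hj, if_false]
        split_ifs
        · simp only [dotProduct, Fin.sum_univ_two, Matrix.cons_val_zero, Matrix.cons_val_one]
          ring
        · simp
  · push Not at hi
    rw [← Finset.sum_erase_add _ _ (Finset.mem_univ (k i))]
    have h1 : extVal w (a, k) ⟨j, l₀⟩ ⟨i, k i⟩ =
        planeDual w a j ⬝ᵥ w i - if j = i then 1 else 0 :=
      if_neg (notMem_wedgeFacet.2 ⟨hi.1, hi.2, rfl⟩)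
    have h2 : ∀ l ∈ Finset.univ.erase (k i), extVal w (a, k) ⟨j, l₀⟩ ⟨i, l⟩ =
        if (⟨j, l₀⟩ : Σ i, κ i) = ⟨i, l⟩ then 1 else 0 := fun l hl =>
      if_pos (mem_wedgeFacet.2 (Or.inr (Or.inr (Finset.ne_of_mem_erase hl))))
    rw [h1, Finset.sum_congr rfl h2]
    by_cases hj : j = i
    · subst hj
      have hl : l₀ ≠ k j := by
        have := mem_wedgeFacet.1 hx
        simpa [hi.1, hi.2] using this
      have : ∀ l, ((⟨j, l₀⟩ : Σ i, κ i) = ⟨j, l⟩) ↔ l₀ = l := fun l => by simp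
      simp [this, hl]
    · have h2 : ∀ l, (⟨j, l₀⟩ : Σ i, κ i) ≠ ⟨i, l⟩ := fun l h => hj (congrArg Sigma.fst h)
      simp [h2, hj]

/-- For an added vertex the vector is a coordinate vector, and the claim is the definition of
`extDual`. For a vertex on `k₀`, the value is the total over its copies minus the values at the
other copies. -/
theorem extDual_dotProduct_extVec (hw : IsUnimodularCycle w) (k₀ : ∀ i, κ i)
    {f : Fin (M + 3) × ∀ i, κ i} {x : Σ i, κ i} (hx : x ∈ wedgeFacet f) (y : Σ i, κ i) :
    ∑ b, extDual w k₀ f x b * extVec w k₀ y b = extVal w f x y := by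
  rw [Fintype.sum_sum_type]
  simp only [extDual, extVec]
  have hsub : ∀ g : (Σ i, κ i) → ℤ, ∑ z : {x : Σ i, κ i // x.2 ≠ k₀ x.1}, g z =
      ∑ z, if z.2 ≠ k₀ z.1 then g z else 0 := by
    intro g
    rw [← Finset.sum_filter]
    exact (Finset.sum_subtype _ (by simp) g).symm
  rw [hsub fun z => extVal w f x z *
    ((if y = z then 1 else 0) - if y.2 = k₀ y.1 ∧ y.1 = z.1 then 1 else 0)]
  by_cases hy : y.2 = k₀ y.1
  · have h1 : ∀ z : Σ i, κ i, (if z.2 ≠ k₀ z.1 then extVal w f x z *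
        ((if y = z then 1 else 0) - if y.2 = k₀ y.1 ∧ y.1 = z.1 then 1 else 0) else 0) =
        -if y.1 = z.1 then if z.2 ≠ k₀ z.1 then extVal w f x z else 0 else 0 := by
      intro z
      by_cases hz : z.2 = k₀ z.1
      · simp [hz]
      · have : y ≠ z := by
          rintro rfl
          exact hz hy
        simp only [hz, hy, this, ne_eq, not_false_eq_true, if_true, if_false, true_and]
        split_ifs <;> ring
    rw [Finset.sum_congr rfl fun z _ => h1 z, Finset.sum_neg_distrib, Fintype.sum_sigma,
      Finset.sum_eq_single y.1]
    · have h2 := sum_extVal hw hx y.1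
      rw [← Finset.sum_erase_add _ _ (Finset.mem_univ y.2)] at h2
      have h3 : ∑ l, (if y.1 = y.1 then if l ≠ k₀ y.1 then extVal w f x ⟨y.1, l⟩ else 0 else 0) =
          ∑ l ∈ Finset.univ.erase y.2, extVal w f x ⟨y.1, l⟩ := by
        simp only [if_true]
        rw [← Finset.sum_filter, hy]
        refine Finset.sum_congr ?_ fun _ _ => rfl
        ext l
        simp
      rw [h3]
      simp only [hy, if_true] at h2 ⊢
      have h4 : ∑ t, planeDual w f.1 x.1 t * w y.1 t = planeDual w f.1 x.1 ⬝ᵥ w y.1 := rfl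
      rw [h4, ← h2, ← hy]
      ring
    · intro i _ hi
      simp [Ne.symm hi]
    · simp
  · rw [Finset.sum_eq_single y]
    · simp [hy]
    · intro z _ hz
      simp [hy, Ne.symm hz]
    · simp

/-- The canonical extension of a planar fan to the iterated wedge of a polygon. -/
def extSystem (hw : IsUnimodularCycle w) (k₀ : ∀ i, κ i) :
    UnimodularSystem (Fintype.card (ExtIndex k₀)) (Σ i, κ i) (Fin (M + 3) × ∀ i, κ i) :=
  .ofMatrix (extVec w k₀) wedgeFacet (extDual w k₀)
    (fun _ _ hx y hy => (extDual_dotProduct_extVec hw k₀ hx y).trans (if_pos hy))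
    (card_wedgeFacet k₀)

theorem pairing_extSystem (hw : IsUnimodularCycle w) (k₀ : ∀ i, κ i)
    {f : Fin (M + 3) × ∀ i, κ i} {x : Σ i, κ i} (hx : x ∈ wedgeFacet f) (y : Σ i, κ i) :
    pairing ((extSystem hw k₀).dual f x) ((extSystem hw k₀).rvec y) = extVal w f x y := by
  rw [← extDual_dotProduct_extVec hw k₀ hx y]
  refine (pairing_toReal _ _).trans (congrArg _ ?_)
  exact Equiv.sum_comp (Fintype.equivFin _).symm fun b => extDual w k₀ f x b * extVec w k₀ y b

/-- By Cramer's rule, the pairings with the two dual vectors of the edge are the coordinates of the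
planar ray in the basis `w a`, `w (a + 1)`. -/
theorem isWedge_extSystem (hw : IsUnimodularCycle w) (k₀ : ∀ i, κ i)
    (hw' : ∀ a i, i ≠ a → i ≠ a + 1 → ¬ (0 ≤ w i 0 * w (a + 1) 1 - w i 1 * w (a + 1) 0 ∧
      0 ≤ w a 0 * w i 1 - w a 1 * w i 0)) : (extSystem hw k₀).IsWedge := by
  refine ⟨fun f => rfl, ?_⟩
  rintro ⟨a, k⟩ x hx ⟨h1, h2⟩
  rw [pairing_extSystem hw k₀ (mem_wedgeFacet.2 (by simp))] at h1 h2
  obtain ⟨hxa, hxa', -⟩ := notMem_wedgeFacet.1 hx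
  refine hw' a x.1 hxa hxa' ⟨?_, ?_⟩
  · have : extVal w (a, k) ⟨a, k a⟩ x = w x.1 0 * w (a + 1) 1 - w x.1 1 * w (a + 1) 0 := by
      rw [extVal, if_neg hx]
      simp only [planeDual, if_true, dotProduct, Fin.sum_univ_two, Matrix.cons_val_zero,
          Matrix.cons_val_one, hxa.symm, if_false]
      ring
    rw [← this]
    exact_mod_cast h1
  · have : extVal w (a, k) ⟨a + 1, k (a + 1)⟩ x = w a 0 * w x.1 1 - w a 1 * w x.1 0 := by
      rw [extVal, if_neg hx]
      simp only [planeDual, fin_add_one_ne, if_true, dotProduct, Fin.sum_univ_two,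
        Matrix.cons_val_zero, Matrix.cons_val_one, hxa'.symm, if_false]
      ring
    rw [← this]
    exact_mod_cast h2

end Extension

/-- The rays `(1, 0), (1, 1), …, (1, M), (0, 1), (-1, -1)`. -/
def planeRays (M : ℕ) (i : Fin (M + 3)) : Fin 2 → ℤ :=
  if i.1 ≤ M then ![1, (i.1 : ℤ)] else if i.1 = M + 1 then ![0, 1] else ![-1, -1]

theorem planeRays_cases {M : ℕ} (a : Fin (M + 3)) :
    (a.1 < M ∧ planeRays M a = ![1, (a.1 : ℤ)] ∧ planeRays M (a + 1) = ![1, (a.1 : ℤ) + 1] ∧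
      (a + 1).1 = a.1 + 1) ∨
    (a.1 = M ∧ planeRays M a = ![1, (M : ℤ)] ∧ planeRays M (a + 1) = ![0, 1] ∧ (a + 1).1 = M + 1) ∨
    (a.1 = M + 1 ∧ planeRays M a = ![0, 1] ∧ planeRays M (a + 1) = ![-1, -1] ∧
      (a + 1).1 = M + 2) ∨
    (a.1 = M + 2 ∧ planeRays M a = ![-1, -1] ∧ planeRays M (a + 1) = ![1, 0] ∧
      (a + 1).1 = 0) := by
  have ha := a.2
  have h1 : (a + 1).1 = if a.1 = M + 2 then 0 else a.1 + 1 := by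
    rw [Fin.val_add_one]
    simp [Fin.ext_iff]
  unfold planeRays
  rw [h1]
  rcases lt_trichotomy a.1 M with h | h | h
  · left
    simp [h, h.le, show a.1 ≠ M + 2 by omega, show a.1 + 1 ≤ M by omega]
  · right; left
    simp [h]
  · right; right
    rcases (show a.1 = M + 1 ∨ a.1 = M + 2 by omega) with h | h
    · left
      simp [h]
    · right
      simp [h]

theorem isUnimodularCycle_planeRays (M : ℕ) : IsUnimodularCycle (planeRays M) := by
  intro a
  rcases planeRays_cases a with ⟨-, h1, h2, -⟩ | ⟨-, h1, h2, -⟩ | ⟨-, h1, h2, -⟩ |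
    ⟨-, h1, h2, -⟩ <;>
    simp [h1, h2]

theorem planeRays_not_nonneg {M : ℕ} (a i : Fin (M + 3)) (hia : i ≠ a) (hia' : i ≠ a + 1) :
    ¬ (0 ≤ planeRays M i 0 * planeRays M (a + 1) 1 - planeRays M i 1 * planeRays M (a + 1) 0 ∧
      0 ≤ planeRays M a 0 * planeRays M i 1 - planeRays M a 1 * planeRays M i 0) := by
  have hi := i.2
  rw [ne_eq, Fin.ext_iff] at hia hia'
  have h3 : (i.1 ≤ M ∧ planeRays M i = ![1, (i.1 : ℤ)]) ∨ (i.1 = M + 1 ∧ planeRays M i = ![0, 1]) ∨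
      (i.1 = M + 2 ∧ planeRays M i = ![-1, -1]) := by
    rcases planeRays_cases i with ⟨h, h1, -⟩ | ⟨h, h1, -⟩ | ⟨h, h1, -⟩ | ⟨h, h1, -⟩
    · exact Or.inl ⟨h.le, h1⟩
    · exact Or.inl ⟨h.le, by rw [h1, h]⟩
    · exact Or.inr (Or.inl ⟨h, h1⟩)
    · exact Or.inr (Or.inr ⟨h, h1⟩)
  rintro ⟨p, q⟩
  rcases planeRays_cases a with ⟨h, h1, h2, h4⟩ | ⟨h, h1, h2, h4⟩ | ⟨h, h1, h2, h4⟩ |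
    ⟨h, h1, h2, h4⟩ <;> rw [h4] at hia' <;> rw [h1] at q <;> rw [h2] at p <;>
    rcases h3 with ⟨h5, h6⟩ | ⟨h5, h6⟩ | ⟨h5, h6⟩ <;> rw [h6] at p q <;>
    simp only [Matrix.cons_val_zero, Matrix.cons_val_one] at p q <;> omega

theorem exists_ampleSystem_multiWedge {M : ℕ} (J : Fin (M + 3) → ℕ+) :
    ∃ (n : ℕ) (S : AmpleSystem n (Σ i, Fin (J i)) (Fin (M + 3) × ∀ i, Fin (J i))),
      ∀ s : Finset (Σ i, Fin (J i)), s.Nonempty →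
        (s ∈ (multiWedge (polygon (M + 3)) J).faces ↔ S.IsFace s) := by
  have hW := isWedge_extSystem (isUnimodularCycle_planeRays M)
    (fun i => (⟨0, (J i).pos⟩ : Fin (J i))) planeRays_not_nonneg
  exact ⟨_, hW.ampleSystem, fun s hs => by rw [hW.isFace_iff, mem_multiWedge_polygon_iff J s hs]⟩

end ToricWedge

end

theorem theorem1p1 (m : ℕ) (hm : 3 ≤ m) (J : Fin m → ℕ+) :
    (∀ (n : ℕ) (Δ : ToricWedge.Fan n),
      Δ.IsToricManifoldOver (ToricWedge.multiWedge (ToricWedge.polygon m) J) →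
        ToricWedge.IsProjective Δ.structureMap ∧ Δ.IsStronglyPolytopal) ∧
    ToricWedge.IsStronglyCombinatoriallyDelzant
      (ToricWedge.multiWedge (ToricWedge.polygon m) J) := by
  obtain ⟨M, rfl⟩ : ∃ M, m = M + 3 := ⟨m - 3, by omega⟩
  have : Nonempty (Fin (M + 3) × ∀ i, Fin (J i)) := ⟨(0, fun i => ⟨0, (J i).pos⟩)⟩
  have : Nonempty (Σ i, Fin (J i)) := ⟨⟨0, ⟨0, (J 0).pos⟩⟩⟩
  have main : ∀ (n : ℕ) (Δ : ToricWedge.Fan n),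
      Δ.IsToricManifoldOver (ToricWedge.multiWedge (ToricWedge.polygon (M + 3)) J) →
        ToricWedge.IsProjective Δ.structureMap ∧ Δ.IsStronglyPolytopal := by
    intro n Δ hΔ
    obtain ⟨S, hS⟩ := hΔ.exists_ampleSystem
    exact ⟨hS.isProjective, hS.isStronglyPolytopal⟩
  obtain ⟨n, S, hS⟩ := ToricWedge.exists_ampleSystem_multiWedge J
  exact ⟨main, ⟨S.isPolytopal _ hS, n, S.fan,
    ⟨S.isComplete_fan, S.isNonsingular_fan, S.isOver_fan _ hS⟩, S.spans_fan.isProjective⟩,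
    fun n Δ hΔ => (main n Δ hΔ).1⟩
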